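/- A binary quantum code of length $n$ is a subspace $Q$ of $(\mathbb C^2)^{\otimes n}$. It detects a Pauli error $E$ if $PEP=cP$ for some $c\in\mathbb C$, where $P$ is the orthogonal projection onto $Q$. It is an $[[n,k,d]]$ code if $\dim Q=2^k$ and $d$ is the least weight of a Pauli error that $Q$ does not detect; it is pure if $PEP=0$ for every Pauli error $E$ of weight $w$ with $0<w<d$. A quantum code is said to come from a linear code $\mathscr C\subseteq F_2^{2n}$ that contains its symplectic dual $\mathscr C^{\perp_s}$ if it is a nonzero joint eigenspace of the Pauli operators that belong to $\mathscr C^{\perp_s}$. For polynomials $g_1,g_2,v$ over $F_2$ let $\mathscr C$ be the quasi-cyclic code of length $2n$ generated by $(v g_1,g_1)$ and $(g_2,v g_2)$ over $F_2[x]/(x^n-1)$. Write a polynomial as the string of its coefficients in ascending order, with exponents denoting repetition. For each of the following choices, $\mathscr C$ contains $\mathscr C^{\perp_s}$, and there is a pure quantum code with the stated parameters that comes from $\mathscr C$: 1. $[[45,16,8]]$: $g_1=1^201^20^71^2$, $g_2=1^40^21010^41^201$, $v=01^201^20^{34}1^201^2$; 2. $[[51,26,7]]$: $g_1=1^2$,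 $g_2=1^20^310^21^20^21^201010^21^301$, $v=0^41^2010101^201^20^31^201010^210101^20^31^201^2010101^2$; 3. $[[47,23,7]]$: $g_1=10^31^20^31^301^201^301^4$, $g_2=1^2$, $v=0^21^501^30^31^20^{16}1^20^31^301^5$; 4. $[[55,25,8]]$: $g_1=101^201^2010^2101^30^21^3$, $g_2=1^{11}$, $v=010101^4010^210^{28}10^2101^40101$; 5. $[[73,45,7]]$: $g_1=1^301^30^210^21^301^3$, $g_2=1^2010101^4$, $v=01010^21^20^{58}1^20^2101$; 6. $[[91,60,7]]$: $g_1=10^21^4010^31$, $g_2=1^20^51^4010^31^201$, $v=01^20^210^{80}10^21^2$; 7. $[[93,63,7]]$: $g_1=1^301^20^41^30101010101^201$, $g_2=1^301^2$, $v=0^31010^210^21010101^401^201010^8101^20^21^{10}0^21^2010^810101^201^40101010^210^2101$; 8. $[[105,74,7]]$: $g_1=1^201^30^310^21$, $g_2=1^2010^41^301^8$, $v=0^21010^410^{86}10^4101$. Starting from such codes, the propagation rules $[[n,k,d]]\to[[n,k-1,d]]$ for $k\ge1$ (pass to a subcode that again comes from a symplectic dual-containing code) and $[[n,k,d]]\to[[n+1,k,d]]$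 for $k>0$ (replace $Q$ by $Q\otimes|0\rangle$) yield quantum codes, again coming from symplectic dual-containing codes, with the following 36 parameters, which are pairwise distinct and different from the eight above: - $[[46,16,8]]$, $[[47,16,8]]$, $[[56,25,8]]$, $[[57,25,8]]$; - $[[48,23,7]]$, $[[49,23,7]]$, $[[50,23,7]]$, $[[51,23,7]]$, $[[51,24,7]]$, $[[51,25,7]]$; - $[[73,43,7]]$, $[[73,44,7]]$, $[[74,43,7]]$, $[[74,44,7]]$, $[[74,45,7]]$, $[[75,43,7]]$, $[[75,44,7]]$, $[[75,45,7]]$, $[[76,43,7]]$, $[[76,44,7]]$, $[[76,45,7]]$, $[[77,44,7]]$, $[[77,45,7]]$, $[[78,45,7]]$; - $[[91,58,7]]$, $[[91,59,7]]$, $[[92,59,7]]$, $[[92,60,7]]$, $[[93,62,7]]$, $[[94,63,7]]$, $[[95,63,7]]$; - $[[105,73,7]]$, $[[106,73,7]]$, $[[106,74,7]]$, $[[107,73,7]]$, $[[107,74,7]]$. For each of these the minimum distance $d$ exceeds the best one previously recorded for the same $n$ and $k$ in Grassl's code table, which is $7$ for the four codes with $d=8$ and $6$ for the 32 codes with $d=7$.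 -/

import Mathlib

open Polynomial

/-! ## Symplectic vectors and symplectic codes over the field with two elements -/

/-- The space `F₂ⁿ × F₂ⁿ = F₂²ⁿ`; the pair `(a, b)` is the word `(a | b)` of length `2n`. -/
abbrev SympVec (n : ℕ) : Type := (Fin n → ZMod 2) × (Fin n → ZMod 2)

/-- The symplectic inner product `∑ᵢ (uᵢ v_{n+i} - u_{n+i} vᵢ)`. -/
def sympInner {n : ℕ} (u v : SympVec n) : ZMod 2 :=
  ∑ i, (u.1 i * v.2 i - u.2 i * v.1 i)

/-- The symplectic dual of a linear code of length `2n`. -/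
def sympDual {n : ℕ} (C : Submodule (ZMod 2) (SympVec n)) : Submodule (ZMod 2) (SympVec n) where
  carrier := {v | ∀ u ∈ C, sympInner u v = 0}
  zero_mem' := by
    intro u _
    simp [sympInner]
  add_mem' := by
    intro v w hv hw u hu
    have h : sympInner u (v + w) = sympInner u v + sympInner u w := by
      simp only [sympInner, ← Finset.sum_add_distrib]
      refine Finset.sum_congr rfl fun i _ => ?_
      simp only [Prod.fst_add, Prod.snd_add, Pi.add_apply]
      ring
    rw [h, hv u hu, hw u hu, add_zero]
  smul_mem' := by
    intro c v hv u hu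
    have h : sympInner u (c • v) = c * sympInner u v := by
      simp only [sympInner, Finset.mul_sum]
      refine Finset.sum_congr rfl fun i _ => ?_
      simp only [Prod.smul_fst, Prod.smul_snd, Pi.smul_apply, smul_eq_mul]
      ring
    rw [h, hv u hu, mul_zero]

/-- The symplectic weight: the number of `i` with `(uᵢ, u_{n+i}) ≠ (0, 0)`. -/
def sympWeight {n : ℕ} (u : SympVec n) : ℕ :=
  (Finset.univ.filter fun i => (u.1 i, u.2 i) ≠ (0, 0)).card

/-! ## Binary quantum codes -/

/-- The Hilbert space `(ℂ²)^{⊗ n}` of `n` qubits, written in the computational basis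
`|x⟩`, `x ∈ F₂ⁿ`. -/
abbrev Qubits (n : ℕ) : Type := EuclideanSpace ℂ (Fin n → ZMod 2)

/-- The Pauli error `Z(b) X(a)` of `u = (a | b)`: it sends `|x⟩` to `(-1)^{b ⬝ (x + a)} |x + a⟩`.
Up to a phase these are all tensor products of `n` Pauli matrices. -/
noncomputable def pauli {n : ℕ} (u : SympVec n) : Qubits n →ₗ[ℂ] Qubits n where
  toFun ψ := WithLp.toLp 2 fun x => (if ∑ i, u.2 i * x i = 0 then 1 else -1) * ψ (x + u.1)
  map_add' ψ φ := by
    ext x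
    simp [mul_add]
  map_smul' c ψ := by
    ext x
    simp only [PiLp.smul_apply, smul_eq_mul, RingHom.id_apply]
    ring

/-- The quantum code `Q` detects the Pauli error of `e` (Knill-Laflamme condition `P E P = c P`,
where `P` is the orthogonal projection onto `Q`). -/
def Detects {n : ℕ} (Q : Submodule ℂ (Qubits n)) (e : SympVec n) : Prop :=
  ∃ c : ℂ, ∀ φ ∈ Q, ∀ ψ ∈ Q, inner ℂ φ (pauli e ψ) = c * inner ℂ φ ψ

/-- `Q` is an `[[n, k, d]]` quantum code: it has dimension `2 ^ k`, and its minimum distance, the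
least weight of a Pauli error that `Q` does not detect, is exactly `d`. -/
def IsQECC (n k d : ℕ) (Q : Submodule ℂ (Qubits n)) : Prop :=
  Module.finrank ℂ Q = 2 ^ k ∧ IsLeast {w | ∃ e : SympVec n, sympWeight e = w ∧ ¬ Detects Q e} d

/-- `Q` is pure to `d`: Pauli errors of positive weight less than `d` map `Q` to a space
orthogonal to `Q`. -/
def IsPureQECC {n : ℕ} (d : ℕ) (Q : Submodule ℂ (Qubits n)) : Prop :=
  ∀ e : SympVec n, 0 < sympWeight e → sympWeight e < d →
    ∀ φ ∈ Q, ∀ ψ ∈ Q, inner ℂ φ (pauli e ψ) = 0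

/-- `Q` is obtained from the symplectic dual-containing code `C` by the symplectic construction:
it is a nonzero joint eigenspace of the Pauli operators that belong to the symplectic dual
of `C`. -/
def IsSymplecticConstruction {n : ℕ} (C : Submodule (ZMod 2) (SympVec n))
    (Q : Submodule ℂ (Qubits n)) : Prop :=
  sympDual C ≤ C ∧ Q ≠ ⊥ ∧
    ∃ χ : SympVec n → ℂ, ∀ ψ : Qubits n, ψ ∈ Q ↔ ∀ s ∈ sympDual C, pauli s ψ = χ s • ψ

/-! ## Propagation rules -/

/-- The map `ψ ↦ ψ ⊗ |0⟩` that adjoins one qubit. -/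
noncomputable def tensorZero (n : ℕ) : Qubits n →ₗ[ℂ] Qubits (n + 1) where
  toFun ψ := WithLp.toLp 2 fun x : Fin (n + 1) → ZMod 2 =>
    if x (Fin.last n) = 0 then ψ fun i => x i.castSucc else 0
  map_add' ψ φ := by
    ext x
    by_cases h : x (Fin.last n) = 0 <;> simp [h]
  map_smul' c ψ := by
    ext x
    by_cases h : x (Fin.last n) = 0 <;> simp [h]

/-- `Propagates Q₀ n Q`: the code `Q` of length `n` is obtained from `Q₀` by finitely many
applications of the rules `[[n, k, d]] → [[n, k - 1, d]]` (pass to a subcode) and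
`[[n, k, d]] → [[n + 1, k, d]]` (adjoin a qubit in the state `|0⟩`). -/
inductive Propagates {n₀ : ℕ} (Q₀ : Submodule ℂ (Qubits n₀)) :
    (n : ℕ) → Submodule ℂ (Qubits n) → Prop
  | refl : Propagates Q₀ n₀ Q₀
  | subcode {n k d : ℕ} {Q Q' : Submodule ℂ (Qubits n)} (h : Propagates Q₀ n Q)
      (hk : 1 ≤ k) (hQ : IsQECC n k d Q) (hle : Q' ≤ Q)
      (hC : ∃ C', IsSymplecticConstruction C' Q') (hQ' : IsQECC n (k - 1) d Q') :
      Propagates Q₀ n Q'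
  | lengthen {n k d : ℕ} {Q : Submodule ℂ (Qubits n)} (h : Propagates Q₀ n Q)
      (hk : 0 < k) (hQ : IsQECC n k d Q)
      (hQ' : IsQECC (n + 1) k d (Q.map (tensorZero n))) :
      Propagates Q₀ (n + 1) (Q.map (tensorZero n))

/-! ## The eight two-generator quasi-cyclic codes -/

/-- The polynomial over `F₂` whose coefficients, in ascending order, are given by runs:
`(c, m)` stands for `m` consecutive coefficients equal to `c`. -/
noncomputable def ofRuns : List (ZMod 2 × ℕ) → (ZMod 2)[X]
  | [] => 0
  | (c, m) :: t => C c * (∑ i ∈ Finset.range m, X ^ i) + X ^ m * ofRuns t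

/-- The coefficient vector `[p(x)]` in `F₂ⁿ` of the class of `p` in `F₂[x] / (xⁿ - 1)`. -/
noncomputable def coeffVec (n : ℕ) (p : (ZMod 2)[X]) : Fin n → ZMod 2 :=
  fun i => (p %ₘ (X ^ n - 1)).coeff i

/-- The quasi-cyclic code of length `2n` and index 2 that is generated by `(v g₁, g₁)` and
`(g₂, v g₂)` as a module over `F₂[x] / (xⁿ - 1)`. -/
noncomputable def quasiCyclicCode (n : ℕ) (g₁ g₂ v : (ZMod 2)[X]) :
    Submodule (ZMod 2) (SympVec n) :=
  Submodule.span (ZMod 2) {u | ∃ a b : (ZMod 2)[X],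
    u = (coeffVec n (a * (v * g₁) + b * g₂), coeffVec n (a * g₁ + b * (v * g₂)))}

/-- Claimed parameters `[[n, k, d]]` of a quantum code and the polynomials of the quasi-cyclic
code that it comes from. -/
structure QCData where
  n : ℕ
  k : ℕ
  d : ℕ
  g₁ : (ZMod 2)[X]
  g₂ : (ZMod 2)[X]
  v : (ZMod 2)[X]

/-- The eight codes to which the propagation rules are applied. -/
noncomputable def eightCodes : List QCData :=
  [
  { n := 45, k := 16, d := 8
    g₁ := ofRuns [(1, 2), (0, 1), (1, 2), (0, 7), (1, 2)]
    g₂ := ofRuns [(1, 4), (0, 2), (1, 1), (0, 1), (1, 1), (0, 4), (1, 2), (0, 1), (1, 1)]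
    v := ofRuns [(0, 1), (1, 2), (0, 1), (1, 2), (0, 34), (1, 2), (0, 1), (1, 2)] },
  { n := 51, k := 26, d := 7
    g₁ := ofRuns [(1, 2)]
    g₂ := ofRuns [(1, 2), (0, 3), (1, 1), (0, 2), (1, 2), (0, 2), (1, 2), (0, 1), (1, 1),
      (0, 1), (1, 1), (0, 2), (1, 3), (0, 1), (1, 1)]
    v := ofRuns [(0, 4), (1, 2), (0, 1), (1, 1), (0, 1), (1, 1), (0, 1), (1, 2), (0, 1), (1, 2),
      (0, 3), (1, 2), (0, 1), (1, 1), (0, 1), (1, 1), (0, 2), (1, 1), (0, 1), (1, 1), (0, 1),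
      (1, 2), (0, 3), (1, 2), (0, 1), (1, 2), (0, 1), (1, 1), (0, 1), (1, 1), (0, 1), (1, 2)] },
  { n := 47, k := 23, d := 7
    g₁ := ofRuns [(1, 1), (0, 3), (1, 2), (0, 3), (1, 3), (0, 1), (1, 2), (0, 1), (1, 3),
      (0, 1), (1, 4)]
    g₂ := ofRuns [(1, 2)]
    v := ofRuns [(0, 2), (1, 5), (0, 1), (1, 3), (0, 3), (1, 2), (0, 16), (1, 2), (0, 3),
      (1, 3), (0, 1), (1, 5)] },
  { n := 55, k := 25, d := 8
    g₁ := ofRuns [(1, 1), (0, 1), (1, 2), (0, 1), (1, 2), (0, 1), (1, 1), (0, 2), (1, 1),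
      (0, 1), (1, 3), (0, 2), (1, 3)]
    g₂ := ofRuns [(1, 11)]
    v := ofRuns [(0, 1), (1, 1), (0, 1), (1, 1), (0, 1), (1, 4), (0, 1), (1, 1), (0, 2), (1, 1),
      (0, 28), (1, 1), (0, 2), (1, 1), (0, 1), (1, 4), (0, 1), (1, 1), (0, 1), (1, 1)] },
  { n := 73, k := 45, d := 7
    g₁ := ofRuns [(1, 3), (0, 1), (1, 3), (0, 2), (1, 1), (0, 2), (1, 3), (0, 1), (1, 3)]
    g₂ := ofRuns [(1, 2), (0, 1), (1, 1), (0, 1), (1, 1), (0, 1), (1, 4)]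
    v := ofRuns [(0, 1), (1, 1), (0, 1), (1, 1), (0, 2), (1, 2), (0, 58), (1, 2), (0, 2),
      (1, 1), (0, 1), (1, 1)] },
  { n := 91, k := 60, d := 7
    g₁ := ofRuns [(1, 1), (0, 2), (1, 4), (0, 1), (1, 1), (0, 3), (1, 1)]
    g₂ := ofRuns [(1, 2), (0, 5), (1, 4), (0, 1), (1, 1), (0, 3), (1, 2), (0, 1), (1, 1)]
    v := ofRuns [(0, 1), (1, 2), (0, 2), (1, 1), (0, 80), (1, 1), (0, 2), (1, 2)] },
  { n := 93, k := 63, d := 7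
    g₁ := ofRuns [(1, 3), (0, 1), (1, 2), (0, 4), (1, 3), (0, 1), (1, 1), (0, 1), (1, 1),
      (0, 1), (1, 1), (0, 1), (1, 1), (0, 1), (1, 2), (0, 1), (1, 1)]
    g₂ := ofRuns [(1, 3), (0, 1), (1, 2)]
    v := ofRuns [(0, 3), (1, 1), (0, 1), (1, 1), (0, 2), (1, 1), (0, 2), (1, 1), (0, 1), (1, 1),
      (0, 1), (1, 1), (0, 1), (1, 4), (0, 1), (1, 2), (0, 1), (1, 1), (0, 1), (1, 1), (0, 8),
      (1, 1), (0, 1), (1, 2), (0, 2), (1, 10), (0, 2), (1, 2), (0, 1), (1, 1), (0, 8), (1, 1),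
      (0, 1), (1, 1), (0, 1), (1, 2), (0, 1), (1, 4), (0, 1), (1, 1), (0, 1), (1, 1), (0, 1),
      (1, 1), (0, 2), (1, 1), (0, 2), (1, 1), (0, 1), (1, 1)] },
  { n := 105, k := 74, d := 7
    g₁ := ofRuns [(1, 2), (0, 1), (1, 3), (0, 3), (1, 1), (0, 2), (1, 1)]
    g₂ := ofRuns [(1, 2), (0, 1), (1, 1), (0, 4), (1, 3), (0, 1), (1, 8)]
    v := ofRuns [(0, 2), (1, 1), (0, 1), (1, 1), (0, 4), (1, 1), (0, 86), (1, 1), (0, 4),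
      (1, 1), (0, 1), (1, 1)] }]

/-! ## The table -/

/-- A line of the table: the parameters `[[n, k, d]]` of a new code, and the minimum distance
`known` of the best previously known code with the same `n` and `k`, as recorded in Grassl's
code table. -/
structure TableRow where
  n : ℕ
  k : ℕ
  d : ℕ
  known : ℕ

/-- The 36 lines of the table, each written `⟨n, k, d, known⟩`. -/
def newCodes : List TableRow :=
  [⟨46, 16, 8, 7⟩, ⟨47, 16, 8, 7⟩, ⟨48, 23, 7, 6⟩, ⟨49, 23, 7, 6⟩,
   ⟨50, 23, 7, 6⟩, ⟨51, 23, 7, 6⟩, ⟨51, 25, 7, 6⟩, ⟨51, 24, 7, 6⟩,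
   ⟨56, 25, 8, 7⟩, ⟨57, 25, 8, 7⟩, ⟨73, 44, 7, 6⟩, ⟨73, 43, 7, 6⟩,
   ⟨74, 45, 7, 6⟩, ⟨74, 44, 7, 6⟩, ⟨74, 43, 7, 6⟩, ⟨75, 45, 7, 6⟩,
   ⟨75, 44, 7, 6⟩, ⟨75, 43, 7, 6⟩, ⟨76, 45, 7, 6⟩, ⟨76, 44, 7, 6⟩,
   ⟨76, 43, 7, 6⟩, ⟨77, 45, 7, 6⟩, ⟨77, 44, 7, 6⟩, ⟨78, 45, 7, 6⟩,
   ⟨91, 59, 7, 6⟩, ⟨91, 58, 7, 6⟩, ⟨92, 60, 7, 6⟩, ⟨92, 59, 7, 6⟩,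
   ⟨93, 62, 7, 6⟩, ⟨94, 63, 7, 6⟩, ⟨95, 63, 7, 6⟩, ⟨105, 73, 7, 6⟩,
   ⟨106, 74, 7, 6⟩, ⟨106, 73, 7, 6⟩, ⟨107, 74, 7, 6⟩, ⟨107, 73, 7, 6⟩]

/-! ## The symplectic form -/

/-! The quantum side is the stabilizer formalism. Let S be a subspace contained in its symplectic
dual C. The Pauli operators in S commute, so they have a nonzero joint eigenspace Q, and the trace
of the averaging projection gives dim Q = 2^(n - dim S). An error e outside C maps Q to an
orthogonal space, an error in S acts on Q as a scalar, and an error in C but not in S is undetected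
(`detects_iff`). The minimum distance is therefore the least weight in C \ S, and Q is pure when no
nonzero word of C is lighter. The propagation rules become operations on S: add to S a vector that
keeps a chosen minimum-weight error undetected (`exists_subcode`), or add Z on a new qubit
(`IsStabilizerCode.lengthen`).

For each quasi-cyclic code three facts remain. First, the symplectic dual is again of the form (v
h₁, h₁), (h₂, v h₂) with gᵢ dividing hᵢ. Orthogonality uses the symmetry of v under x ↦ 1/x, and
equality follows by dimension count from the invertibility of 1 + v² (`sympDual_quasiCyclicCode`).
Second, an explicit word of weight d in the code fails to be orthogonal to another word. Third, no
nonzero word has weight below d.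

The third fact is a meet in the middle. A family of parity checks is packed into strings of n blocks
of K bits, so that a cyclic shift of an error rotates its syndrome by K places. A nonzero word of
weight at most 6 splits into two disjoint errors of weight at most 3 with equal syndromes. A
rotation-invariant hash that is injective on orbit representatives excludes this
(`syndrome_ne_zero`). In a word of weight 7 some four cyclically consecutive positions lie in a
window of length 3n/7, so it suffices that hashes of triples differ from hashes of fours in such a
window (`syndrome_seven_ne_zero`).

Distinctness of the hashes is decided by packing them into one long number and applying a sorting
network to all its fields in parallel. Only the fact that the network permutes the fields is proved;
the order of its output is tested directly. -/

theorem sympInner_add_left {n : ℕ} (u v w : SympVec n) :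
    sympInner (u + v) w = sympInner u w + sympInner v w := by
  simp only [sympInner, ← Finset.sum_add_distrib]
  refine Finset.sum_congr rfl fun i _ => ?_
  simp only [Prod.fst_add, Prod.snd_add, Pi.add_apply]
  ring

theorem sympInner_smul_left {n : ℕ} (c : ZMod 2) (u w : SympVec n) :
    sympInner (c • u) w = c * sympInner u w := by
  simp only [sympInner, Finset.mul_sum]
  refine Finset.sum_congr rfl fun i _ => ?_
  simp only [Prod.smul_fst, Prod.smul_snd, Pi.smul_apply, smul_eq_mul]
  ring

theorem sympInner_comm {n : ℕ} (u v : SympVec n) : sympInner u v = sympInner v u := by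
  refine Finset.sum_congr rfl fun i _ => ?_
  rw [CharTwo.sub_eq_add, CharTwo.sub_eq_add]
  ring

theorem sympInner_add_right {n : ℕ} (u v w : SympVec n) :
    sympInner u (v + w) = sympInner u v + sympInner u w := by
  rw [sympInner_comm, sympInner_add_left, sympInner_comm v, sympInner_comm w]

theorem sympInner_smul_right {n : ℕ} (c : ZMod 2) (u w : SympVec n) :
    sympInner u (c • w) = c * sympInner u w := by
  rw [sympInner_comm, sympInner_smul_left, sympInner_comm]

theorem sympInner_self {n : ℕ} (u : SympVec n) : sympInner u u = 0 := by
  simp [sympInner, mul_comm]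

/-- The symplectic inner product as a bilinear form. -/
noncomputable def sympForm (n : ℕ) : LinearMap.BilinForm (ZMod 2) (SympVec n) :=
  LinearMap.mk₂ _ sympInner sympInner_add_left sympInner_smul_left sympInner_add_right
    sympInner_smul_right

theorem sympForm_apply {n : ℕ} (u v : SympVec n) : sympForm n u v = sympInner u v := rfl

theorem SympVec.add_self {n : ℕ} (u : SympVec n) : u + u = 0 := by
  ext i
  · exact CharTwo.add_self_eq_zero _
  · exact CharTwo.add_self_eq_zero _

/-- A nonzero coordinate in one half is detected by the unit vector at the same place in the other
half. This gives nondegeneracy, and an anticommuting partner for every nontrivial Pauli operator. -/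
theorem exists_sympInner_eq_one {n : ℕ} {u : SympVec n} (hu : u ≠ 0) :
    ∃ v, sympInner u v = 1 := by
  have key : ∀ c : ZMod 2, c ≠ 0 → c = 1 := by decide
  by_cases h : u.1 = 0
  · have h2 : u.2 ≠ 0 := fun h2 => hu (Prod.ext h h2)
    obtain ⟨i, hi⟩ := Function.ne_iff.1 h2
    refine ⟨(Pi.single i 1, 0), ?_⟩
    simp [sympInner, h, Pi.single_apply, key _ hi]
  · obtain ⟨i, hi⟩ := Function.ne_iff.1 h
    refine ⟨(0, Pi.single i 1), ?_⟩
    simp [sympInner, Pi.single_apply, key _ hi]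

theorem sympForm_isRefl (n : ℕ) : (sympForm n).IsRefl := fun u v h => by
  rw [sympForm_apply] at h ⊢
  rw [sympInner_comm, h]

theorem sympForm_nondegenerate (n : ℕ) : (sympForm n).Nondegenerate := by
  refine ⟨fun u h => ?_, fun u h => ?_⟩
  · by_contra hu
    obtain ⟨v, hv⟩ := exists_sympInner_eq_one hu
    exact zero_ne_one ((h v).symm.trans hv)
  · by_contra hu
    obtain ⟨v, hv⟩ := exists_sympInner_eq_one hu
    rw [sympInner_comm] at hv
    exact zero_ne_one ((h v).symm.trans hv)

theorem mem_sympDual {n : ℕ} {C : Submodule (ZMod 2) (SympVec n)} {v : SympVec n} :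
    v ∈ sympDual C ↔ ∀ u ∈ C, sympInner u v = 0 := Iff.rfl

theorem sympDual_eq_orthogonal {n : ℕ} (C : Submodule (ZMod 2) (SympVec n)) :
    sympDual C = (sympForm n).orthogonal C := rfl

theorem sympDual_sympDual {n : ℕ} (C : Submodule (ZMod 2) (SympVec n)) :
    sympDual (sympDual C) = C := by
  rw [sympDual_eq_orthogonal, sympDual_eq_orthogonal]
  exact LinearMap.BilinForm.orthogonal_orthogonal (sympForm_nondegenerate n) (sympForm_isRefl n) C

theorem finrank_sympDual {n : ℕ} (C : Submodule (ZMod 2) (SympVec n)) :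
    Module.finrank (ZMod 2) (sympDual C) = 2 * n - Module.finrank (ZMod 2) C := by
  rw [sympDual_eq_orthogonal,
    LinearMap.BilinForm.finrank_orthogonal (sympForm_nondegenerate n)]
  simp [two_mul]

theorem sympDual_anti {n : ℕ} {C D : Submodule (ZMod 2) (SympVec n)} (h : C ≤ D) :
    sympDual D ≤ sympDual C := fun _ hv u hu => hv u (h hu)

theorem card_submodule {n : ℕ} (S : Submodule (ZMod 2) (SympVec n)) :
    Nat.card S = 2 ^ Module.finrank (ZMod 2) S := by
  rw [Module.natCard_eq_pow_finrank (K := ZMod 2)]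
  simp

/-! ## Pauli operators -/

/-- The sign `(-1)^a`. -/
noncomputable def signC (a : ZMod 2) : ℂ := if a = 0 then 1 else -1

@[simp] theorem signC_zero : signC 0 = 1 := by simp [signC]

@[simp] theorem signC_one : signC 1 = -1 := by simp [signC]

theorem signC_add (a b : ZMod 2) : signC (a + b) = signC a * signC b := by
  have : ∀ a : ZMod 2, a = 0 ∨ a = 1 := by decide
  have h2 : (1 : ZMod 2) + 1 = 0 := by decide
  rcases this a with rfl | rfl <;> rcases this b with rfl | rfl <;> simp [h2]

theorem signC_mul_self (a : ZMod 2) : signC a * signC a = 1 := by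
  rw [← signC_add, CharTwo.add_self_eq_zero, signC_zero]

theorem star_signC (a : ZMod 2) : (starRingEnd ℂ) (signC a) = signC a := by
  unfold signC
  split_ifs <;> simp

theorem pauli_apply {n : ℕ} (u : SympVec n) (ψ : Qubits n) (x : Fin n → ZMod 2) :
    pauli u ψ x = signC (∑ i, u.2 i * x i) * ψ (x + u.1) := rfl

@[simp] theorem pauli_zero {n : ℕ} (ψ : Qubits n) : pauli 0 ψ = ψ := by
  ext x
  simp [pauli_apply]

theorem pauli_pauli {n : ℕ} (u v : SympVec n) (ψ : Qubits n) :
    pauli u (pauli v ψ) = signC (∑ i, v.2 i * u.1 i) • pauli (u + v) ψ := by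
  ext x
  simp only [PiLp.smul_apply, smul_eq_mul, pauli_apply, Prod.snd_add, Prod.fst_add, Pi.add_apply,
    add_mul, mul_add, Finset.sum_add_distrib, signC_add, add_assoc]
  ring

/-- Both orders give the operator of u + v up to sign, and the product of the two signs is the
symplectic form, since subtraction is addition in characteristic 2. -/
theorem pauli_comm {n : ℕ} (u v : SympVec n) (ψ : Qubits n) :
    pauli u (pauli v ψ) = signC (sympInner u v) • pauli v (pauli u ψ) := by
  rw [pauli_pauli, pauli_pauli, add_comm v u, smul_smul]
  congr 1
  have : sympInner u v = (∑ i, v.2 i * u.1 i) + ∑ i, u.2 i * v.1 i := by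
    rw [← Finset.sum_add_distrib]
    refine Finset.sum_congr rfl fun i _ => ?_
    rw [CharTwo.sub_eq_add]
    ring
  rw [this, signC_add, mul_assoc, signC_mul_self, mul_one]

theorem signC_ne_zero (a : ZMod 2) : signC a ≠ 0 := fun h => by
  simpa [h] using signC_mul_self a

theorem pauli_pauli_self {n : ℕ} (u : SympVec n) (ψ : Qubits n) :
    pauli u (pauli u ψ) = signC (∑ i, u.2 i * u.1 i) • ψ := by
  rw [pauli_pauli, SympVec.add_self, pauli_zero]

theorem pauli_injective {n : ℕ} (u : SympVec n) : Function.Injective (pauli u) := by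
  intro ψ φ h
  have h2 : pauli u (pauli u ψ) = pauli u (pauli u φ) := by rw [h]
  rw [pauli_pauli_self, pauli_pauli_self] at h2
  exact smul_right_injective _ (signC_ne_zero _) h2

theorem inner_pauli_pauli {n : ℕ} (u : SympVec n) (φ ψ : Qubits n) :
    inner ℂ (pauli u φ) (pauli u ψ) = inner ℂ φ ψ := by
  simp only [PiLp.inner_apply, RCLike.inner_apply, pauli_apply, map_mul, star_signC]
  rw [← Equiv.sum_comp (Equiv.addRight u.1) (fun x => ψ x * (starRingEnd ℂ) (φ x))]
  refine Finset.sum_congr rfl fun x _ => ?_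
  simp only [Equiv.coe_addRight]
  linear_combination (ψ (x + u.1) * (starRingEnd ℂ) (φ (x + u.1))) *
    signC_mul_self (∑ i, u.2 i * x i)

/-- Conjugation by an anticommuting Pauli operator preserves the trace and changes its sign. -/
theorem trace_pauli {n : ℕ} {u : SympVec n} (hu : u ≠ 0) :
    LinearMap.trace ℂ _ (pauli u) = 0 := by
  obtain ⟨v, hv⟩ := exists_sympInner_eq_one hu
  set c := signC (∑ i, v.2 i * v.1 i) with hc
  have hvv : pauli v * pauli v = c • (1 : Qubits n →ₗ[ℂ] Qubits n) := by
    ext1 ψ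
    exact pauli_pauli_self v ψ
  have huv : pauli u * pauli v = -(pauli v * pauli u) := by
    ext1 ψ
    simpa [hv] using pauli_comm u v ψ
  have h1 : LinearMap.trace ℂ _ (pauli u * pauli v * pauli v) =
      c * LinearMap.trace ℂ _ (pauli u) := by
    rw [mul_assoc, hvv, mul_smul_comm, mul_one, map_smul, smul_eq_mul]
  have h2 : LinearMap.trace ℂ _ (pauli u * pauli v * pauli v) =
      -(c * LinearMap.trace ℂ _ (pauli u)) := by
    rw [huv, neg_mul, map_neg, LinearMap.trace_mul_comm, ← mul_assoc, hvv, smul_mul_assoc,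
      one_mul, map_smul, smul_eq_mul]
  have h3 : c * LinearMap.trace ℂ _ (pauli u) = 0 := by
    have := h1.symm.trans h2
    exact self_eq_neg.1 this
  exact (mul_eq_zero.1 h3).resolve_left (signC_ne_zero _)

/-! ## Joint eigenspaces of Pauli operators -/

/-- `Q` is a nonzero joint eigenspace, with eigenvalues `χ`, of the Pauli operators in `S`. -/
structure IsJointEigenspace {n : ℕ} (S : Submodule (ZMod 2) (SympVec n)) (χ : SympVec n → ℂ)
    (Q : Submodule ℂ (Qubits n)) : Prop where
  ne_bot : Q ≠ ⊥
  mem_iff : ∀ ψ : Qubits n, ψ ∈ Q ↔ ∀ s ∈ S, pauli s ψ = χ s • ψ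

namespace IsJointEigenspace

variable {n : ℕ} {S : Submodule (ZMod 2) (SympVec n)} {χ : SympVec n → ℂ}
  {Q : Submodule ℂ (Qubits n)}

theorem exists_ne_zero (h : IsJointEigenspace S χ Q) : ∃ ψ ∈ Q, ψ ≠ 0 :=
  Submodule.exists_mem_ne_zero_of_ne_bot h.ne_bot

/-- The eigenvalues need not form a character: they inherit the sign cocycle of the operators, read
off at a nonzero vector of Q. -/
theorem eigen_mul (h : IsJointEigenspace S χ Q) {s t : SympVec n} (hs : s ∈ S) (ht : t ∈ S) :
    χ s * χ t = signC (∑ i, t.2 i * s.1 i) * χ (s + t) := by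
  obtain ⟨ψ, hψ, h0⟩ := h.exists_ne_zero
  have hm := (h.mem_iff ψ).1 hψ
  have h1 := pauli_pauli s t ψ
  rw [hm _ (S.add_mem hs ht), hm t ht, map_smul, hm s hs, smul_smul, smul_smul] at h1
  rw [mul_comm]
  exact smul_left_injective ℂ h0 h1

theorem eigen_ne_zero (h : IsJointEigenspace S χ Q) {s : SympVec n} (hs : s ∈ S) : χ s ≠ 0 := by
  obtain ⟨ψ, hψ, h0⟩ := h.exists_ne_zero
  intro h1
  have := (h.mem_iff ψ).1 hψ s hs
  rw [h1, zero_smul, ← map_zero (pauli s)] at this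
  exact h0 (pauli_injective s this)

theorem star_eigen_mul (h : IsJointEigenspace S χ Q) {s : SympVec n} (hs : s ∈ S) :
    (starRingEnd ℂ) (χ s) * χ s = 1 := by
  obtain ⟨ψ, hψ, h0⟩ := h.exists_ne_zero
  have h1 := inner_pauli_pauli s ψ ψ
  rw [(h.mem_iff ψ).1 hψ s hs, inner_smul_left, inner_smul_right, ← mul_assoc] at h1
  have h2 : inner ℂ ψ ψ ≠ 0 := inner_self_ne_zero.2 h0
  exact mul_right_cancel₀ h2 (h1.trans (one_mul _).symm)

theorem eigen_zero (h : IsJointEigenspace S χ Q) : χ 0 = 1 := by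
  obtain ⟨ψ, hψ, h0⟩ := h.exists_ne_zero
  have := (h.mem_iff ψ).1 hψ 0 S.zero_mem
  rw [pauli_zero] at this
  exact (smul_left_injective ℂ h0 (by simpa using this)).symm

theorem pauli_mem (h : IsJointEigenspace S χ Q) {e : SympVec n} (he : e ∈ sympDual S)
    {ψ : Qubits n} (hψ : ψ ∈ Q) : pauli e ψ ∈ Q := by
  rw [h.mem_iff]
  intro s hs
  rw [pauli_comm, he s hs, signC_zero, one_smul, (h.mem_iff ψ).1 hψ s hs, map_smul]

/-- Some s in S anticommutes with e. Applying its operator to both arguments leaves the inner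
product unchanged, while the unimodular eigenvalues cancel and the anticommutation produces a sign.
-/
theorem inner_pauli_eq_zero (h : IsJointEigenspace S χ Q) {e : SympVec n}
    (he : e ∉ sympDual S) {φ ψ : Qubits n} (hφ : φ ∈ Q) (hψ : ψ ∈ Q) :
    inner ℂ φ (pauli e ψ) = 0 := by
  rw [mem_sympDual] at he
  push Not at he
  obtain ⟨s, hs, hse⟩ := he
  have key : ∀ c : ZMod 2, c ≠ 0 → c = 1 := by decide
  have h1 := inner_pauli_pauli s φ (pauli e ψ)
  rw [pauli_comm, key _ hse, (h.mem_iff φ).1 hφ s hs, (h.mem_iff ψ).1 hψ s hs, map_smul,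
    inner_smul_left, inner_smul_right, inner_smul_right, signC_one] at h1
  have h2 := h.star_eigen_mul hs
  have h3 : (2 : ℂ) * inner ℂ φ (pauli e ψ) = 0 := by
    linear_combination -h1 - (inner ℂ φ (pauli e ψ)) * h2
  exact (mul_eq_zero.1 h3).resolve_left two_ne_zero

theorem detects_iff (h : IsJointEigenspace S χ Q) (e : SympVec n) :
    Detects Q e ↔ e ∉ sympDual S ∨ e ∈ S := by
  constructor
  · intro hd
    by_contra! hcon
    obtain ⟨heC, heS⟩ := hcon
    obtain ⟨c, hc⟩ := hd
    -- Since e preserves Q, the difference lies in Q and is orthogonal to all of Q, hence to itself.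
    have hE : ∀ ψ ∈ Q, pauli e ψ = c • ψ := by
      intro ψ hψ
      have hmem : pauli e ψ - c • ψ ∈ Q := Q.sub_mem (h.pauli_mem heC hψ) (Q.smul_mem c hψ)
      have h0 : inner ℂ (pauli e ψ - c • ψ) (pauli e ψ - c • ψ) = 0 := by
        rw [inner_sub_right, hc _ hmem _ hψ, inner_smul_right, sub_self]
      exact sub_eq_zero.1 (inner_self_eq_zero.1 h0)
    -- By biduality some f commutes with all of S but anticommutes with e. It preserves Q, where e
    -- acts as c, so c = -c = 0, contradicting injectivity of e.
    rw [← sympDual_sympDual S, mem_sympDual] at heS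
    push Not at heS
    obtain ⟨f, hf, hfe⟩ := heS
    have key : ∀ c : ZMod 2, c ≠ 0 → c = 1 := by decide
    obtain ⟨ψ, hψ, h0⟩ := h.exists_ne_zero
    have h1 := pauli_comm f e ψ
    rw [hE ψ hψ, hE _ (h.pauli_mem hf hψ), map_smul, key _ hfe, signC_one, neg_one_smul] at h1
    replace h1 : c • pauli f ψ = 0 := by
      have h2 : (2 : ℂ) • (c • pauli f ψ) = 0 := by
        rw [two_smul]
        nth_rewrite 1 [h1]
        exact neg_add_cancel _
      exact (smul_eq_zero.1 h2).resolve_left two_ne_zero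
    have hFψ : pauli f ψ ≠ 0 := fun h2 => h0 (pauli_injective f (h2.trans (map_zero _).symm))
    have hc0 : c = 0 := (smul_eq_zero.1 h1).resolve_right hFψ
    have h3 := hE ψ hψ
    rw [hc0, zero_smul, ← map_zero (pauli e)] at h3
    exact h0 (pauli_injective e h3)
  · rintro (he | he)
    · exact ⟨0, fun φ hφ ψ hψ => by rw [h.inner_pauli_eq_zero he hφ hψ, zero_mul]⟩
    · exact ⟨χ e, fun φ _ ψ hψ => by rw [(h.mem_iff ψ).1 hψ e he, inner_smul_right]⟩

/-- The dimension of a joint eigenspace. -/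
theorem finrank_mul_card (h : IsJointEigenspace S χ Q) :
    Module.finrank ℂ Q * Nat.card S = 2 ^ n := by
  classical
  have : Fintype S := Fintype.ofFinite S
  -- Divided by |S| this is a projection onto Q, so its trace is dim Q; every summand with s ≠ 0 is
  -- traceless, and s = 0 contributes 2^n.
  set P : Qubits n →ₗ[ℂ] Qubits n := ∑ s : S, (χ s)⁻¹ • pauli (s : SympVec n) with hP
  have hcard : (Nat.card S : ℂ) ≠ 0 := by
    exact_mod_cast Nat.card_pos.ne'
  have hPQ : ∀ ψ ∈ Q, P ψ = (Nat.card S : ℂ) • ψ := by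
    intro ψ hψ
    rw [hP, LinearMap.sum_apply]
    have : ∀ s ∈ (Finset.univ : Finset S), ((χ s)⁻¹ • pauli (s : SympVec n)) ψ = ψ := by
      intro s _
      rw [LinearMap.smul_apply, (h.mem_iff ψ).1 hψ s s.2, smul_smul,
        inv_mul_cancel₀ (h.eigen_ne_zero s.2), one_smul]
    rw [Finset.sum_congr rfl this, Finset.sum_const, Finset.card_univ, Nat.card_eq_fintype_card,
      Nat.cast_smul_eq_nsmul]
  have hPmem : ∀ ψ, P ψ ∈ Q := by
    intro ψ
    rw [h.mem_iff]
    intro t ht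
    rw [hP, LinearMap.sum_apply, map_sum, Finset.smul_sum]
    symm
    rw [← Equiv.sum_comp (Equiv.addLeft (⟨t, ht⟩ : S))]
    refine Finset.sum_congr rfl fun s _ => ?_
    simp only [Equiv.coe_addLeft, LinearMap.smul_apply, Submodule.coe_add, map_smul]
    have h1 := h.eigen_mul ht s.2
    rw [pauli_pauli, smul_smul, smul_smul]
    have hs := h.eigen_ne_zero s.2
    have hts := h.eigen_ne_zero (S.add_mem ht s.2)
    congr 1
    field_simp
    rw [h1, mul_comm]
  have hproj : LinearMap.IsProj Q ((Nat.card S : ℂ)⁻¹ • P) := by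
    refine ⟨fun ψ => Q.smul_mem _ (hPmem ψ), fun ψ hψ => ?_⟩
    rw [LinearMap.smul_apply, hPQ ψ hψ, smul_smul, inv_mul_cancel₀ hcard, one_smul]
  have htr := hproj.trace
  have hPtr : LinearMap.trace ℂ _ P = (2 : ℂ) ^ n := by
    rw [hP, map_sum, Finset.sum_eq_single (0 : S)]
    · have h1 : pauli (0 : SympVec n) = LinearMap.id := LinearMap.ext fun ψ => pauli_zero ψ
      rw [map_smul, Submodule.coe_zero, h.eigen_zero, h1, LinearMap.trace_id]
      simp
    · intro s _ hs
      rw [map_smul, trace_pauli (fun h0 => hs (Subtype.ext h0)), smul_zero]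
    · simp
  rw [map_smul, hPtr, smul_eq_mul] at htr
  have : (Module.finrank ℂ Q : ℂ) * (Nat.card S : ℂ) = 2 ^ n := by
    rw [← htr]
    field_simp
  exact_mod_cast this

end IsJointEigenspace

/-- Commuting Pauli operators that preserve a nonzero space have a joint eigenvector in it. -/
theorem exists_joint_eigenvector {n : ℕ} {S : Submodule (ZMod 2) (SympVec n)}
    (hS : S ≤ sympDual S) {V : Submodule ℂ (Qubits n)} (hV : V ≠ ⊥)
    (hSV : ∀ s ∈ S, ∀ ψ ∈ V, pauli s ψ ∈ V) :
    ∃ ψ ∈ V, ψ ≠ 0 ∧ ∀ s ∈ S, ∃ c : ℂ, pauli s ψ = c • ψ := by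
  classical
  -- The space is cut down by one operator at a time. An eigenspace of one operator stays invariant
  -- under all of S because the operators commute, so the next eigenvalue can be found inside it.
  have key : ∀ T : Finset (SympVec n), (∀ s ∈ T, s ∈ S) → ∃ W : Submodule ℂ (Qubits n),
      W ≤ V ∧ W ≠ ⊥ ∧ (∀ s ∈ S, ∀ ψ ∈ W, pauli s ψ ∈ W) ∧
      ∀ s ∈ T, ∃ c : ℂ, ∀ ψ ∈ W, pauli s ψ = c • ψ := by
    intro T
    induction T using Finset.induction_on with
    | empty => exact fun _ => ⟨V, le_rfl, hV, hSV, by simp⟩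
    | insert t T _ ih =>
      intro hT
      obtain ⟨W, hWV, hW0, hW, hWT⟩ := ih fun s hs => hT s (Finset.mem_insert_of_mem hs)
      have ht : t ∈ S := hT t (Finset.mem_insert_self _ _)
      have : Nontrivial W := Submodule.nontrivial_iff_ne_bot.2 hW0
      obtain ⟨c, hc⟩ := Module.End.exists_eigenvalue ((pauli t).restrict (hW t ht))
      obtain ⟨w, hw⟩ := hc.exists_hasEigenvector
      have hw1 : pauli t (w : Qubits n) = c • (w : Qubits n) := by
        simpa using congrArg Subtype.val hw.apply_eq_smul
      refine ⟨W ⊓ LinearMap.ker (pauli t - c • LinearMap.id), inf_le_left.trans hWV, ?_, ?_, ?_⟩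
      · refine Submodule.ne_bot_iff _ |>.2 ⟨w, ⟨w.2, ?_⟩, fun h => hw.2 (Subtype.ext h)⟩
        simp [LinearMap.mem_ker, hw1]
      · rintro s hs ψ ⟨hψ, hψ2⟩
        refine ⟨hW s hs ψ hψ, ?_⟩
        have h1 : pauli t ψ = c • ψ := by
          simpa [LinearMap.mem_ker, sub_eq_zero] using hψ2
        simp [LinearMap.mem_ker, pauli_comm t s, h1, hS hs t ht]
      · intro s hs
        rcases Finset.mem_insert.1 hs with rfl | hs
        · refine ⟨c, fun ψ hψ => ?_⟩
          simpa [LinearMap.mem_ker, sub_eq_zero] using hψ.2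
        · obtain ⟨c', hc'⟩ := hWT s hs
          exact ⟨c', fun ψ hψ => hc' ψ hψ.1⟩
  obtain ⟨W, hWV, hW0, -, hWT⟩ := key (Finset.univ.filter (· ∈ S)) (by simp)
  obtain ⟨ψ, hψ, h0⟩ := Submodule.exists_mem_ne_zero_of_ne_bot hW0
  refine ⟨ψ, hWV hψ, h0, fun s hs => ?_⟩
  obtain ⟨c, hc⟩ := hWT s (by simpa using hs)
  exact ⟨c, hc ψ hψ⟩

/-- The joint eigenspace of the Pauli operators in `S` with eigenvalues `χ`. -/
noncomputable def jointEigenspace {n : ℕ} (S : Submodule (ZMod 2) (SympVec n))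
    (χ : SympVec n → ℂ) : Submodule ℂ (Qubits n) :=
  ⨅ s ∈ S, LinearMap.ker (pauli s - χ s • LinearMap.id)

theorem mem_jointEigenspace {n : ℕ} {S : Submodule (ZMod 2) (SympVec n)} {χ : SympVec n → ℂ}
    {ψ : Qubits n} : ψ ∈ jointEigenspace S χ ↔ ∀ s ∈ S, pauli s ψ = χ s • ψ := by
  simp [jointEigenspace, Submodule.mem_iInf, sub_eq_zero]

/-- The eigenvalues of a joint eigenvector found in V define the eigenspace. Retaining that vector
is what later shows that the eigenspace of a larger stabilizer lies in the original code. -/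
theorem exists_isJointEigenspace {n : ℕ} {S : Submodule (ZMod 2) (SympVec n)}
    (hS : S ≤ sympDual S) {V : Submodule ℂ (Qubits n)} (hV : V ≠ ⊥)
    (hSV : ∀ s ∈ S, ∀ ψ ∈ V, pauli s ψ ∈ V) :
    ∃ χ Q, IsJointEigenspace S χ Q ∧ ∃ ψ ∈ Q, ψ ∈ V ∧ ψ ≠ 0 := by
  classical
  obtain ⟨ψ, hψ, h0, h⟩ := exists_joint_eigenvector hS hV hSV
  choose! χ hχ using h
  have hmem : ψ ∈ jointEigenspace S χ := mem_jointEigenspace.2 hχ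
  exact ⟨χ, jointEigenspace S χ, ⟨(Submodule.ne_bot_iff _).2 ⟨ψ, hmem, h0⟩,
    fun _ => mem_jointEigenspace⟩, ψ, hmem, hψ, h0⟩

/-! ## Stabilizer codes and the propagation rules -/

/-- `Q` is the stabilizer code of the self-orthogonal space `S`, and it has parameters
`[[n, k, d]]`. -/
structure IsStabilizerCode (n k d : ℕ) (S : Submodule (ZMod 2) (SympVec n))
    (χ : SympVec n → ℂ) (Q : Submodule ℂ (Qubits n)) : Prop where
  le_dual : S ≤ sympDual S
  eigenspace : IsJointEigenspace S χ Q
  finrank_eq : Module.finrank ℂ Q = 2 ^ k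
  isLeast : IsLeast {w | ∃ e ∈ sympDual S, e ∉ S ∧ sympWeight e = w} d

namespace IsStabilizerCode

variable {n k d : ℕ} {S : Submodule (ZMod 2) (SympVec n)} {χ : SympVec n → ℂ}
  {Q : Submodule ℂ (Qubits n)}

theorem isQECC (h : IsStabilizerCode n k d S χ Q) : IsQECC n k d Q := by
  refine ⟨h.finrank_eq, ?_⟩
  have : {w | ∃ e : SympVec n, sympWeight e = w ∧ ¬ Detects Q e} =
      {w | ∃ e ∈ sympDual S, e ∉ S ∧ sympWeight e = w} := by
    ext w
    refine exists_congr fun e => ?_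
    rw [h.eigenspace.detects_iff]
    tauto
  rw [this]
  exact h.isLeast

theorem isSymplecticConstruction (h : IsStabilizerCode n k d S χ Q) :
    IsSymplecticConstruction (sympDual S) Q := by
  refine ⟨?_, h.eigenspace.ne_bot, χ, ?_⟩ <;> rw [sympDual_sympDual]
  · exact h.le_dual
  · exact h.eigenspace.mem_iff

theorem finrank_add (h : IsStabilizerCode n k d S χ Q) :
    Module.finrank (ZMod 2) S + k = n := by
  have h1 := h.eigenspace.finrank_mul_card
  rw [h.finrank_eq, card_submodule, ← pow_add] at h1
  have := Nat.pow_right_injective le_rfl h1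
  omega

/-- The rule `[[n, k + 1, d]] → [[n, k, d]]` for `k ≥ 1`. -/
theorem exists_subcode (h : IsStabilizerCode n (k + 1) d S χ Q) (hk : 1 ≤ k) :
    ∃ S' χ' Q', Q' ≤ Q ∧ IsStabilizerCode n k d S' χ' Q' := by
  classical
  have hfr := h.finrank_add
  obtain ⟨⟨e, heC, heS, hed⟩, hmin⟩ := h.isLeast
  -- The new stabilizer element f is taken in the dual of S + ⟨e⟩ but outside S + ⟨e⟩. Orthogonality
  -- to e keeps e in the new dual, and f ∉ S + ⟨e⟩ keeps e out of the new stabilizer, so the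
  -- distance does not grow.
  set Se := S ⊔ Submodule.span (ZMod 2) {e} with hSe
  have hadd : ∀ {f : SympVec n}, f ∉ S →
      Module.finrank (ZMod 2) ↥(S ⊔ Submodule.span (ZMod 2) {f}) =
        Module.finrank (ZMod 2) S + 1 := by
    intro f hf
    have h0 : f ≠ 0 := fun h0 => hf (h0 ▸ S.zero_mem)
    have hinf : S ⊓ Submodule.span (ZMod 2) {f} = ⊥ := by
      rw [← disjoint_iff, Submodule.disjoint_span_singleton' h0]
      exact hf
    have := Submodule.finrank_sup_add_finrank_inf_eq S (Submodule.span (ZMod 2) {f})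
    rwa [hinf, finrank_bot, add_zero, finrank_span_singleton h0] at this
  have hSe1 : Module.finrank (ZMod 2) Se = Module.finrank (ZMod 2) S + 1 := hadd heS
  have hdim := finrank_sympDual Se
  -- With dim S = n - k - 1 the dimensions are n - k and n + k, so k ≥ 1 is exactly what is needed.
  have hlt : Module.finrank (ZMod 2) Se < Module.finrank (ZMod 2) (sympDual Se) := by
    rw [hdim]
    omega
  have hnle : ¬ sympDual Se ≤ Se := fun hle =>
    absurd (Submodule.finrank_mono hle) (not_le.2 hlt)
  obtain ⟨f, hf, hfSe⟩ := SetLike.not_le_iff_exists.1 hnle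
  have hfS : f ∉ S := fun hfS => hfSe (le_sup_left (a := S) hfS)
  have hfC : f ∈ sympDual S := sympDual_anti le_sup_left hf
  have hef : sympInner e f = 0 :=
    hf e (le_sup_right (a := S) (Submodule.mem_span_singleton_self e))
  set S' := S ⊔ Submodule.span (ZMod 2) {f} with hS'
  have hmem : ∀ {u : SympVec n}, u ∈ S' ↔ ∃ s ∈ S, ∃ c : ZMod 2, s + c • f = u := by
    intro u
    simp [hS', Submodule.mem_sup, Submodule.mem_span_singleton]
  have hdual : ∀ {u : SympVec n}, u ∈ sympDual S' ↔ u ∈ sympDual S ∧ sympInner f u = 0 := by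
    intro u
    constructor
    · intro hu
      exact ⟨sympDual_anti le_sup_left hu,
        hu f (le_sup_right (a := S) (Submodule.mem_span_singleton_self f))⟩
    · rintro ⟨h1, h2⟩ v hv
      obtain ⟨s, hs, c, rfl⟩ := hmem.1 hv
      rw [sympInner_add_left, sympInner_smul_left, h1 s hs, h2, mul_zero, add_zero]
  have hS'S' : S' ≤ sympDual S' := by
    intro u hu
    obtain ⟨s, hs, c, rfl⟩ := hmem.1 hu
    refine hdual.2 ⟨Submodule.add_mem _ (h.le_dual hs) (Submodule.smul_mem _ _ hfC), ?_⟩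
    rw [sympInner_add_right, sympInner_smul_right, sympInner_self, sympInner_comm, hfC s hs,
      mul_zero, add_zero]
  obtain ⟨χ', Q', hQ', ψ, hψ', hψ, h0⟩ := exists_isJointEigenspace hS'S' h.eigenspace.ne_bot
    (fun s hs φ hφ => h.eigenspace.pauli_mem (hdual.1 (hS'S' hs)).1 hφ)
  -- The two sets of eigenvalues agree on S because Q and Q' share the nonzero vector ψ.
  have hle : Q' ≤ Q := by
    intro φ hφ
    rw [h.eigenspace.mem_iff]
    intro s hs
    have hs' : s ∈ S' := le_sup_left (a := S) hs
    rw [(hQ'.mem_iff φ).1 hφ s hs']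
    congr 1
    have h1 := (hQ'.mem_iff ψ).1 hψ' s hs'
    rw [(h.eigenspace.mem_iff ψ).1 hψ s hs] at h1
    exact (smul_left_injective ℂ h0 h1).symm
  refine ⟨S', χ', Q', hle, hS'S', hQ', ?_, ⟨e, ?_, ?_, hed⟩, ?_⟩
  · have h1 := hQ'.finrank_mul_card
    rw [card_submodule, hadd hfS] at h1
    have h2 : 2 ^ n = 2 ^ k * 2 ^ (Module.finrank (ZMod 2) S + 1) := by
      rw [← pow_add]
      congr 1
      omega
    rw [h2] at h1
    exact Nat.eq_of_mul_eq_mul_right (by positivity) h1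
  · exact hdual.2 ⟨heC, by rw [sympInner_comm, hef]⟩
  · intro he
    obtain ⟨s, hs, c, hsc⟩ := hmem.1 he
    have hc : ∀ c : ZMod 2, c = 0 ∨ c = 1 := by decide
    rcases hc c with rfl | rfl
    · rw [zero_smul, add_zero] at hsc
      exact heS (hsc ▸ hs)
    · rw [one_smul] at hsc
      refine hfSe ?_
      have : f = s + e := by
        rw [← hsc, ← add_assoc, SympVec.add_self, zero_add]
      rw [this]
      exact Submodule.add_mem _ (le_sup_left (a := S) hs)
        (le_sup_right (a := S) (Submodule.mem_span_singleton_self e))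
  · rintro w ⟨u, hu, huS, rfl⟩
    exact hmin ⟨u, (hdual.1 hu).1, fun h1 => huS (le_sup_left (a := S) h1), rfl⟩

end IsStabilizerCode

/-! ### Adjoining a qubit in the state |0⟩ -/

/-- Forget the last coordinate of a symplectic vector. -/
def sympInit (n : ℕ) : SympVec (n + 1) →ₗ[ZMod 2] SympVec n where
  toFun u := (fun i => u.1 i.castSucc, fun i => u.2 i.castSucc)
  map_add' _ _ := rfl
  map_smul' _ _ := rfl

/-- The stabilizer of `Q ⊗ |0⟩`. -/
def lengthenSpace {n : ℕ} (S : Submodule (ZMod 2) (SympVec n)) :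
    Submodule (ZMod 2) (SympVec (n + 1)) where
  carrier := {u | sympInit n u ∈ S ∧ u.1 (Fin.last n) = 0}
  zero_mem' := ⟨by rw [map_zero]; exact S.zero_mem, rfl⟩
  add_mem' := by
    rintro u v ⟨h1, h2⟩ ⟨h3, h4⟩
    refine ⟨by rw [map_add]; exact S.add_mem h1 h3, ?_⟩
    simp [h2, h4]
  smul_mem' := by
    rintro c u ⟨h1, h2⟩
    refine ⟨by rw [map_smul]; exact S.smul_mem _ h1, ?_⟩
    simp [h2]

theorem mem_lengthenSpace {n : ℕ} {S : Submodule (ZMod 2) (SympVec n)} {u : SympVec (n + 1)} :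
    u ∈ lengthenSpace S ↔ sympInit n u ∈ S ∧ u.1 (Fin.last n) = 0 := Iff.rfl

theorem sympInner_succ {n : ℕ} (u v : SympVec (n + 1)) :
    sympInner u v = sympInner (sympInit n u) (sympInit n v) +
      (u.1 (Fin.last n) * v.2 (Fin.last n) - u.2 (Fin.last n) * v.1 (Fin.last n)) :=
  Fin.sum_univ_castSucc _

/-- Append a coordinate to a symplectic vector. -/
def sympSnoc {n : ℕ} (u : SympVec n) (a b : ZMod 2) : SympVec (n + 1) :=
  (Fin.snoc (α := fun _ => ZMod 2) u.1 a, Fin.snoc (α := fun _ => ZMod 2) u.2 b)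

@[simp] theorem sympInit_snoc {n : ℕ} (u : SympVec n) (a b : ZMod 2) :
    sympInit n (sympSnoc u a b) = u := by
  ext i <;> simp [sympInit, sympSnoc]

@[simp] theorem sympSnoc_fst_last {n : ℕ} (u : SympVec n) (a b : ZMod 2) :
    (sympSnoc u a b).1 (Fin.last n) = a := by simp [sympSnoc]

@[simp] theorem sympSnoc_snd_last {n : ℕ} (u : SympVec n) (a b : ZMod 2) :
    (sympSnoc u a b).2 (Fin.last n) = b := by simp [sympSnoc]

/-- Testing against Z on the new qubit forces the new X-coordinate to vanish, and testing against
words padded by zero gives the condition on the old coordinates. The new Z-coordinate is free on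
both sides. -/
theorem sympDual_lengthenSpace {n : ℕ} (S : Submodule (ZMod 2) (SympVec n)) :
    sympDual (lengthenSpace S) = lengthenSpace (sympDual S) := by
  ext v
  rw [mem_sympDual, mem_lengthenSpace, mem_sympDual]
  constructor
  · intro h
    constructor
    · intro u hu
      have := h (sympSnoc u 0 0) ⟨by simpa using hu, by simp⟩
      simpa [sympInner_succ] using this
    · have := h (sympSnoc 0 0 1) ⟨by simp, by simp⟩
      rw [sympInner_succ] at this
      simpa [sympInner] using this
  · rintro ⟨h1, h2⟩ u ⟨hu1, hu2⟩
    rw [sympInner_succ, h1 _ hu1, hu2, h2]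
    simp

theorem sympWeight_succ {n : ℕ} (u : SympVec (n + 1)) :
    sympWeight u = sympWeight (sympInit n u) +
      if (u.1 (Fin.last n), u.2 (Fin.last n)) ≠ (0, 0) then 1 else 0 := by
  simp only [sympWeight, Finset.card_filter]
  exact Fin.sum_univ_castSucc _

theorem tensorZero_apply {n : ℕ} (ψ : Qubits n) (x : Fin (n + 1) → ZMod 2) :
    tensorZero n ψ x = if x (Fin.last n) = 0 then ψ fun i => x i.castSucc else 0 := rfl

theorem tensorZero_injective (n : ℕ) : Function.Injective (tensorZero n) := by
  intro ψ φ h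
  ext x
  have := congrArg (fun f : Qubits (n + 1) => f (Fin.snoc (α := fun _ => ZMod 2) x 0)) h
  simpa [tensorZero_apply] using this

theorem pauli_tensorZero {n : ℕ} {u : SympVec (n + 1)} (hu : u.1 (Fin.last n) = 0)
    (ψ : Qubits n) : pauli u (tensorZero n ψ) = tensorZero n (pauli (sympInit n u) ψ) := by
  ext x
  simp only [pauli_apply, tensorZero_apply, Pi.add_apply, hu, add_zero]
  by_cases h : x (Fin.last n) = 0
  · simp only [h, if_true, Fin.sum_univ_castSucc, mul_zero, add_zero]
    rfl
  · simp [h]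

theorem IsJointEigenspace.lengthen {n : ℕ} {S : Submodule (ZMod 2) (SympVec n)}
    {χ : SympVec n → ℂ} {Q : Submodule ℂ (Qubits n)} (h : IsJointEigenspace S χ Q) :
    IsJointEigenspace (lengthenSpace S) (fun u => χ (sympInit n u)) (Q.map (tensorZero n)) := by
  constructor
  · obtain ⟨ψ, hψ, h0⟩ := h.exists_ne_zero
    refine (Submodule.ne_bot_iff _).2 ⟨_, Submodule.mem_map_of_mem hψ, fun h1 => h0 ?_⟩
    exact tensorZero_injective n (h1.trans (map_zero _).symm)
  · intro ψ
    rw [Submodule.mem_map]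
    constructor
    · rintro ⟨φ, hφ, rfl⟩ s ⟨hs, hs0⟩
      rw [pauli_tensorZero hs0, (h.mem_iff φ).1 hφ _ hs, map_smul]
    · intro hψ
      -- Z on the new qubit has eigenvalue χ 0 = 1, so ψ vanishes wherever the last coordinate is 1
      -- and is therefore of the form φ ⊗ |0⟩.
      have hz := hψ (sympSnoc 0 0 1) ⟨by simp, by simp⟩
      simp only [sympInit_snoc, h.eigen_zero, one_smul] at hz
      set φ : Qubits n := WithLp.toLp 2 fun x => ψ (Fin.snoc (α := fun _ => ZMod 2) x 0) with hφ
      have hψφ : tensorZero n φ = ψ := by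
        ext x
        rw [tensorZero_apply]
        split_ifs with hx
        · have h1 : Fin.snoc (α := fun _ => ZMod 2) (fun i => x i.castSucc) 0 = x := by
            funext i
            refine Fin.lastCases ?_ (fun j => ?_) i <;> simp [hx]
          exact congrArg (fun y => ψ y) h1
        · have h1 := congrArg (fun f : Qubits (n + 1) => f x) hz
          have key : ∀ c : ZMod 2, c ≠ 0 → c = 1 := by decide
          have h2 : x + (sympSnoc (0 : SympVec n) 0 1).1 = x := by
            funext i
            refine Fin.lastCases ?_ (fun j => ?_) i <;> simp [sympSnoc]
          have h3 : ∑ i, (sympSnoc (0 : SympVec n) 0 1).2 i * x i = 1 := by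
            rw [Fin.sum_univ_castSucc]
            simp [sympSnoc, key _ hx]
          simp only [pauli_apply, h2, h3, signC_one] at h1
          linear_combination (1 / 2 : ℂ) * h1
      refine ⟨φ, (h.mem_iff φ).2 fun s hs => ?_, hψφ⟩
      have h1 := hψ (sympSnoc s 0 0) ⟨by simpa using hs, by simp⟩
      rw [← hψφ, pauli_tensorZero (by simp), sympInit_snoc, ← map_smul] at h1
      exact tensorZero_injective n h1

/-- The rule `[[n, k, d]] → [[n + 1, k, d]]`. -/
theorem IsStabilizerCode.lengthen {n k d : ℕ} {S : Submodule (ZMod 2) (SympVec n)}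
    {χ : SympVec n → ℂ} {Q : Submodule ℂ (Qubits n)} (h : IsStabilizerCode n k d S χ Q) :
    IsStabilizerCode (n + 1) k d (lengthenSpace S) (fun u => χ (sympInit n u))
      (Q.map (tensorZero n)) := by
  refine ⟨?_, h.eigenspace.lengthen, ?_, ?_, ?_⟩
  · rw [sympDual_lengthenSpace]
    rintro u ⟨h1, h2⟩
    exact ⟨h.le_dual h1, h2⟩
  · rw [← (Submodule.equivMapOfInjective _ (tensorZero_injective n) Q).finrank_eq, h.finrank_eq]
  · obtain ⟨⟨e, heC, heS, hed⟩, -⟩ := h.isLeast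
    refine ⟨sympSnoc e 0 0, ?_, fun h1 => heS (by simpa using h1.1), ?_⟩
    · rw [sympDual_lengthenSpace]
      exact ⟨by simpa using heC, by simp⟩
    · rw [sympWeight_succ]
      simp [hed]
  · rintro w ⟨u, hu, huS, rfl⟩
    rw [sympDual_lengthenSpace] at hu
    rw [sympWeight_succ]
    refine le_trans (h.isLeast.2 ⟨_, hu.1, fun h1 => huS ⟨h1, hu.2⟩, rfl⟩) (Nat.le_add_right _ _)

/-- The codes that are reached from `Q₀` by `i` passages to a subcode and `j` lengthenings. -/
theorem exists_propagates {n k d : ℕ} {S : Submodule (ZMod 2) (SympVec n)}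
    {χ : SympVec n → ℂ} {Q : Submodule ℂ (Qubits n)} (h : IsStabilizerCode n k d S χ Q)
    (i j : ℕ) (hi : i < k) :
    ∃ S' χ' Q', IsStabilizerCode (n + j) (k - i) d S' χ' Q' ∧ Propagates Q (n + j) Q' := by
  -- All passages to subcodes take place at length n, before any qubit is adjoined; i < k keeps
  -- every exponent positive.
  induction j with
  | zero =>
    induction i with
    | zero => exact ⟨S, χ, Q, h, .refl⟩
    | succ i ih =>
      obtain ⟨S', χ', Q', h', hp⟩ := ih (by omega)
      obtain ⟨k', hk'⟩ : ∃ k', k - i = k' + 1 := ⟨k - i - 1, by omega⟩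
      have hk2 : k - (i + 1) = k' := by omega
      rw [hk'] at h'
      obtain ⟨S'', χ'', Q'', hle, h''⟩ := h'.exists_subcode (by omega)
      rw [hk2]
      exact ⟨S'', χ'', Q'', h'', .subcode hp (by omega) h'.isQECC hle
        ⟨_, h''.isSymplecticConstruction⟩ h''.isQECC⟩
  | succ j ih =>
    obtain ⟨S', χ', Q', h', hp⟩ := ih
    exact ⟨_, _, _, h'.lengthen, .lengthen hp (by omega) h'.isQECC h'.lengthen.isQECC⟩

/-! ## Quasi-cyclic codes -/

theorem monic_X_pow_sub_one {n : ℕ} (hn : 0 < n) : (X ^ n - 1 : (ZMod 2)[X]).Monic := by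
  simpa using monic_X_pow_sub_C (1 : ZMod 2) hn.ne'

theorem degree_X_pow_sub_one {n : ℕ} (hn : 0 < n) : (X ^ n - 1 : (ZMod 2)[X]).degree = n := by
  simpa using degree_X_pow_sub_C hn (1 : ZMod 2)

/-- The map `coeffVec n` as a linear map. -/
noncomputable def coeffLin (n : ℕ) : (ZMod 2)[X] →ₗ[ZMod 2] (Fin n → ZMod 2) where
  toFun := coeffVec n
  map_add' p q := by
    funext i
    simp [coeffVec, add_modByMonic]
  map_smul' c p := by
    funext i
    simp [coeffVec, smul_modByMonic]

theorem coeffLin_apply (n : ℕ) (p : (ZMod 2)[X]) : coeffLin n p = coeffVec n p := rfl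

theorem coeffVec_eq_zero_iff {n : ℕ} (hn : 0 < n) (p : (ZMod 2)[X]) :
    coeffVec n p = 0 ↔ (X ^ n - 1) ∣ p := by
  rw [← modByMonic_eq_zero_iff_dvd (monic_X_pow_sub_one hn)]
  constructor
  · intro h
    ext i
    by_cases hi : i < n
    · exact congrFun h ⟨i, hi⟩
    · rw [coeff_zero]
      refine coeff_eq_zero_of_degree_lt ?_
      refine (degree_modByMonic_lt _ (monic_X_pow_sub_one hn)).trans_le ?_
      rw [degree_X_pow_sub_one hn]
      exact_mod_cast not_lt.1 hi
  · intro h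
    funext i
    simp [coeffVec, h]

theorem coeffVec_congr {n : ℕ} (hn : 0 < n) {p q : (ZMod 2)[X]} (h : (X ^ n - 1) ∣ p - q) :
    coeffVec n p = coeffVec n q := by
  rw [← coeffVec_eq_zero_iff hn, ← coeffLin_apply, map_sub] at h
  exact sub_eq_zero.1 h

theorem coeffVec_of_degree_lt {n : ℕ} (hn : 0 < n) {p : (ZMod 2)[X]} (hp : p.degree < n)
    (i : Fin n) : coeffVec n p i = p.coeff i := by
  rw [coeffVec, (modByMonic_eq_self_iff (monic_X_pow_sub_one hn)).2]
  rwa [degree_X_pow_sub_one hn]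

/-- Multiplication by `x` is a cyclic shift of the coefficients. -/
theorem coeffVec_X_mul (m : ℕ) (p : (ZMod 2)[X]) :
    coeffVec (m + 1) (X * p) = Fin.cons (α := fun _ => ZMod 2) (coeffVec (m + 1) p (Fin.last m))
      fun j => coeffVec (m + 1) p j.castSucc := by
  have hn : 0 < m + 1 := m.succ_pos
  set r := p %ₘ (X ^ (m + 1) - 1) with hr
  have hrdeg : r.degree < ((m + 1 : ℕ) : WithBot ℕ) := by
    rw [← degree_X_pow_sub_one hn]
    exact degree_modByMonic_lt _ (monic_X_pow_sub_one hn)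
  -- Subtracting the leading coefficient times x^n - 1 moves the coefficient that overflows back to
  -- degree 0.
  have h1 : coeffVec (m + 1) (X * p) =
      coeffVec (m + 1) (X * r - C (r.coeff m) * (X ^ (m + 1) - 1)) := by
    refine coeffVec_congr hn ⟨X * (p /ₘ (X ^ (m + 1) - 1)) + C (r.coeff m), ?_⟩
    have := modByMonic_add_div p (X ^ (m + 1) - 1 : (ZMod 2)[X])
    rw [← hr] at this
    linear_combination -X * this
  have hcoeff : ∀ i, (X * r - C (r.coeff m) * (X ^ (m + 1) - 1)).coeff i =
      (X * r).coeff i - r.coeff m * ((if i = m + 1 then 1 else 0) - if i = 0 then 1 else 0) := by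
    intro i
    simp [coeff_X_pow, coeff_one]
  have hdeg : (X * r - C (r.coeff m) * (X ^ (m + 1) - 1)).degree < ((m + 1 : ℕ) : WithBot ℕ) := by
    rw [degree_lt_iff_coeff_zero]
    intro i hi
    rw [hcoeff]
    obtain ⟨j, rfl⟩ : ∃ j, i = j + 1 := ⟨i - 1, by omega⟩
    rw [coeff_X_mul]
    rcases Nat.lt_or_ge m j with h | h
    · have : r.coeff j = 0 := (degree_lt_iff_coeff_zero _ _).1 hrdeg j h
      simp [this, h.ne']
    · have : j = m := by omega
      subst this
      simp
  rw [h1]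
  funext i
  rw [coeffVec_of_degree_lt hn hdeg, hcoeff]
  refine Fin.cases ?_ (fun j => ?_) i
  · simp [coeffVec, hr]
  · have : (j : ℕ) ≠ m := j.2.ne
    simp [coeffVec, hr, this]

/-- The map that sends `(a, b)` to the word `a (v g₁, g₁) + b (g₂, v g₂)`. -/
noncomputable def qcMap (n : ℕ) (g₁ g₂ v : (ZMod 2)[X]) :
    (ZMod 2)[X] × (ZMod 2)[X] →ₗ[ZMod 2] SympVec n :=
  ((coeffLin n).prodMap (coeffLin n)).comp (σ₁₂ := RingHom.id (ZMod 2))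
    { toFun := fun c => (c.1 * (v * g₁) + c.2 * g₂, c.1 * g₁ + c.2 * (v * g₂))
      map_add' := fun c d => by ext1 <;> simp only [Prod.fst_add, Prod.snd_add] <;> ring
      map_smul' := fun c d => by simp [RingHom.id_apply] }

theorem qcMap_apply (n : ℕ) (g₁ g₂ v a b : (ZMod 2)[X]) :
    qcMap n g₁ g₂ v (a, b) =
      (coeffVec n (a * (v * g₁) + b * g₂), coeffVec n (a * g₁ + b * (v * g₂))) := rfl

theorem quasiCyclicCode_eq_range (n : ℕ) (g₁ g₂ v : (ZMod 2)[X]) :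
    quasiCyclicCode n g₁ g₂ v = LinearMap.range (qcMap n g₁ g₂ v) := by
  rw [quasiCyclicCode, ← Submodule.span_eq (LinearMap.range (qcMap n g₁ g₂ v))]
  congr 1
  ext u
  simp only [Set.mem_ofPred_eq, SetLike.mem_coe, LinearMap.mem_range, Prod.exists, qcMap_apply]
  exact exists_congr fun a => exists_congr fun b => eq_comm

theorem mem_quasiCyclicCode {n : ℕ} {g₁ g₂ v : (ZMod 2)[X]} {u : SympVec n} :
    u ∈ quasiCyclicCode n g₁ g₂ v ↔ ∃ a b : (ZMod 2)[X],
      u = (coeffVec n (a * (v * g₁) + b * g₂), coeffVec n (a * g₁ + b * (v * g₂))) := by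
  rw [quasiCyclicCode_eq_range]
  simp only [LinearMap.mem_range, Prod.exists, qcMap_apply]
  exact exists_congr fun a => exists_congr fun b => eq_comm

/-- The dimension of a quasi-cyclic code is at least `2n - deg g₁ - deg g₂` if `1 + v²` is
invertible modulo `xⁿ - 1`. -/
theorem le_finrank_quasiCyclicCode {n d₁ d₂ : ℕ} (hn : 0 < n) {g₁ g₂ v w : (ZMod 2)[X]}
    (hg₁ : g₁.degree = d₁) (hg₂ : g₂.degree = d₂)
    (hw : (X ^ n - 1) ∣ w * (1 + v * v) - 1) :
    (n - d₁) + (n - d₂) ≤ Module.finrank (ZMod 2) (quasiCyclicCode n g₁ g₂ v) := by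
  have h2 : (2 : (ZMod 2)[X]) = 0 := CharTwo.two_eq_zero
  -- The inverse w removes the factor 1 + v², and then a g has degree below n, too small for a
  -- nonzero multiple of x^n - 1.
  have hsmall : ∀ {g : (ZMod 2)[X]} {d : ℕ}, g.degree = d → ∀ a ∈ degreeLT (ZMod 2) (n - d),
      (X ^ n - 1) ∣ (1 + v * v) * (a * g) → a = 0 := by
    intro g d hg a ha hdvd
    by_contra h0
    have hdvd' : (X ^ n - 1) ∣ a * g := by
      have e : a * g = w * ((1 + v * v) * (a * g)) - (a * g) * (w * (1 + v * v) - 1) := by ring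
      rw [e]
      exact dvd_sub (hdvd.mul_left _) (hw.mul_left _)
    have hg0 : g ≠ 0 := by
      rintro rfl
      rw [degree_zero] at hg
      exact absurd hg (by simp)
    have hle := degree_le_of_dvd hdvd' (mul_ne_zero h0 hg0)
    rw [degree_X_pow_sub_one hn, degree_mul, hg, degree_eq_natDegree h0] at hle
    rw [mem_degreeLT, degree_eq_natDegree h0] at ha
    have h3 : a.natDegree < n - d := by exact_mod_cast ha
    have h4 : n ≤ a.natDegree + d := by exact_mod_cast hle
    omega
  let ι : degreeLT (ZMod 2) (n - d₁) × degreeLT (ZMod 2) (n - d₂) →ₗ[ZMod 2]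
      (ZMod 2)[X] × (ZMod 2)[X] := (Submodule.subtype _).prodMap (Submodule.subtype _)
  have hinj : Function.Injective ((qcMap n g₁ g₂ v).comp ι) := by
    rw [← LinearMap.ker_eq_bot, LinearMap.ker_eq_bot']
    rintro ⟨⟨a, ha⟩, ⟨b, hb⟩⟩ h
    have h' : qcMap n g₁ g₂ v (a, b) = 0 := h
    rw [qcMap_apply, Prod.mk_eq_zero, coeffVec_eq_zero_iff hn, coeffVec_eq_zero_iff hn] at h'
    obtain ⟨e1, e2⟩ := h'
    -- Adding v times the first component to the second cancels b in characteristic 2 and leaves (1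
    -- + v²) a g₁; exchanging the roles of the components isolates b.
    have ha0 : a = 0 := by
      refine hsmall hg₁ a ha ?_
      have e : (1 + v * v) * (a * g₁) = v * (a * (v * g₁) + b * g₂) + (a * g₁ + b * (v * g₂)) := by
        linear_combination (-(v * b * g₂)) * h2
      rw [e]
      exact dvd_add (e1.mul_left _) e2
    have hb0 : b = 0 := by
      refine hsmall hg₂ b hb ?_
      have e : (1 + v * v) * (b * g₂) = (a * (v * g₁) + b * g₂) + v * (a * g₁ + b * (v * g₂)) := by
        linear_combination (-(v * a * g₁)) * h2
      rw [e]
      exact dvd_add e1 (e2.mul_left _)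
    subst ha0 hb0
    rfl
  have hfr : ∀ m, Module.finrank (ZMod 2) (degreeLT (ZMod 2) m) = m := fun m => by
    rw [(degreeLTEquiv (ZMod 2) m).finrank_eq, Module.finrank_fin_fun]
  have hfin : ∀ m, Module.Finite (ZMod 2) (degreeLT (ZMod 2) m) := fun m =>
    Module.Finite.equiv (degreeLTEquiv (ZMod 2) m).symm
  have h5 : (n - d₁) + (n - d₂) =
      Module.finrank (ZMod 2) (degreeLT (ZMod 2) (n - d₁) × degreeLT (ZMod 2) (n - d₂)) := by
    rw [Module.finrank_prod, hfr, hfr]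
  rw [h5, quasiCyclicCode_eq_range, ← LinearMap.finrank_range_of_inj hinj]
  exact Submodule.finrank_mono (LinearMap.range_comp_le_range _ _)

/-! ### The symplectic dual of a quasi-cyclic code -/

/-- The standard inner product of the coefficient vectors. -/
noncomputable def coeffDot (n : ℕ) (p q : (ZMod 2)[X]) : ZMod 2 :=
  ∑ i, coeffVec n p i * coeffVec n q i

theorem coeffDot_X_mul {n : ℕ} (hn : 0 < n) (p q : (ZMod 2)[X]) :
    coeffDot n (X * p) (X * q) = coeffDot n p q := by
  obtain ⟨m, rfl⟩ : ∃ m, n = m + 1 := ⟨n - 1, by omega⟩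
  rw [coeffDot, coeffVec_X_mul, coeffVec_X_mul, Fin.sum_univ_succ, coeffDot,
    Fin.sum_univ_castSucc, add_comm]
  simp

theorem coeffDot_X_pow_mul {n : ℕ} (hn : 0 < n) (p q : (ZMod 2)[X]) (j : ℕ) :
    coeffDot n (X ^ j * p) (X ^ j * q) = coeffDot n p q := by
  induction j with
  | zero => simp
  | succ j ih => rw [pow_succ', mul_assoc, mul_assoc, coeffDot_X_mul hn, ih]

theorem coeffDot_one {n : ℕ} (hn : 0 < n) (p : (ZMod 2)[X]) :
    coeffDot n p 1 = coeffVec n p ⟨0, hn⟩ := by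
  have h1 : ∀ i : Fin n, coeffVec n 1 i = if i = ⟨0, hn⟩ then 1 else 0 := by
    intro i
    rw [coeffVec_of_degree_lt hn (by rw [degree_one]; exact_mod_cast hn), coeff_one]
    simp [Fin.ext_iff]
  simp [coeffDot, h1]

theorem X_pow_sub_one_dvd (n j : ℕ) : (X ^ n - 1 : (ZMod 2)[X]) ∣ X ^ (n * j) - 1 := by
  rw [pow_mul]
  exact sub_one_dvd_pow_sub_one _ _

/-- The dot product is the constant coefficient of p(x) q(1/x), with x^(n-1) playing the part of
1/x. By additivity it is enough to take q = x^j, where shift invariance moves everything to j = 0.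
-/
theorem coeffDot_eq {n : ℕ} (hn : 0 < n) (p q : (ZMod 2)[X]) :
    coeffDot n p q = coeffVec n (p * q.comp (X ^ (n - 1))) ⟨0, hn⟩ := by
  induction q using Polynomial.induction_on' with
  | add q r hq hr =>
    rw [add_comp, mul_add, ← coeffLin_apply n (_ + _), map_add, Pi.add_apply, coeffLin_apply,
      coeffLin_apply, ← hq, ← hr]
    simp only [coeffDot, ← Finset.sum_add_distrib, ← mul_add, ← Pi.add_apply]
    refine Finset.sum_congr rfl fun i _ => ?_
    rw [← coeffLin_apply n (q + r), map_add]
    rfl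
  | monomial j c =>
    have hc : ∀ c : ZMod 2, c = 0 ∨ c = 1 := by decide
    rcases hc c with rfl | rfl
    · simp [coeffDot, ← coeffLin_apply]
    · rw [monomial_one_right_eq_X_pow, X_pow_comp, ← pow_mul, ← coeffDot_one hn,
        ← coeffDot_X_pow_mul hn _ 1 j, mul_one, coeffDot, coeffDot]
      have : coeffVec n p = coeffVec n (X ^ j * (p * X ^ ((n - 1) * j))) := by
        symm
        refine coeffVec_congr hn ?_
        have e : X ^ j * (p * X ^ ((n - 1) * j)) - p = p * (X ^ (n * j) - 1 : (ZMod 2)[X]) := by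
          have : n * j = j + (n - 1) * j := by
            obtain ⟨m, rfl⟩ : ∃ m, n = m + 1 := ⟨n - 1, by omega⟩
            simp only [Nat.add_sub_cancel]
            ring
          rw [this, pow_add]
          ring
        rw [e]
        exact (X_pow_sub_one_dvd n j).mul_left _
      rw [this]

/-- Write * for x ↦ 1/x. In the form of two words the coefficients of a c* and b d* contain v - v*,
while those of a d* and b c* contain g₁ h₂* and g₂ h₁*. All four vanish modulo x^n - 1. -/
theorem quasiCyclicCode_le_sympDual {n : ℕ} (hn : 0 < n) {g₁ g₂ h₁ h₂ v : (ZMod 2)[X]}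
    (hv : (X ^ n - 1) ∣ v.comp (X ^ (n - 1)) - v)
    (h12 : (X ^ n - 1) ∣ g₁ * h₂.comp (X ^ (n - 1)))
    (h21 : (X ^ n - 1) ∣ g₂ * h₁.comp (X ^ (n - 1))) :
    quasiCyclicCode n h₁ h₂ v ≤ sympDual (quasiCyclicCode n g₁ g₂ v) := by
  intro y hy u hu
  obtain ⟨a, b, rfl⟩ := mem_quasiCyclicCode.1 hu
  obtain ⟨c, d, rfl⟩ := mem_quasiCyclicCode.1 hy
  obtain ⟨k1, hk1⟩ := h12
  obtain ⟨k2, hk2⟩ := h21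
  obtain ⟨k3, hk3⟩ := hv
  set f : (ZMod 2)[X] → (ZMod 2)[X] := fun p => p.comp (X ^ (n - 1)) with hf
  have e : sympInner
      (coeffVec n (a * (v * g₁) + b * g₂), coeffVec n (a * g₁ + b * (v * g₂)))
      (coeffVec n (c * (v * h₁) + d * h₂), coeffVec n (c * h₁ + d * (v * h₂))) =
      coeffVec n ((a * (v * g₁) + b * g₂) * f (c * h₁ + d * (v * h₂)) -
        (a * g₁ + b * (v * g₂)) * f (c * (v * h₁) + d * h₂)) ⟨0, hn⟩ := by
    rw [← coeffLin_apply n (_ - _), map_sub, Pi.sub_apply, coeffLin_apply, coeffLin_apply,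
      ← coeffDot_eq hn, ← coeffDot_eq hn, coeffDot, coeffDot, sympInner, Finset.sum_sub_distrib]
  rw [e, (coeffVec_eq_zero_iff hn _).2, Pi.zero_apply]
  simp only [hf, add_comp, mul_comp]
  refine ⟨-(a * c.comp (X ^ (n - 1)) * g₁ * h₁.comp (X ^ (n - 1)) * k3) +
    a * d.comp (X ^ (n - 1)) * (v * v.comp (X ^ (n - 1)) - 1) * k1 +
    b * c.comp (X ^ (n - 1)) * (1 - v * v.comp (X ^ (n - 1))) * k2 +
    b * d.comp (X ^ (n - 1)) * g₂ * h₂.comp (X ^ (n - 1)) * k3, ?_⟩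
  linear_combination
    (-(a * c.comp (X ^ (n - 1)) * g₁ * h₁.comp (X ^ (n - 1))) +
      b * d.comp (X ^ (n - 1)) * g₂ * h₂.comp (X ^ (n - 1))) * hk3 +
    a * d.comp (X ^ (n - 1)) * (v * v.comp (X ^ (n - 1)) - 1) * hk1 +
    b * c.comp (X ^ (n - 1)) * (1 - v * v.comp (X ^ (n - 1))) * hk2

theorem quasiCyclicCode_mono {n : ℕ} {g₁ g₂ h₁ h₂ v : (ZMod 2)[X]} (h1 : g₁ ∣ h₁) (h2 : g₂ ∣ h₂) :
    quasiCyclicCode n h₁ h₂ v ≤ quasiCyclicCode n g₁ g₂ v := by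
  intro u hu
  obtain ⟨a, b, rfl⟩ := mem_quasiCyclicCode.1 hu
  obtain ⟨c, rfl⟩ := h1
  obtain ⟨d, rfl⟩ := h2
  refine mem_quasiCyclicCode.2 ⟨a * c, b * d, ?_⟩
  ext1
  · simp only
    congr 1
    ring
  · simp only
    congr 1
    ring

/-- A quasi-cyclic code that contains its symplectic dual, and the dimension of the dual. -/
theorem sympDual_quasiCyclicCode {n d₁ d₂ : ℕ} (hn : 0 < n) {g₁ g₂ h₁ h₂ v w : (ZMod 2)[X]}
    (hg₁ : g₁.degree = d₁) (hg₂ : g₂.degree = d₂) (hd₁ : d₁ ≤ n) (hd₂ : d₂ ≤ n)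
    (hh₁ : h₁.degree = (n - d₂ : ℕ)) (hh₂ : h₂.degree = (n - d₁ : ℕ))
    (h1 : g₁ ∣ h₁) (h2 : g₂ ∣ h₂)
    (hw : (X ^ n - 1) ∣ w * (1 + v * v) - 1)
    (hv : (X ^ n - 1) ∣ v.comp (X ^ (n - 1)) - v)
    (h12 : (X ^ n - 1) ∣ g₁ * h₂.comp (X ^ (n - 1)))
    (h21 : (X ^ n - 1) ∣ g₂ * h₁.comp (X ^ (n - 1))) :
    sympDual (quasiCyclicCode n g₁ g₂ v) ≤ quasiCyclicCode n g₁ g₂ v ∧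
      Module.finrank (ZMod 2) (sympDual (quasiCyclicCode n g₁ g₂ v)) = d₁ + d₂ := by
  have hle := quasiCyclicCode_le_sympDual hn hv h12 h21
  have hC := le_finrank_quasiCyclicCode hn hg₁ hg₂ hw
  have hD := le_finrank_quasiCyclicCode hn hh₁ hh₂ hw
  have hCC := finrank_sympDual (quasiCyclicCode n g₁ g₂ v)
  have hmono := Submodule.finrank_mono hle
  -- The code has dimension at least 2n - d₁ - d₂, so its dual has at most d₁ + d₂, which the code
  -- of h₁, h₂ already attains.
  have heq : quasiCyclicCode n h₁ h₂ v = sympDual (quasiCyclicCode n g₁ g₂ v) :=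
    Submodule.eq_of_le_of_finrank_le hle (by omega)
  exact ⟨heq ▸ quasiCyclicCode_mono h1 h2, by omega⟩

/-! ## Polynomials over `F₂` as bit strings -/

/-- The `i`th bit of `A` as an element of the field with two elements. -/
def bitVal (A i : ℕ) : ZMod 2 := if A.testBit i then 1 else 0

theorem bitVal_xor (A B i : ℕ) : bitVal (A ^^^ B) i = bitVal A i + bitVal B i := by
  have h : (1 : ZMod 2) + 1 = 0 := by decide
  simp only [bitVal, Nat.testBit_xor]
  cases A.testBit i <;> cases B.testBit i <;> simp [h]

@[simp] theorem bitVal_zero (i : ℕ) : bitVal 0 i = 0 := by simp [bitVal]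

/-- This reduces identities between strings built from XOR to linear identities over F₂, one bit at
a time. -/
theorem bitVal_injective : Function.Injective bitVal := by
  intro A B h
  refine Nat.eq_of_testBit_eq fun i => ?_
  have := congrFun h i
  simp only [bitVal] at this
  cases hA : A.testBit i <;> cases hB : B.testBit i <;> simp_all

/-- The polynomial whose coefficients are the binary digits of `A`. -/
noncomputable def bitPoly (A : ℕ) : (ZMod 2)[X] :=
  ∑ i ∈ Finset.range A.size, monomial i (bitVal A i)

theorem coeff_bitPoly (A i : ℕ) : (bitPoly A).coeff i = bitVal A i := by
  simp only [bitPoly, finsetSum_coeff, coeff_monomial]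
  rw [Finset.sum_ite_eq' (Finset.range A.size) i]
  split_ifs with h
  · rfl
  · have hlt : A < 2 ^ i :=
      (Nat.lt_size_self A).trans_le (Nat.pow_le_pow_right two_pos (by simpa using h))
    simp [bitVal, Nat.testBit_lt_two_pow hlt]

@[simp] theorem bitPoly_zero : bitPoly 0 = 0 := by
  ext i
  simp [coeff_bitPoly]

theorem bitPoly_xor (A B : ℕ) : bitPoly (A ^^^ B) = bitPoly A + bitPoly B := by
  ext i
  simp [coeff_bitPoly, bitVal_xor]

theorem bitPoly_shiftLeft (A k : ℕ) : bitPoly (A <<< k) = X ^ k * bitPoly A := by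
  ext i
  rw [coeff_X_pow_mul', coeff_bitPoly, coeff_bitPoly]
  by_cases h : k ≤ i <;> simp [bitVal, Nat.testBit_shiftLeft, h]

theorem bitPoly_one : bitPoly 1 = 1 := by
  ext i
  rw [coeff_bitPoly, coeff_one, bitVal]
  cases i <;> simp [Nat.testBit_succ]

theorem bitPoly_mod_two (A : ℕ) : bitPoly (A % 2) = if A % 2 = 1 then 1 else 0 := by
  rcases Nat.mod_two_eq_zero_or_one A with h | h <;> simp [h, bitPoly_one]

theorem bitPoly_eq_mod_add_div (A k : ℕ) :
    bitPoly A = bitPoly (A % 2 ^ k) + X ^ k * bitPoly (A >>> k) := by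
  rw [← bitPoly_shiftLeft, ← bitPoly_xor]
  congr 1
  refine Nat.eq_of_testBit_eq fun i => ?_
  rw [Nat.testBit_xor, Nat.testBit_mod_two_pow, Nat.testBit_shiftLeft, Nat.testBit_shiftRight]
  by_cases h : i < k
  · simp [h, not_le.2 h]
  · simp [h, not_lt.1 h]

theorem bitPoly_eq_bit (A : ℕ) :
    bitPoly A = (if A % 2 = 1 then 1 else 0) + X * bitPoly (A / 2) := by
  have h := bitPoly_eq_mod_add_div A 1
  rwa [pow_one, bitPoly_mod_two, pow_one, Nat.shiftRight_one] at h

theorem degree_bitPoly {A d : ℕ} (h1 : 2 ^ d ≤ A) (h2 : A < 2 ^ (d + 1)) :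
    (bitPoly A).degree = d := by
  have htop : (bitPoly A).coeff d = 1 := by
    rw [coeff_bitPoly, bitVal, Nat.testBit_of_two_pow_le_and_two_pow_add_one_gt h1 h2]
    rfl
  refine le_antisymm ?_ (le_degree_of_ne_zero (by rw [htop]; exact one_ne_zero))
  rw [degree_le_iff_coeff_zero]
  intro m hm
  have hm' : d + 1 ≤ m := by exact_mod_cast hm
  rw [coeff_bitPoly, bitVal, Nat.testBit_lt_two_pow
    (h2.trans_le (Nat.pow_le_pow_right two_pos hm'))]
  rfl

/-- The carry-less product of `a` and of the lowest `m` bits of `b`. -/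
noncomputable def clMul (m : ℕ) : ℕ → ℕ → ℕ :=
  Nat.rec (fun _ _ => 0) (fun _ ih a b =>
    Nat.xor (Nat.mul a (Nat.mod b 2)) (ih (Nat.mul a 2) (Nat.div b 2))) m

theorem clMul_succ (m a b : ℕ) :
    clMul (m + 1) a b = (a * (b % 2)) ^^^ clMul m (a * 2) (b / 2) := rfl

theorem bitPoly_clMul (m a b : ℕ) (hb : b < 2 ^ m) :
    bitPoly (clMul m a b) = bitPoly a * bitPoly b := by
  induction m generalizing a b with
  | zero =>
    obtain rfl : b = 0 := by simpa using hb
    change bitPoly 0 = _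
    simp
  | succ m ih =>
    have h2 : a * 2 = a <<< 1 := by simp [Nat.shiftLeft_eq]
    rw [clMul_succ, bitPoly_xor, ih _ _ (by rw [pow_succ] at hb; omega), bitPoly_eq_bit b, h2,
      bitPoly_shiftLeft, pow_one]
    rcases Nat.mod_two_eq_zero_or_one b with h | h <;> simp [h] <;> ring

/-- Reduction modulo `xⁿ - 1`, by adding up blocks of length `n`. -/
noncomputable def cycFold (n m : ℕ) : ℕ → ℕ :=
  Nat.rec (fun x => x)
    (fun _ ih x => ih (Nat.xor (Nat.mod x (Nat.pow 2 n)) (Nat.shiftRight x n))) m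

theorem cycFold_succ (n m x : ℕ) :
    cycFold n (m + 1) x = cycFold n m ((x % 2 ^ n) ^^^ (x >>> n)) := rfl

theorem dvd_bitPoly_sub_cycFold (n m x : ℕ) :
    (X ^ n - 1) ∣ bitPoly x - bitPoly (cycFold n m x) := by
  induction m generalizing x with
  | zero =>
    change _ ∣ bitPoly x - bitPoly x
    simp
  | succ m ih =>
    rw [cycFold_succ]
    have h := ih ((x % 2 ^ n) ^^^ (x >>> n))
    rw [bitPoly_xor] at h
    have e : bitPoly x - bitPoly (cycFold n m ((x % 2 ^ n) ^^^ (x >>> n))) =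
        (bitPoly (x % 2 ^ n) + bitPoly (x >>> n) -
          bitPoly (cycFold n m ((x % 2 ^ n) ^^^ (x >>> n)))) +
        (X ^ n - 1) * bitPoly (x >>> n) := by
      rw [bitPoly_eq_mod_add_div x n]
      ring
    rw [e]
    exact dvd_add h (Dvd.intro _ rfl)

/-- Every fold stays in the residue class modulo x^n - 1, so the conclusion is sound for any number
of folds; the counts only have to be large enough for the two results to coincide. -/
theorem dvd_bitPoly_sub {n m m' x y : ℕ} (h : cycFold n m x = cycFold n m' y) :
    (X ^ n - 1) ∣ bitPoly x - bitPoly y := by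
  have h1 := dvd_bitPoly_sub_cycFold n m x
  have h2 := dvd_bitPoly_sub_cycFold n m' y
  rw [h] at h1
  have e : bitPoly x - bitPoly y = (bitPoly x - bitPoly (cycFold n m' y)) -
      (bitPoly y - bitPoly (cycFold n m' y)) := by ring
  rw [e]
  exact dvd_sub h1 h2

/-- Move the bit at position `i < m` to position `s i`. -/
noncomputable def spreadBits (s m : ℕ) : ℕ → ℕ :=
  Nat.rec (fun _ => 0)
    (fun _ ih a => Nat.xor (Nat.mod a 2) (Nat.shiftLeft (ih (Nat.div a 2)) s)) m

theorem spreadBits_succ (s m a : ℕ) :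
    spreadBits s (m + 1) a = (a % 2) ^^^ (spreadBits s m (a / 2) <<< s) := rfl

theorem bitPoly_spreadBits (s m a : ℕ) (ha : a < 2 ^ m) :
    bitPoly (spreadBits s m a) = (bitPoly a).comp (X ^ s) := by
  induction m generalizing a with
  | zero =>
    obtain rfl : a = 0 := by simpa using ha
    change bitPoly 0 = _
    simp
  | succ m ih =>
    rw [spreadBits_succ, bitPoly_xor, bitPoly_shiftLeft,
      ih _ (by rw [pow_succ] at ha; omega), bitPoly_eq_bit a, bitPoly_mod_two]
    rcases Nat.mod_two_eq_zero_or_one a with h | h <;> simp [h]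

/-- The bit string of a polynomial given by runs. -/
def runBits : List (ZMod 2 × ℕ) → ℕ
  | [] => 0
  | (c, m) :: t => (if c = 1 then 2 ^ m - 1 else 0) ^^^ (runBits t <<< m)

theorem bitPoly_two_pow_sub_one (m : ℕ) :
    bitPoly (2 ^ m - 1) = ∑ i ∈ Finset.range m, X ^ i := by
  ext i
  rw [coeff_bitPoly, finsetSum_coeff, bitVal, Nat.testBit_two_pow_sub_one]
  simp [coeff_X_pow]

theorem ofRuns_eq_bitPoly (L : List (ZMod 2 × ℕ)) : ofRuns L = bitPoly (runBits L) := by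
  induction L with
  | nil => simp [ofRuns, runBits]
  | cons a t ih =>
    obtain ⟨c, m⟩ := a
    have hc : ∀ c : ZMod 2, c = 0 ∨ c = 1 := by decide
    rw [ofRuns, runBits, bitPoly_xor, bitPoly_shiftLeft, ih]
    rcases hc c with rfl | rfl <;> simp [bitPoly_two_pow_sub_one]

theorem coeffVec_bitPoly {n A : ℕ} (hn : 0 < n) (hA : A < 2 ^ n) (i : Fin n) :
    coeffVec n (bitPoly A) i = bitVal A i := by
  rw [coeffVec_of_degree_lt hn, coeff_bitPoly]
  rw [degree_lt_iff_coeff_zero]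
  intro m hm
  rw [coeff_bitPoly, bitVal,
    Nat.testBit_lt_two_pow (hA.trans_le (Nat.pow_le_pow_right two_pos hm))]
  rfl

/-- The conditions on bit strings under which the quasi-cyclic code of `g₁`, `g₂`, `v` contains
its symplectic dual. -/
structure DualCertificate (n d₁ d₂ g₁ g₂ v h₁ h₂ c₁ c₂ w : ℕ) : Prop where
  pos : 0 < n
  le₁ : d₁ ≤ n
  le₂ : d₂ ≤ n
  deg_g₁ : 2 ^ d₁ ≤ g₁ ∧ g₁ < 2 ^ (d₁ + 1)
  deg_g₂ : 2 ^ d₂ ≤ g₂ ∧ g₂ < 2 ^ (d₂ + 1)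
  deg_h₁ : 2 ^ (n - d₂) ≤ h₁ ∧ h₁ < 2 ^ (n - d₂ + 1)
  deg_h₂ : 2 ^ (n - d₁) ≤ h₂ ∧ h₂ < 2 ^ (n - d₁ + 1)
  size : v < 2 ^ (n + 1) ∧ c₁ < 2 ^ (n + 1) ∧ c₂ < 2 ^ (n + 1) ∧ w < 2 ^ (n + 1)
  mul₁ : clMul (n + 1) g₁ c₁ = h₁
  mul₂ : clMul (n + 1) g₂ c₂ = h₂
  inv : cycFold n 4 (clMul (n + 1) (1 ^^^ clMul (n + 1) v v) w) = cycFold n 4 1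
  pal : cycFold n n (spreadBits (n - 1) (n + 1) v) = cycFold n n v
  orth₁ : cycFold n (n + 1) (clMul (n + 1) (spreadBits (n - 1) (n + 1) h₂) g₁) =
    cycFold n (n + 1) 0
  orth₂ : cycFold n (n + 1) (clMul (n + 1) (spreadBits (n - 1) (n + 1) h₁) g₂) =
    cycFold n (n + 1) 0

theorem DualCertificate.sympDual_le {n d₁ d₂ g₁ g₂ v h₁ h₂ c₁ c₂ w : ℕ}
    (h : DualCertificate n d₁ d₂ g₁ g₂ v h₁ h₂ c₁ c₂ w) :
    sympDual (quasiCyclicCode n (bitPoly g₁) (bitPoly g₂) (bitPoly v)) ≤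
        quasiCyclicCode n (bitPoly g₁) (bitPoly g₂) (bitPoly v) ∧
      Module.finrank (ZMod 2)
        (sympDual (quasiCyclicCode n (bitPoly g₁) (bitPoly g₂) (bitPoly v))) = d₁ + d₂ := by
  obtain ⟨hv, hc₁, hc₂, hw⟩ := h.size
  have hlt : ∀ {a e : ℕ}, e ≤ n → a < 2 ^ (e + 1) → a < 2 ^ (n + 1) := fun he ha =>
    ha.trans_le (Nat.pow_le_pow_right two_pos (by omega))
  have hg₁ := hlt h.le₁ h.deg_g₁.2
  have hg₂ := hlt h.le₂ h.deg_g₂.2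
  have hh₁ := hlt (Nat.sub_le _ _) h.deg_h₁.2
  have hh₂ := hlt (Nat.sub_le _ _) h.deg_h₂.2
  refine sympDual_quasiCyclicCode (w := bitPoly w) h.pos (degree_bitPoly h.deg_g₁.1 h.deg_g₁.2)
    (degree_bitPoly h.deg_g₂.1 h.deg_g₂.2) h.le₁ h.le₂ (degree_bitPoly h.deg_h₁.1 h.deg_h₁.2)
    (degree_bitPoly h.deg_h₂.1 h.deg_h₂.2) ⟨bitPoly c₁, ?_⟩ ⟨bitPoly c₂, ?_⟩ ?_ ?_ ?_ ?_
  · rw [← bitPoly_clMul _ _ _ hc₁, h.mul₁]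
  · rw [← bitPoly_clMul _ _ _ hc₂, h.mul₂]
  · have := dvd_bitPoly_sub h.inv
    rwa [bitPoly_clMul _ _ _ hw, bitPoly_xor, bitPoly_clMul _ _ _ hv, bitPoly_one, mul_comm] at this
  · have := dvd_bitPoly_sub h.pal
    rwa [bitPoly_spreadBits _ _ _ hv] at this
  · have := dvd_bitPoly_sub h.orth₁
    rwa [bitPoly_clMul _ _ _ hg₁, bitPoly_spreadBits _ _ _ hh₂, bitPoly_zero, sub_zero,
      mul_comm] at this
  · have := dvd_bitPoly_sub h.orth₂
    rwa [bitPoly_clMul _ _ _ hg₂, bitPoly_spreadBits _ _ _ hh₁, bitPoly_zero, sub_zero,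
      mul_comm] at this

/-! ## Sorting the fields of a long number -/

/-- The `i`th field of `V`, for fields of `w` bits. -/
def field (w V i : ℕ) : ℕ := (V >>> (w * i)) % 2 ^ w

theorem field_lt (w V i : ℕ) : field w V i < 2 ^ w := Nat.mod_lt _ (by positivity)

theorem field_zero (w V : ℕ) : field w V 0 = V % 2 ^ w := by simp [field]

theorem field_succ (w V i : ℕ) : field w V (i + 1) = field w (V / 2 ^ w) i := by
  rw [field, field, ← Nat.shiftRight_eq_div_pow, ← Nat.shiftRight_add]
  congr 2
  ring

@[simp] theorem field_of_zero (w i : ℕ) : field w 0 i = 0 := by simp [field]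

theorem field_xor (w U V i : ℕ) : field w (U ^^^ V) i = field w U i ^^^ field w V i := by
  simp [field, Nat.shiftRight_xor_distrib, Nat.xor_mod_two_pow]

theorem field_and (w U V i : ℕ) : field w (U &&& V) i = field w U i &&& field w V i := by
  simp [field, Nat.shiftRight_and_distrib, Nat.and_mod_two_pow]

theorem field_or (w U V i : ℕ) : field w (U ||| V) i = field w U i ||| field w V i := by
  simp [field, Nat.shiftRight_or_distrib, Nat.or_mod_two_pow]

theorem field_shiftRight (w V s i : ℕ) : field w (V >>> (w * s)) i = field w V (i + s) := by
  rw [field, field, ← Nat.shiftRight_add]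
  congr 2
  ring

theorem field_shiftLeft (w V s i : ℕ) :
    field w (V <<< (w * s)) i = if s ≤ i then field w V (i - s) else 0 := by
  split_ifs with h
  · obtain ⟨j, rfl⟩ := Nat.exists_eq_add_of_le h
    rw [Nat.add_sub_cancel_left, add_comm, ← field_shiftRight, Nat.shiftLeft_shiftRight]
  · refine Nat.eq_of_testBit_eq fun k => ?_
    rw [field, Nat.testBit_mod_two_pow, Nat.testBit_shiftRight, Nat.testBit_shiftLeft,
      Nat.zero_testBit]
    by_cases hk : k < w
    · have : w * i + k < w * s := by
        have : w * (i + 1) ≤ w * s := Nat.mul_le_mul_left w (by omega)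
        rw [mul_add] at this
        omega
      simp [not_le.2 this]
    · simp [hk]

theorem field_mod (w V s i : ℕ) :
    field w (V % 2 ^ (w * s)) i = if i < s then field w V i else 0 := by
  refine Nat.eq_of_testBit_eq fun k => ?_
  rw [field, Nat.testBit_mod_two_pow, Nat.testBit_shiftRight, Nat.testBit_mod_two_pow]
  by_cases hk : k < w
  · split_ifs with h
    · have : w * i + k < w * s := by
        have : w * (i + 1) ≤ w * s := Nat.mul_le_mul_left w (by omega)
        rw [mul_add] at this
        omega
      simp [field, hk, this, Nat.testBit_mod_two_pow, Nat.testBit_shiftRight]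
    · have : w * s ≤ w * i := Nat.mul_le_mul_left w (by omega)
      have : ¬ w * i + k < w * s := by omega
      simp [hk, this]
  · split_ifs <;> simp [hk, field, Nat.testBit_mod_two_pow]

theorem add_shiftLeft_eq_xor {A B s : ℕ} (hA : A < 2 ^ s) : A + B <<< s = A ^^^ (B <<< s) := by
  rw [add_comm, Nat.shiftLeft_add_eq_or_of_lt hA]
  refine Nat.eq_of_testBit_eq fun i => ?_
  simp only [Nat.testBit_or, Nat.testBit_xor, Nat.testBit_shiftLeft]
  by_cases h : i < s
  · simp [not_le.2 h]
  · have : A.testBit i = false :=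
      Nat.testBit_lt_two_pow (hA.trans_le (Nat.pow_le_pow_right two_pos (by omega)))
    simp [this]

theorem field_eq_zero_of_lt {w A s i : ℕ} (hA : A < 2 ^ (w * s)) (h : s ≤ i) :
    field w A i = 0 := by
  rw [← Nat.mod_eq_of_lt hA, field_mod, if_neg (by omega)]

theorem field_append {w A B s : ℕ} (hA : A < 2 ^ (w * s)) (i : ℕ) :
    field w (A + B <<< (w * s)) i = if i < s then field w A i else field w B (i - s) := by
  rw [add_shiftLeft_eq_xor hA, field_xor, field_shiftLeft]
  by_cases h : i < s
  · simp [h, not_le.2 h]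
  · rw [field_eq_zero_of_lt hA (not_lt.1 h), if_pos (not_lt.1 h), if_neg h, Nat.zero_xor]

/-- Addition without carries between fields. -/
theorem field_add {w U V : ℕ} (i : ℕ) (h : ∀ j ≤ i, field w U j + field w V j < 2 ^ w) :
    field w (U + V) i = field w U i + field w V i := by
  induction i generalizing U V with
  | zero =>
    have h0 := h 0 le_rfl
    simp only [field_zero] at h0 ⊢
    rw [Nat.add_mod, Nat.mod_eq_of_lt h0]
  | succ i ih =>
    have h0 := h 0 (Nat.zero_le _)
    simp only [field_zero] at h0
    have hdiv : (U + V) / 2 ^ w = U / 2 ^ w + V / 2 ^ w := by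
      rw [Nat.add_div (by positivity), if_neg (not_le.2 h0), add_zero]
    rw [field_succ, field_succ, field_succ, hdiv]
    refine ih fun j hj => ?_
    have := h (j + 1) (by omega)
    rwa [field_succ, field_succ] at this

/-- Fields 0 and 1 turn into 0 and k < 2^w, so nothing carries; this copies a constant into all
selected fields. -/
theorem field_mul {w c k : ℕ} (hk : k < 2 ^ w) (hc : ∀ i, field w c i ≤ 1) (i : ℕ) :
    field w (c * k) i = field w c i * k := by
  induction i generalizing c with
  | zero =>
    have h0 := hc 0
    rw [field_zero] at h0 ⊢
    rw [field_zero, Nat.mul_mod, Nat.mod_eq_of_lt hk]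
    refine Nat.mod_eq_of_lt (lt_of_le_of_lt ?_ hk)
    calc c % 2 ^ w * k ≤ 1 * k := Nat.mul_le_mul_right k h0
      _ = k := one_mul k
  | succ i ih =>
    have h0 := hc 0
    rw [field_zero] at h0
    have hdiv : c * k / 2 ^ w = c / 2 ^ w * k := by
      conv_lhs => rw [← Nat.mod_add_div c (2 ^ w)]
      rw [add_mul, mul_assoc, Nat.add_mul_div_left _ _ (by positivity : 0 < 2 ^ w)]
      have : c % 2 ^ w * k < 2 ^ w := by
        refine lt_of_le_of_lt ?_ hk
        calc c % 2 ^ w * k ≤ 1 * k := Nat.mul_le_mul_right k h0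
          _ = k := one_mul k
      rw [Nat.div_eq_of_lt this, zero_add]
    rw [field_succ, field_succ, hdiv]
    exact ih fun j => by
      rw [← field_succ]
      exact hc (j + 1)

/-- The number with `2 ^ m` fields equal to `1`. -/
noncomputable def fieldOnes (w m : ℕ) : ℕ :=
  Nat.rec 1 (fun j ih => Nat.add ih (Nat.shiftLeft ih (Nat.mul w (Nat.pow 2 j)))) m

theorem fieldOnes_succ (w m : ℕ) :
    fieldOnes w (m + 1) = fieldOnes w m + fieldOnes w m <<< (w * 2 ^ m) := rfl

theorem append_lt {w A B s t : ℕ} (hA : A < 2 ^ (w * s)) (hB : B < 2 ^ (w * t)) :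
    A + B <<< (w * s) < 2 ^ (w * (s + t)) := by
  rw [Nat.shiftLeft_eq, mul_add, pow_add]
  calc A + B * 2 ^ (w * s) < 2 ^ (w * s) + B * 2 ^ (w * s) := by omega
    _ = 2 ^ (w * s) * (B + 1) := by ring
    _ ≤ _ := Nat.mul_le_mul_left _ hB

theorem fieldOnes_lt {w : ℕ} (hw : 0 < w) (m : ℕ) : fieldOnes w m < 2 ^ (w * 2 ^ m) := by
  induction m with
  | zero =>
    change 1 < _
    exact Nat.one_lt_pow (by simpa using hw.ne') one_lt_two
  | succ m ih =>
    rw [fieldOnes_succ, pow_succ 2 m, mul_two]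
    exact append_lt ih ih

theorem field_fieldOnes {w : ℕ} (hw : 0 < w) (m i : ℕ) :
    field w (fieldOnes w m) i = if i < 2 ^ m then 1 else 0 := by
  induction m generalizing i with
  | zero =>
    change field w 1 i = _
    have h1 : 1 < 2 ^ w := Nat.one_lt_pow hw.ne' one_lt_two
    cases i with
    | zero => simp [field_zero, Nat.mod_eq_of_lt h1]
    | succ i => simp [field_succ, Nat.div_eq_of_lt h1]
  | succ m ih =>
    rw [fieldOnes_succ, field_append (fieldOnes_lt hw m), ih, ih, pow_succ]
    split_ifs <;> omega

/-! ### Exchanges of fields and the sorting network -/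

/-- The mask of the fields `i < 2 ^ m` for which the `j`th bit of `i` is `0`. -/
noncomputable def fieldMask (w m j : ℕ) : ℕ :=
  Nat.rec (fieldOnes w j) (fun r ih => Nat.add ih
    (Nat.shiftLeft ih (Nat.mul w (Nat.pow 2 (Nat.add j (Nat.succ r)))))) (Nat.sub (Nat.sub m j) 1)

/-- A mask that selects, among the first `N` fields, some that can be exchanged with the fields
`s` places above. -/
structure IsSwapMask (w s N c : ℕ) : Prop where
  le_one : ∀ i, field w c i ≤ 1
  of_eq_one : ∀ i, field w c i = 1 → field w c (i + s) = 0 ∧ i + s < N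

/-- Any subset of disjoint exchanges is admissible, so the outcome of the comparisons in a stage
never has to be analysed. -/
theorem IsSwapMask.and {w s N c : ℕ} (h : IsSwapMask w s N c) (d : ℕ) :
    IsSwapMask w s N (c &&& d) := by
  refine ⟨fun i => ?_, fun i hi => ?_⟩
  · rw [field_and]
    exact Nat.and_le_left.trans (h.le_one i)
  · rw [field_and] at hi ⊢
    have h1 : field w c i = 1 := by
      refine le_antisymm (h.le_one i) ?_
      rw [← hi]
      exact Nat.and_le_left
    obtain ⟨h2, h3⟩ := h.of_eq_one i h1
    exact ⟨by rw [h2, Nat.zero_and], h3⟩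

theorem isSwapMask_fieldMask {w m j : ℕ} (hw : 0 < w) (hj : j < m) :
    IsSwapMask w (2 ^ j) (2 ^ m) (fieldMask w m j) := by
  obtain ⟨r, rfl⟩ : ∃ r, m = j + (r + 1) := ⟨m - j - 1, by omega⟩
  have hr : Nat.sub (Nat.sub (j + (r + 1)) j) 1 = r := by
    change j + (r + 1) - j - 1 = r
    omega
  have hp : 0 < 2 ^ j := by positivity
  -- The mask is built by doubling a pattern of 2^j ones followed by 2^j zeros. The size bound
  -- travels with the induction because appending needs it.
  have key : ∀ r : ℕ, (Nat.rec (fieldOnes w j) (fun r ih => Nat.add ih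
      (Nat.shiftLeft ih (Nat.mul w (Nat.pow 2 (Nat.add j (Nat.succ r)))))) r : ℕ) <
        2 ^ (w * 2 ^ (j + (r + 1))) ∧ IsSwapMask w (2 ^ j) (2 ^ (j + (r + 1)))
          (Nat.rec (fieldOnes w j) (fun r ih => Nat.add ih
            (Nat.shiftLeft ih (Nat.mul w (Nat.pow 2 (Nat.add j (Nat.succ r)))))) r) := by
    intro r
    induction r with
    | zero =>
      change fieldOnes w j < _ ∧ IsSwapMask _ _ _ (fieldOnes w j)
      have h2 : 2 ^ (j + (0 + 1)) = 2 ^ j + 2 ^ j := by ring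
      refine ⟨(fieldOnes_lt hw j).trans_le (Nat.pow_le_pow_right two_pos
        (Nat.mul_le_mul_left w (by omega))), fun i => ?_, fun i hi => ?_⟩
      · rw [field_fieldOnes hw]
        split_ifs <;> omega
      · rw [field_fieldOnes hw] at hi ⊢
        have : i < 2 ^ j := by
          by_contra h
          simp [h] at hi
        rw [if_neg (by omega)]
        omega
    | succ r ih =>
      obtain ⟨hlt, hmask⟩ := ih
      set M : ℕ := Nat.rec (fieldOnes w j) (fun r ih => Nat.add ih
        (Nat.shiftLeft ih (Nat.mul w (Nat.pow 2 (Nat.add j (Nat.succ r)))))) r with hM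
      change M + M <<< (w * 2 ^ (j + (r + 1))) < _ ∧
        IsSwapMask _ _ _ (M + M <<< (w * 2 ^ (j + (r + 1))))
      have h2 : 2 ^ (j + (r + 1 + 1)) = 2 ^ (j + (r + 1)) + 2 ^ (j + (r + 1)) := by ring
      have hlt2 : 2 ^ j ≤ 2 ^ (j + (r + 1)) := Nat.pow_le_pow_right two_pos (by omega)
      rw [h2]
      refine ⟨append_lt hlt hlt, fun i => ?_, fun i hi => ?_⟩
      · rw [field_append hlt]
        split_ifs
        · exact hmask.le_one _
        · exact hmask.le_one _
      · rw [field_append hlt] at hi ⊢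
        split_ifs at hi with h
        · obtain ⟨h3, h4⟩ := hmask.of_eq_one i hi
          rw [if_pos h4]
          exact ⟨h3, by omega⟩
        · obtain ⟨h3, h4⟩ := hmask.of_eq_one _ hi
          have e : i + 2 ^ j - 2 ^ (j + (r + 1)) = i - 2 ^ (j + (r + 1)) + 2 ^ j := by omega
          rw [if_neg (by omega), e]
          exact ⟨h3, by omega⟩
  have h := (key r).2
  rw [fieldMask, hr]
  exact h

/-- Exchange the fields that are selected by `c` with those `s` bits above. -/
noncomputable def swapFields (w s V c : ℕ) : ℕ :=
  (fun t => Nat.xor V (Nat.xor t (Nat.shiftLeft t s)))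
    (Nat.land (Nat.xor V (Nat.shiftRight V s)) (Nat.mul c (Nat.sub (Nat.pow 2 w) 1)))

theorem swapFields_eq (w s V c : ℕ) : swapFields w s V c =
    V ^^^ (((V ^^^ (V >>> s)) &&& (c * (2 ^ w - 1))) ^^^
      (((V ^^^ (V >>> s)) &&& (c * (2 ^ w - 1))) <<< s)) := rfl

/-- The multiset of the first `N` fields. -/
def fieldsOf (w N V : ℕ) : Multiset ℕ := (Multiset.range N).map (field w V)

theorem map_range_of_involutive {N : ℕ} (σ : ℕ → ℕ) (h1 : ∀ i < N, σ i < N)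
    (h2 : ∀ i < N, σ (σ i) = i) : (Multiset.range N).map σ = Multiset.range N := by
  have h := Finset.image_val_of_injOn (s := Finset.range N) (f := σ) (fun i hi j hj hij => by
    rw [← h2 i (by simpa using hi), ← h2 j (by simpa using hj), hij])
  have h3 : (Finset.range N).image σ = Finset.range N := by
    ext i
    simp only [Finset.mem_image, Finset.mem_range]
    constructor
    · rintro ⟨j, hj, rfl⟩
      exact h1 j hj
    · exact fun hi => ⟨σ i, h1 i hi, h2 i hi⟩
  rw [h3] at h
  exact h.symm

/-- This is the XOR exchange done in all selected fields at once: t holds the differences of the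
pairs and is added at both ends. On indices it acts as the involution σ, and the mask conditions
make the pairs disjoint and keep them among the first N fields. -/
theorem fieldsOf_swapFields {w s N c : ℕ} (hc : IsSwapMask w s N c) (V : ℕ) :
    fieldsOf w N (swapFields w (w * s) V c) = fieldsOf w N V := by
  set t := (V ^^^ (V >>> (w * s))) &&& (c * (2 ^ w - 1)) with ht
  have hpow : 0 < 2 ^ w := by positivity
  have h01 : ∀ i, field w c i = 0 ∨ field w c i = 1 := fun i => by
    have := hc.le_one i
    omega
  have hfield : ∀ i, field w t i =
      if field w c i = 1 then field w V i ^^^ field w V (i + s) else 0 := by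
    intro i
    rw [ht, field_and, field_xor, field_shiftRight, field_mul (by omega) hc.le_one]
    rcases h01 i with h | h
    · simp [h]
    · rw [h, one_mul, Nat.and_two_pow_sub_one_eq_mod, if_pos rfl]
      exact Nat.mod_eq_of_lt (Nat.xor_lt_two_pow (field_lt _ _ _) (field_lt _ _ _))
  set σ : ℕ → ℕ := fun i => if field w c i = 1 then i + s else
    if s ≤ i ∧ field w c (i - s) = 1 then i - s else i with hσ
  have hs : ∀ i, field w c i = 1 → field w c (i + s) ≠ 1 := fun i hi => by
    rw [(hc.of_eq_one i hi).1]
    exact zero_ne_one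
  have hV : ∀ i, field w (swapFields w (w * s) V c) i = field w V (σ i) := by
    intro i
    rw [swapFields_eq, ← ht, field_xor, field_xor, field_shiftLeft, hfield]
    simp only [hσ, hfield]
    by_cases h1 : field w c i = 1
    · have h2 : (if s ≤ i then (if field w c (i - s) = 1 then
          field w V (i - s) ^^^ field w V (i - s + s) else 0) else 0) = 0 := by
        split_ifs with h3 h4
        · exact absurd (by rwa [Nat.sub_add_cancel h3]) (hs _ h4)
        · rfl
        · rfl
      rw [h2, if_pos h1, if_pos h1, Nat.xor_zero, ← Nat.xor_assoc, Nat.xor_self, Nat.zero_xor]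
    · rw [if_neg h1, if_neg h1, Nat.zero_xor]
      by_cases h3 : s ≤ i
      · by_cases h4 : field w c (i - s) = 1
        · rw [if_pos h3, if_pos h4, if_pos ⟨h3, h4⟩, Nat.sub_add_cancel h3,
            Nat.xor_comm (field w V (i - s)), ← Nat.xor_assoc, Nat.xor_self, Nat.zero_xor]
        · simp [h4]
      · simp [h3]
  have hσlt : ∀ i < N, σ i < N := by
    intro i hi
    simp only [hσ]
    split_ifs with h1 h2
    · exact (hc.of_eq_one i h1).2
    · omega
    · exact hi
  have hσσ : ∀ i < N, σ (σ i) = i := by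
    intro i _
    simp only [hσ]
    by_cases h1 : field w c i = 1
    · simp [h1, hs i h1]
    · by_cases h2 : s ≤ i ∧ field w c (i - s) = 1
      · simp [h1, h2]
      · simp [h1, h2]
  calc fieldsOf w N (swapFields w (w * s) V c)
      = (Multiset.range N).map (field w V ∘ σ) := by
        simp only [fieldsOf]
        exact Multiset.map_congr rfl fun i _ => hV i
    _ = ((Multiset.range N).map σ).map (field w V) := (Multiset.map_map _ _ _).symm
    _ = fieldsOf w N V := by rw [map_range_of_involutive σ hσlt hσσ, fieldsOf]

/-- Compare the fields in the mask `O` with those `s` bits above, and exchange some of them. -/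
noncomputable def compareStage (w s O dir V : ℕ) : ℕ :=
  swapFields w s V (Nat.land O (Nat.xor dir (Nat.shiftRight
    (Nat.sub (Nat.add (Nat.land (Nat.shiftRight V s)
        (Nat.mul O (Nat.sub (Nat.pow 2 (Nat.sub w 1)) 1))) (Nat.shiftLeft O (Nat.sub w 1)))
      (Nat.land V (Nat.mul O (Nat.sub (Nat.pow 2 (Nat.sub w 1)) 1)))) (Nat.sub w 1))))

/-- The comparisons at distances `2 ^ (k - 1), …, 1`. -/
noncomputable def mergePhase (w m dir k : ℕ) : ℕ → ℕ :=
  Nat.rec (fun V => V)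
    (fun j ih V => ih (compareStage w (Nat.mul w (Nat.pow 2 j)) (fieldMask w m j) dir V)) k

/-- Batcher's bitonic sorting network on `2 ^ m` fields. -/
noncomputable def fieldSort (w m : ℕ) (V : ℕ) : ℕ :=
  Nat.rec V (fun k ih => mergePhase w m (fieldMask w m (Nat.succ k)) (Nat.succ k) ih) m

theorem fieldsOf_mergePhase {w m : ℕ} (hw : 0 < w) (dir k : ℕ) (hk : k ≤ m) (V : ℕ) :
    fieldsOf w (2 ^ m) (mergePhase w m dir k V) = fieldsOf w (2 ^ m) V := by
  induction k generalizing V with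
  | zero => rfl
  | succ k ih =>
    change fieldsOf w (2 ^ m)
      (mergePhase w m dir k (compareStage w (w * 2 ^ k) (fieldMask w m k) dir V)) = _
    rw [ih (by omega)]
    exact fieldsOf_swapFields ((isSwapMask_fieldMask hw hk).and _) V

/-- Preservation of the multiset is all that is needed from the network. A network that failed to
sort could only make the later tests return false. -/
theorem fieldsOf_fieldSort {w : ℕ} (hw : 0 < w) (m V : ℕ) :
    fieldsOf w (2 ^ m) (fieldSort w m V) = fieldsOf w (2 ^ m) V := by
  have key : ∀ k ≤ m, fieldsOf w (2 ^ m) (Nat.rec V (fun k ih =>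
      mergePhase w m (fieldMask w m (Nat.succ k)) (Nat.succ k) ih) k) = fieldsOf w (2 ^ m) V := by
    intro k
    induction k with
    | zero => exact fun _ => rfl
    | succ k ih =>
      intro hk
      exact (fieldsOf_mergePhase hw _ _ hk _).trans (ih (by omega))
  exact key m le_rfl

/-! ## Checking lists of numbers by sorting -/

/-- Write the numbers in `l` into consecutive fields. -/
def packKeys (w acc : ℕ) (l : List ℕ) : ℕ := l.foldl (fun a x => a <<< w + x) acc

theorem packKeys_append (w acc : ℕ) (l l' : List ℕ) :
    packKeys w acc (l ++ l') = packKeys w (packKeys w acc l) l' := List.foldl_append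

theorem packKeys_eq (w acc : ℕ) (l : List ℕ) :
    packKeys w acc l = acc <<< (w * l.length) + packKeys w 0 l := by
  induction l generalizing acc with
  | nil => simp [packKeys]
  | cons x l ih =>
    have h1 : ∀ a, packKeys w a (x :: l) = packKeys w (a <<< w + x) l := fun a => rfl
    rw [h1, h1, ih, ih (0 <<< w + x)]
    simp only [Nat.shiftLeft_eq, List.length_cons, mul_add, pow_add, mul_one]
    ring

theorem fieldsOf_packKeys {w : ℕ} (l : List ℕ) (hl : ∀ x ∈ l, x < 2 ^ w) {N : ℕ}
    (hN : l.length ≤ N) :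
    fieldsOf w N (packKeys w 0 l) = (l : Multiset ℕ) + Multiset.replicate (N - l.length) 0 := by
  induction l using List.reverseRecOn generalizing N with
  | nil =>
    simp only [packKeys, List.foldl_nil, fieldsOf, field_of_zero]
    simp
  -- The last key packed is field 0, hence the induction from the end of the list.
  | append_singleton l x ih =>
    have hx : x < 2 ^ w := hl x (by simp)
    obtain ⟨N, rfl⟩ : ∃ M, N = M + 1 := ⟨N - 1, by simp at hN; omega⟩
    have hN' : l.length ≤ N := by simpa using hN
    have ih' := ih (fun y hy => hl y (by simp [hy])) hN'
    rw [packKeys_append]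
    change fieldsOf w (N + 1) (packKeys w 0 l <<< w + x) = _
    have h0 : field w (packKeys w 0 l <<< w + x) 0 = x := by
      rw [field_zero, Nat.shiftLeft_eq, Nat.mul_add_mod_self_right, Nat.mod_eq_of_lt hx]
    have hs : ∀ i, field w (packKeys w 0 l <<< w + x) (i + 1) = field w (packKeys w 0 l) i := by
      intro i
      rw [field_succ, Nat.shiftLeft_eq, add_comm, Nat.add_mul_div_right _ _ (by positivity),
        Nat.div_eq_of_lt hx, zero_add]
    have hrange : Multiset.range (N + 1) = 0 ::ₘ (Multiset.range N).map (· + 1) := by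
      simp only [Multiset.range, List.range_succ_eq_map]
      rfl
    rw [fieldsOf, hrange, Multiset.map_cons, h0, Multiset.map_map]
    have : (Multiset.range N).map (field w (packKeys w 0 l <<< w + x) ∘ (· + 1)) =
        fieldsOf w N (packKeys w 0 l) := Multiset.map_congr rfl fun i _ => hs i
    rw [this, ih', ← Multiset.cons_add]
    have hlen : N + 1 - (l ++ [x]).length = N - l.length := by simp
    rw [hlen]
    congr 1
    rw [← Multiset.coe_add, add_comm, Multiset.coe_singleton, Multiset.singleton_add]

/-! ### Order tests on all fields at once -/

theorem field_lt_of_and_eq_zero {w A O i : ℕ} (hw : 0 < w) (hO : ∀ i, field w O i ≤ 1)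
    (h : A &&& (O <<< (w - 1)) = 0) (hi : field w O i = 1) : field w A i < 2 ^ (w - 1) := by
  have h1 : field w (A &&& (O <<< (w - 1))) i = 0 := by rw [h, field_of_zero]
  rw [field_and, Nat.shiftLeft_eq, field_mul (Nat.pow_lt_pow_right one_lt_two (by omega)) hO, hi,
    one_mul] at h1
  by_contra hcon
  have h2 : (field w A i).testBit (w - 1) = true :=
    Nat.testBit_of_two_pow_le_and_two_pow_add_one_gt (not_lt.1 hcon)
      (by rw [Nat.sub_add_cancel hw]; exact field_lt _ _ _)
  have h3 : (field w A i &&& 2 ^ (w - 1)).testBit (w - 1) = true := by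
    rw [Nat.testBit_and, h2, Nat.testBit_two_pow_self]
    rfl
  rw [h1] at h3
  simp at h3

/-- Are the top `M` fields of `V` strictly increasing and those below zero? -/
noncomputable def strictCheck (w m M V : ℕ) : Bool :=
  (fun V' => (fun X Y O => Bool.rec false (Bool.rec false
      (Nat.beq 0 (Nat.land (Nat.lor Y (Nat.sub X (Nat.add Y O))) (Nat.shiftLeft O (Nat.sub w 1))))
      (Nat.ble (Nat.add Y O) X))
      (Nat.beq (Nat.shiftLeft V' (Nat.mul w (Nat.sub (Nat.pow 2 m) M))) V))
    (Nat.shiftRight V' w) (Nat.mod V' (Nat.pow 2 (Nat.mul w (Nat.sub M 1))))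
    (Nat.mod (fieldOnes w m) (Nat.pow 2 (Nat.mul w (Nat.sub M 1)))))
  (Nat.shiftRight V (Nat.mul w (Nat.sub (Nat.pow 2 m) M)))

theorem and_of_boolRec {a b : Bool} (h : (Bool.rec false a b : Bool) = true) :
    a = true ∧ b = true := by
  cases b
  · exact absurd (show false = true from h) Bool.false_ne_true
  · exact ⟨h, rfl⟩

theorem field_maskedOnes {w : ℕ} (hw : 0 < w) (m s i : ℕ) :
    field w (fieldOnes w m % 2 ^ (w * s)) i = if i < s ∧ i < 2 ^ m then 1 else 0 := by
  rw [field_mod, field_fieldOnes hw]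
  split_ifs <;> first | rfl | omega

/-- X and Y are the list without its first and without its last field. The tested top bits of Y and
of X - (Y + O) are zero, so Y + O and (Y + O) + (X - (Y + O)) involve no carries, and each field of
X is the field of Y plus 1 plus something nonnegative. -/
theorem field_lt_field_of_strictCheck {w m M V : ℕ} (hw : 0 < w) (hM : M ≤ 2 ^ m)
    (h : strictCheck w m M V = true) {i : ℕ} (hi : i + 1 < M) :
    field w (V >>> (w * (2 ^ m - M))) i < field w (V >>> (w * (2 ^ m - M))) (i + 1) := by
  set V' := V >>> (w * (2 ^ m - M)) with hV'
  set O := fieldOnes w m % 2 ^ (w * (M - 1)) with hO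
  set Y := V' % 2 ^ (w * (M - 1)) with hY
  set X := V' >>> w with hX
  obtain ⟨h1, -⟩ := and_of_boolRec h
  obtain ⟨h2, h3⟩ := and_of_boolRec h1
  have h4 : Y + O ≤ X := Nat.le_of_ble_eq_true h3
  have h5 : (Y ||| (X - (Y + O))) &&& (O <<< (w - 1)) = 0 := (Nat.eq_of_beq_eq_true h2).symm
  have hO1 : ∀ i, field w O i ≤ 1 := fun i => by
    rw [hO, field_maskedOnes hw]
    split_ifs <;> omega
  have hOi : ∀ j, j ≤ i → field w O j = 1 := fun j hj => by
    rw [hO, field_maskedOnes hw, if_pos (by omega)]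
  have hb : ∀ j ≤ i, field w Y j < 2 ^ (w - 1) ∧ field w (X - (Y + O)) j < 2 ^ (w - 1) := by
    intro j hj
    have := field_lt_of_and_eq_zero hw hO1 h5 (hOi j hj)
    rw [field_or] at this
    exact ⟨Nat.left_le_or.trans_lt this, Nat.right_le_or.trans_lt this⟩
  have hpow : 2 ^ w = 2 ^ (w - 1) + 2 ^ (w - 1) := by
    rw [← two_mul, ← pow_succ', Nat.sub_add_cancel hw]
  have hYO : ∀ j ≤ i, field w (Y + O) j = field w Y j + 1 := by
    intro j hj
    rw [field_add, hOi j hj]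
    intro k hk
    rw [hOi k (hk.trans hj)]
    have := (hb k (hk.trans hj)).1
    omega
  have hXi : field w X i = field w Y i + 1 + field w (X - (Y + O)) i := by
    conv_lhs => rw [← Nat.add_sub_of_le h4]
    rw [field_add, hYO i le_rfl]
    intro k hk
    rw [hYO k hk]
    have := hb k hk
    omega
  have e1 : field w X i = field w V' (i + 1) := by
    have := field_shiftRight w V' 1 i
    rwa [mul_one] at this
  have e2 : field w Y i = field w V' i := by
    rw [hY, field_mod, if_pos (by omega)]
  rw [← e1, ← e2, hXi]
  omega

/-- Shifting the top part back shows that the remaining 2^m - M fields are zeros. These cancel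
against the padding, so the top fields are the keys as a multiset, and strictly increasing fields
are distinct. -/
theorem nodup_of_strictCheck {w m : ℕ} (hw : 0 < w) {l : List ℕ} (hl : ∀ x ∈ l, x < 2 ^ w)
    (hm : l.length ≤ 2 ^ m)
    (h : strictCheck w m l.length (fieldSort w m (packKeys w 0 l)) = true) : l.Nodup := by
  set V := fieldSort w m (packKeys w 0 l) with hV
  set M := l.length with hM
  have hlt : ∀ {i}, i + 1 < M → _ := fun {i} hi => field_lt_field_of_strictCheck hw hm h hi
  set V' := V >>> (w * (2 ^ m - M)) with hV'
  have hshift : V' <<< (w * (2 ^ m - M)) = V := Nat.eq_of_beq_eq_true (and_of_boolRec h).2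
  have h1 := fieldsOf_fieldSort hw m (packKeys w 0 l)
  rw [← hV, fieldsOf_packKeys l hl hm] at h1
  have hrange : Multiset.range (2 ^ m) =
      (Multiset.range M).map (2 ^ m - M + ·) + Multiset.range (2 ^ m - M) := by
    have : Multiset.range (2 ^ m) = Multiset.range ((2 ^ m - M) + M) := by
      rw [Nat.sub_add_cancel hm]
    rw [this, Multiset.range_add, add_comm]
  have h2 : fieldsOf w (2 ^ m) V = fieldsOf w M V' + Multiset.replicate (2 ^ m - M) 0 := by
    rw [fieldsOf, hrange, Multiset.map_add, Multiset.map_map]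
    congr 1
    · refine Multiset.map_congr rfl fun i _ => ?_
      rw [hV', field_shiftRight, Function.comp, add_comm]
    · have : ∀ i ∈ Multiset.range (2 ^ m - M), field w V i = 0 := by
        intro i hi
        rw [← hshift, field_shiftLeft, if_neg (not_le.2 (Multiset.mem_range.1 hi))]
      rw [Multiset.map_congr rfl this, Multiset.map_const', Multiset.card_range]
  rw [h2] at h1
  have h3 : fieldsOf w M V' = (l : Multiset ℕ) := add_right_cancel h1
  rw [← Multiset.coe_nodup, ← h3, fieldsOf]
  have hmono : ∀ j < M, ∀ i < j, field w V' i < field w V' j := by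
    intro j
    induction j with
    | zero => exact fun _ i hi => absurd hi (Nat.not_lt_zero i)
    | succ j ih =>
      intro hj i hi
      rcases Nat.lt_succ_iff_lt_or_eq.1 hi with h4 | rfl
      · exact (ih (by omega) i h4).trans (hlt hj)
      · exact hlt hj
  refine Multiset.Nodup.map_on (fun i hi j hj hij => ?_) (Multiset.nodup_range M)
  rw [Multiset.mem_range] at hi hj
  rcases lt_trichotomy i j with h4 | h4 | h4
  · exact absurd hij (hmono j hj i h4).ne
  · exact h4
  · exact absurd hij (hmono i hi j h4).ne'

/-- Do the `2 ^ m` fields of `V` increase, in steps different from `1`? -/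
noncomputable def gapCheck (w m V : ℕ) : Bool :=
  (fun X Y O => (fun Z T => Bool.rec false (Bool.rec false
      (Nat.beq (Nat.land (Nat.add (Nat.xor Z O) (Nat.mul O (Nat.sub (Nat.pow 2 (Nat.sub w 1)) 1))) T)
        T)
      (Nat.ble Y X))
      (Nat.beq 0 (Nat.land (Nat.lor Y Z) T)))
    (Nat.sub X Y) (Nat.shiftLeft O (Nat.sub w 1)))
  (Nat.shiftRight V w) (Nat.mod V (Nat.pow 2 (Nat.mul w (Nat.sub (Nat.pow 2 m) 1))))
  (Nat.mod (fieldOnes w m) (Nat.pow 2 (Nat.mul w (Nat.sub (Nat.pow 2 m) 1))))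

theorem field_step_of_gapCheck {w m V : ℕ} (hw : 1 < w) (h : gapCheck w m V = true) {i : ℕ}
    (hi : i + 1 < 2 ^ m) :
    field w V i ≤ field w V (i + 1) ∧ field w V (i + 1) ≠ field w V i + 1 := by
  have hw0 : 0 < w := by omega
  set O := fieldOnes w m % 2 ^ (w * (2 ^ m - 1)) with hO
  set Y := V % 2 ^ (w * (2 ^ m - 1)) with hY
  set X := V >>> w with hX
  obtain ⟨h1, h2⟩ := and_of_boolRec h
  obtain ⟨h3, h4⟩ := and_of_boolRec h1
  have hYX : Y ≤ X := Nat.le_of_ble_eq_true h4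
  have h5 : (Y ||| (X - Y)) &&& (O <<< (w - 1)) = 0 := (Nat.eq_of_beq_eq_true h2).symm
  have h6 : (((X - Y) ^^^ O) + O * (2 ^ (w - 1) - 1)) &&& (O <<< (w - 1)) = O <<< (w - 1) :=
    Nat.eq_of_beq_eq_true h3
  have hO1 : ∀ i, field w O i ≤ 1 := fun i => by
    rw [hO, field_maskedOnes hw0]
    split_ifs <;> omega
  have hOi : ∀ j, j ≤ i → field w O j = 1 := fun j hj => by
    rw [hO, field_maskedOnes hw0, if_pos (by omega)]
  have hb : ∀ j ≤ i, field w Y j < 2 ^ (w - 1) ∧ field w (X - Y) j < 2 ^ (w - 1) := by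
    intro j hj
    have := field_lt_of_and_eq_zero hw0 hO1 h5 (hOi j hj)
    rw [field_or] at this
    exact ⟨Nat.left_le_or.trans_lt this, Nat.right_le_or.trans_lt this⟩
  have hpow : 2 ^ w = 2 ^ (w - 1) + 2 ^ (w - 1) := by
    rw [← two_mul, ← pow_succ', Nat.sub_add_cancel hw0]
  have hpow1 : 1 < 2 ^ (w - 1) := Nat.one_lt_pow (by omega) one_lt_two
  have hXi : field w X i = field w Y i + field w (X - Y) i := by
    conv_lhs => rw [← Nat.add_sub_of_le hYX]
    rw [field_add]
    intro k hk
    have := hb k hk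
    omega
  have hmul : ∀ j ≤ i, field w (O * (2 ^ (w - 1) - 1)) j = 2 ^ (w - 1) - 1 := by
    intro j hj
    rw [field_mul (by omega) hO1, hOi j hj, one_mul]
  have hxor : ∀ j ≤ i, field w ((X - Y) ^^^ O) j < 2 ^ (w - 1) := by
    intro j hj
    rw [field_xor, hOi j hj]
    exact Nat.xor_lt_two_pow (hb j hj).2 hpow1
  -- XOR with 1 sends exactly the difference 1 to 0, and adding 2^(w-1) - 1 produces the top bit
  -- exactly when the result is nonzero.
  have hne : field w (X - Y) i ≠ 1 := by
    intro hone
    have h7 := congrArg (fun A => field w A i) h6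
    simp only [field_and, Nat.shiftLeft_eq] at h7
    rw [field_mul (by omega) hO1, hOi i le_rfl, one_mul, field_add, hmul i le_rfl, field_xor,
      hOi i le_rfl, hone, Nat.xor_self, zero_add] at h7
    · have h8 : (2 ^ (w - 1) - 1) &&& 2 ^ (w - 1) ≤ 2 ^ (w - 1) - 1 := Nat.and_le_left
      omega
    · intro k hk
      have h8 := hxor k hk
      rw [hmul k hk]
      omega
  have e1 : field w X i = field w V (i + 1) := by
    have := field_shiftRight w V 1 i
    rwa [mul_one] at this
  have e2 : field w Y i = field w V i := by
    rw [hY, field_mod, if_pos (by omega)]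
  rw [← e1, ← e2, hXi]
  omega

/-- Going up from a field equal to a, the values stay at a or jump to at least a + 2; going up from
a + 1 they never return to a. Hence a and a + 1 cannot both occur, repeated keys being harmless. -/
theorem add_one_notMem_of_gapCheck {w m : ℕ} (hw : 1 < w) {l : List ℕ}
    (hl : ∀ x ∈ l, x < 2 ^ w) (hm : l.length ≤ 2 ^ m)
    (h : gapCheck w m (fieldSort w m (packKeys w 0 l)) = true) {a : ℕ} (ha : a ∈ l) :
    a + 1 ∉ l := by
  intro ha'
  set V := fieldSort w m (packKeys w 0 l) with hV
  have h1 := fieldsOf_fieldSort (zero_lt_one.trans hw) m (packKeys w 0 l)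
  rw [← hV, fieldsOf_packKeys l hl hm] at h1
  have hmem : ∀ {x}, x ∈ l → ∃ i < 2 ^ m, field w V i = x := by
    intro x hx
    have : x ∈ fieldsOf w (2 ^ m) V := by
      rw [h1]
      exact Multiset.mem_add.2 (Or.inl hx)
    simpa [fieldsOf] using this
  obtain ⟨i, hi, hia⟩ := hmem ha
  obtain ⟨j, hj, hja⟩ := hmem ha'
  have hstep : ∀ {k}, k + 1 < 2 ^ m → _ := fun {k} hk => field_step_of_gapCheck hw h hk
  have hup : ∀ k, i + k < 2 ^ m →
      field w V (i + k) = a ∨ a + 2 ≤ field w V (i + k) := by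
    intro k
    induction k with
    | zero => exact fun _ => Or.inl hia
    | succ k ih =>
      intro hk
      have := hstep (k := i + k) (by omega)
      have := ih (by omega)
      rw [← add_assoc]
      omega
  have hdown : ∀ k, j + k < 2 ^ m → a + 1 ≤ field w V (j + k) := by
    intro k
    induction k with
    | zero => exact fun _ => hja.ge
    | succ k ih =>
      intro hk
      have := hstep (k := j + k) (by omega)
      have := ih (by omega)
      rw [← add_assoc]
      omega
  rcases Nat.le_total i j with hij | hij
  · obtain ⟨k, rfl⟩ := Nat.exists_eq_add_of_le hij
    have := hup k hj
    omega
  · obtain ⟨k, rfl⟩ := Nat.exists_eq_add_of_le hij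
    have := hdown k hi
    omega

/-! ## Rotations of bit strings -/

/-- Rotation of a string of `N` bits by `K` places. -/
noncomputable def bitRot (K N x : ℕ) : ℕ :=
  Nat.xor (Nat.shiftLeft (Nat.mod x (Nat.pow 2 (Nat.sub N K))) K) (Nat.shiftRight x (Nat.sub N K))

theorem bitRot_eq (K N x : ℕ) :
    bitRot K N x = ((x % 2 ^ (N - K)) <<< K) ^^^ (x >>> (N - K)) := rfl

section

variable {K N : ℕ}

theorem bitRot_xor (x y : ℕ) : bitRot K N (x ^^^ y) = bitRot K N x ^^^ bitRot K N y := by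
  simp only [bitRot_eq, Nat.xor_mod_two_pow, Nat.shiftLeft_xor_distrib,
    Nat.shiftRight_xor_distrib]
  ac_rfl

@[simp] theorem bitRot_zero : bitRot K N 0 = 0 := by simp [bitRot_eq]

theorem bitRot_eq_add (hK : K ≤ N) {x : ℕ} (hx : x < 2 ^ N) :
    bitRot K N x = x / 2 ^ (N - K) + x % 2 ^ (N - K) * 2 ^ K := by
  rw [bitRot_eq, Nat.xor_comm, ← add_shiftLeft_eq_xor, Nat.shiftLeft_eq, Nat.shiftRight_eq_div_pow]
  rw [Nat.shiftRight_eq_div_pow, Nat.div_lt_iff_lt_mul (by positivity), ← pow_add]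
  rwa [Nat.add_sub_cancel' hK]

theorem bitRot_lt (hK : K ≤ N) {x : ℕ} (hx : x < 2 ^ N) : bitRot K N x < 2 ^ N := by
  rw [bitRot_eq_add hK hx]
  have h1 : x / 2 ^ (N - K) < 2 ^ K := by
    rw [Nat.div_lt_iff_lt_mul (by positivity), ← pow_add]
    rwa [Nat.add_sub_cancel' hK]
  have h2 : x % 2 ^ (N - K) + 1 ≤ 2 ^ (N - K) := Nat.mod_lt _ (by positivity)
  have h3 : 2 ^ N = 2 ^ (N - K) * 2 ^ K := by rw [← pow_add, Nat.sub_add_cancel hK]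
  have h4 := Nat.mul_le_mul_right (2 ^ K) h2
  rw [h3]
  linarith

theorem bitRot_ne_zero (hK : K ≤ N) {x : ℕ} (hx : x < 2 ^ N) (h0 : x ≠ 0) :
    bitRot K N x ≠ 0 := by
  rw [bitRot_eq_add hK hx]
  intro h
  obtain ⟨h1, h2⟩ := Nat.add_eq_zero_iff.1 h
  have h3 : x % 2 ^ (N - K) = 0 := (mul_eq_zero.1 h2).resolve_right (by positivity)
  have h4 := Nat.mod_add_div x (2 ^ (N - K))
  rw [h1, h3] at h4
  simp at h4
  exact h0 h4.symm

/-- The bits that leave at the top have weight 2^N ≡ 1. Rotation thus becomes multiplication by 2^K,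
which makes periodicity and invariance questions of divisibility. -/
theorem bitRot_modEq (hK : K ≤ N) {x : ℕ} (hx : x < 2 ^ N) :
    bitRot K N x ≡ 2 ^ K * x [MOD 2 ^ N - 1] := by
  rw [bitRot_eq_add hK hx]
  have h3 : 2 ^ N = 2 ^ (N - K) * 2 ^ K := by rw [← pow_add, Nat.sub_add_cancel hK]
  have h4 := Nat.mod_add_div x (2 ^ (N - K))
  have h5 : 2 ^ N ≡ 1 [MOD 2 ^ N - 1] :=
    ((Nat.modEq_iff_dvd' Nat.one_le_two_pow).2 dvd_rfl).symm
  have h6 : 2 ^ K * x = 2 ^ N * (x / 2 ^ (N - K)) + x % 2 ^ (N - K) * 2 ^ K := by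
    conv_lhs => rw [← h4]
    rw [h3]
    ring
  rw [h6]
  refine Nat.ModEq.add_right _ ?_
  simpa using (h5.mul_right (x / 2 ^ (N - K))).symm

theorem iterate_bitRot_xor (i x y : ℕ) :
    (bitRot K N)^[i] (x ^^^ y) = (bitRot K N)^[i] x ^^^ (bitRot K N)^[i] y := by
  induction i generalizing x y with
  | zero => rfl
  | succ i ih => rw [Function.iterate_succ_apply, bitRot_xor, ih]; rfl

@[simp] theorem iterate_bitRot_zero (i : ℕ) : (bitRot K N)^[i] 0 = 0 :=
  Function.iterate_fixed bitRot_zero i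

theorem iterate_bitRot_lt (hK : K ≤ N) {x : ℕ} (hx : x < 2 ^ N) (i : ℕ) :
    (bitRot K N)^[i] x < 2 ^ N := by
  induction i with
  | zero => exact hx
  | succ i ih =>
    rw [Function.iterate_succ_apply']
    exact bitRot_lt hK ih

theorem iterate_bitRot_ne_zero (hK : K ≤ N) {x : ℕ} (hx : x < 2 ^ N) (h0 : x ≠ 0) (i : ℕ) :
    (bitRot K N)^[i] x ≠ 0 := by
  induction i with
  | zero => exact h0
  | succ i ih =>
    rw [Function.iterate_succ_apply']
    exact bitRot_ne_zero hK (iterate_bitRot_lt hK hx i) ih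

theorem iterate_bitRot_modEq (hK : K ≤ N) {x : ℕ} (hx : x < 2 ^ N) (i : ℕ) :
    (bitRot K N)^[i] x ≡ 2 ^ (K * i) * x [MOD 2 ^ N - 1] := by
  induction i with
  | zero => simp [Nat.ModEq.refl]
  | succ i ih =>
    rw [Function.iterate_succ_apply']
    refine (bitRot_modEq hK (iterate_bitRot_lt hK hx i)).trans ?_
    have e : 2 ^ (K * (i + 1)) * x = 2 ^ K * (2 ^ (K * i) * x) := by
      rw [mul_add, pow_add]
      ring
    rw [e]
    exact ih.mul_left _

theorem iterate_bitRot_period {n : ℕ} (hn : 0 < n) (hN : N = K * n) {x : ℕ} (hx : x < 2 ^ N) :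
    (bitRot K N)^[n] x = x := by
  have hK : K ≤ N := hN ▸ Nat.le_mul_of_pos_right K hn
  rcases eq_or_ne x 0 with rfl | h0
  · simp
  have h1 := iterate_bitRot_modEq hK hx n
  rw [← hN] at h1
  have h5 : 2 ^ N ≡ 1 [MOD 2 ^ N - 1] :=
    ((Nat.modEq_iff_dvd' Nat.one_le_two_pow).2 dvd_rfl).symm
  have h2 : (bitRot K N)^[n] x ≡ x [MOD 2 ^ N - 1] := by
    simpa using h1.trans (h5.mul_right x)
  have h3 := iterate_bitRot_lt hK hx n
  have h4 := iterate_bitRot_ne_zero hK hx h0 n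
  set y := (bitRot K N)^[n] x
  -- The only residue with two representatives below 2^N is 0, given by 0 and 2^N - 1; this is why
  -- zero is kept apart.
  have key : ∀ a b : ℕ, a ≤ b → a ≡ b [MOD 2 ^ N - 1] → a ≠ 0 → b < 2 ^ N → a = b := by
    intro a b hab h ha hb
    have hdvd := (Nat.modEq_iff_dvd' hab).1 h
    by_contra hne
    have := Nat.le_of_dvd (by omega) hdvd
    omega
  rcases le_total x y with h | h
  · exact (key x y h h2.symm h0 h3).symm
  · exact key y x h h2 h4 hx

/-- A hash of a string of `N` bits that is invariant under rotations by `K` places. It vanishes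
for multiples of the numbers in `Ds`. -/
noncomputable def rotHash (K : ℕ) (Ds : List ℕ) (x : ℕ) : ℕ :=
  List.rec (Nat.mod x (Nat.sub (Nat.pow 2 K) 1))
    (fun D _ ih => Bool.rec ih 0 (Nat.beq (Nat.mod x D) 0)) Ds

theorem rotHash_nil (x : ℕ) : rotHash K [] x = x % (2 ^ K - 1) := rfl

theorem rotHash_cons (D : ℕ) (Ds : List ℕ) (x : ℕ) :
    rotHash K (D :: Ds) x = if D ∣ x then 0 else rotHash K Ds x := by
  have h : rotHash K (D :: Ds) x = Bool.rec (rotHash K Ds x) 0 (Nat.beq (x % D) 0) := rfl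
  rw [h]
  by_cases hD : D ∣ x
  · rw [if_pos hD, Nat.mod_eq_zero_of_dvd hD]
    rfl
  · have : Nat.beq (x % D) 0 = false := by
      rw [← Bool.not_eq_true, Nat.beq_eq]
      exact fun h => hD (Nat.dvd_of_mod_eq_zero h)
    rw [if_neg hD, this]

theorem rotHash_lt (hK : 0 < K) (Ds : List ℕ) (x : ℕ) : rotHash K Ds x < 2 ^ K := by
  have h1 : 1 < 2 ^ K := Nat.one_lt_pow hK.ne' one_lt_two
  induction Ds with
  | nil =>
    rw [rotHash_nil]
    have := Nat.mod_lt x (show 0 < 2 ^ K - 1 by omega)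
    omega
  | cons D Ds ih =>
    rw [rotHash_cons]
    split_ifs <;> omega

theorem rotHash_zero (Ds : List ℕ) : rotHash K Ds 0 = 0 := by
  cases Ds <;> simp [rotHash_nil, rotHash_cons]

theorem rotHash_eq_zero {D : ℕ} {Ds : List ℕ} (hD : D ∈ Ds) {x : ℕ} (h : D ∣ x) :
    rotHash K Ds x = 0 := by
  induction Ds with
  | nil => simp at hD
  | cons E Ds ih =>
    rw [rotHash_cons]
    rcases List.mem_cons.1 hD with rfl | hD
    · rw [if_pos h]
    · split_ifs
      · rfl
      · exact ih hD

/-- Multiplication by 2^K is trivial modulo 2^K - 1, which divides 2^N - 1. Each D divides 2^N - 1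
and is therefore odd, so divisibility by D is unaffected too. -/
theorem rotHash_bitRot {n : ℕ} (hn : 0 < n) (hK : 0 < K) (hN : N = K * n) {Ds : List ℕ}
    (hDs : ∀ D ∈ Ds, D ∣ 2 ^ N - 1) {x : ℕ} (hx : x < 2 ^ N) :
    rotHash K Ds (bitRot K N x) = rotHash K Ds x := by
  have hKN : K ≤ N := hN ▸ Nat.le_mul_of_pos_right K hn
  have hmod := bitRot_modEq hKN hx
  induction Ds with
  | nil =>
    rw [rotHash_nil, rotHash_nil]
    have h1 : 2 ^ K - 1 ∣ 2 ^ N - 1 := by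
      rw [hN, pow_mul]
      exact Nat.sub_one_dvd_pow_sub_one _ _
    have h2 : 2 ^ K ≡ 1 [MOD 2 ^ K - 1] :=
      ((Nat.modEq_iff_dvd' Nat.one_le_two_pow).2 dvd_rfl).symm
    have h3 := (hmod.of_dvd h1).trans (h2.mul_right x)
    rw [one_mul] at h3
    exact h3
  | cons D Ds ih =>
    have hD := hDs D (by simp)
    have hcop : Nat.Coprime D (2 ^ K) := by
      refine Nat.Coprime.pow_right _ (Nat.Coprime.coprime_dvd_left hD ?_)
      have hN0 : N ≠ 0 := by omega
      rw [Nat.coprime_two_right]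
      exact Nat.Even.sub_odd Nat.one_le_two_pow ((Nat.even_pow.2 ⟨even_two, hN0⟩)) odd_one
    have hiff : D ∣ bitRot K N x ↔ D ∣ x := by
      rw [(hmod.of_dvd hD).dvd_iff dvd_rfl, hcop.dvd_mul_left]
    rw [rotHash_cons, rotHash_cons, ih fun E hE => hDs E (by simp [hE])]
    simp only [hiff]

theorem rotHash_iterate_bitRot {n : ℕ} (hn : 0 < n) (hK : 0 < K) (hN : N = K * n) {Ds : List ℕ}
    (hDs : ∀ D ∈ Ds, D ∣ 2 ^ N - 1) {x : ℕ} (hx : x < 2 ^ N) (i : ℕ) :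
    rotHash K Ds ((bitRot K N)^[i] x) = rotHash K Ds x := by
  have hKN : K ≤ N := hN ▸ Nat.le_mul_of_pos_right K hn
  induction i with
  | zero => rfl
  | succ i ih =>
    rw [Function.iterate_succ_apply', rotHash_bitRot hn hK hN hDs (iterate_bitRot_lt hKN hx i), ih]

end

/-! ## Syndromes of errors of small weight -/

/-- The syndrome of the error with the letter `c.2` at position `c.1` for each `c` in `l`, if
`T t` is the syndrome of the letter `t` at position `0`. -/
noncomputable def syndrome (K N : ℕ) (T : ℕ → ℕ) (l : List (ℕ × ℕ)) : ℕ :=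
  l.foldr (fun c acc => (bitRot K N)^[c.1] (T c.2) ^^^ acc) 0

@[simp] theorem syndrome_nil (K N : ℕ) (T : ℕ → ℕ) : syndrome K N T [] = 0 := rfl

@[simp] theorem syndrome_cons (K N : ℕ) (T : ℕ → ℕ) (c : ℕ × ℕ) (l : List (ℕ × ℕ)) :
    syndrome K N T (c :: l) = (bitRot K N)^[c.1] (T c.2) ^^^ syndrome K N T l := rfl

/-- Errors of weight `1`, up to rotation. -/
def singleErrors : List (List (ℕ × ℕ)) := [1, 2, 3].map fun t => [(0, t)]

/-- Errors of weight `2`, up to rotation, in length `n`. -/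
def pairErrors (n : ℕ) : List (List (ℕ × ℕ)) :=
  [1, 2, 3].flatMap fun t => [1, 2, 3].flatMap fun u =>
    (List.range (n / 2)).map fun i => [(0, t), (i + 1, u)]

/-- Errors of weight `3` with gaps `i + 1`, `i + 1 + j` where `i < m`, `j < c - 3 i`. -/
def tripleErrors (m c : ℕ) : List (List (ℕ × ℕ)) :=
  [1, 2, 3].flatMap fun t => [1, 2, 3].flatMap fun u => [1, 2, 3].flatMap fun v =>
    (List.range m).flatMap fun i => (List.range (c - 3 * i)).map fun j =>
      [(0, t), (i + 1, u), (2 * (i + 1) + j, v)]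

/-- Errors of weight `4` with the letter `t` at position `0`, and last position at most
`m + 2`. -/
def quadErrors (m t : ℕ) : List (List (ℕ × ℕ)) :=
  [1, 2, 3].flatMap fun u => [1, 2, 3].flatMap fun v => [1, 2, 3].flatMap fun s =>
    (List.range m).flatMap fun i => (List.range (m - i)).flatMap fun j =>
      (List.range (m - i - j)).map fun k => [(0, t), (i + 1, u), (i + j + 2, v), (i + j + k + 3, s)]

/-! ### Packing the keys of all representatives -/

/-- Append the keys `f (r + x)`, with `x` rotated `cnt` times. -/
noncomputable def rowKeys (K N w : ℕ) (f : ℕ → ℕ) (r cnt : ℕ) : ℕ → ℕ → ℕ :=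
  Nat.rec (fun _ acc => acc) (fun _ ih x acc =>
    ih (bitRot K N x) (Nat.add (Nat.shiftLeft acc w) (f (Nat.xor r x)))) cnt

theorem rowKeys_eq (K N w : ℕ) (f : ℕ → ℕ) (r cnt x acc : ℕ) :
    rowKeys K N w f r cnt x acc =
      packKeys w acc ((List.range cnt).map fun i => f (r ^^^ (bitRot K N)^[i] x)) := by
  induction cnt generalizing x acc with
  | zero => rfl
  | succ cnt ih =>
    change rowKeys K N w f r cnt (bitRot K N x) (acc <<< w + f (r ^^^ x)) = _
    rw [ih, List.range_succ_eq_map, List.map_cons, List.map_map]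
    rfl

/-- Append the rows for `m` values of the middle position. -/
noncomputable def blockKeys (K N w : ℕ) (f adv : ℕ → ℕ) (d t m : ℕ) : ℕ → ℕ → ℕ → ℕ → ℕ :=
  Nat.rec (fun _ _ _ acc => acc) (fun _ ih r x cnt acc =>
    ih (bitRot K N r) (adv x) (Nat.sub cnt d) (Nat.add (Nat.shiftLeft acc (Nat.mul w cnt))
      (rowKeys K N w f (Nat.xor t r) cnt x 0))) m

theorem blockKeys_eq (K N w : ℕ) (f adv : ℕ → ℕ) (d t m r x cnt acc : ℕ) :
    blockKeys K N w f adv d t m r x cnt acc =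
      packKeys w acc ((List.range m).flatMap fun i => (List.range (cnt - d * i)).map fun j =>
        f (t ^^^ (bitRot K N)^[i] r ^^^ (bitRot K N)^[j] (adv^[i] x))) := by
  induction m generalizing r x cnt acc with
  | zero => rfl
  | succ m ih =>
    change blockKeys K N w f adv d t m (bitRot K N r) (adv x) (cnt - d)
      (acc <<< (w * cnt) + rowKeys K N w f (t ^^^ r) cnt x 0) = _
    rw [ih, List.range_succ_eq_map, List.flatMap_cons, packKeys_append, List.flatMap_map]
    have h1 : acc <<< (w * cnt) + rowKeys K N w f (t ^^^ r) cnt x 0 =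
        packKeys w acc ((List.range (cnt - d * 0)).map fun j =>
          f (t ^^^ (bitRot K N)^[0] r ^^^ (bitRot K N)^[j] (adv^[0] x))) := by
      rw [rowKeys_eq, packKeys_eq w acc]
      simp
    rw [h1]
    congr 1
    refine List.flatMap_congr fun i _ => ?_
    have h2 : cnt - d - d * i = cnt - d * (i + 1) := by
      rw [mul_add, mul_one]
      omega
    rw [h2]
    rfl

/-- Run over the three letters. -/
noncomputable def letters (T : ℕ → ℕ) (g : ℕ → ℕ → ℕ) (acc : ℕ) : ℕ :=
  g (T 3) (g (T 2) (g (T 1) acc))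

theorem letters_eq {w : ℕ} (T : ℕ → ℕ) (g : ℕ → ℕ → ℕ) (L : ℕ → List ℕ)
    (h : ∀ t acc, g (T t) acc = packKeys w acc (L t)) (acc : ℕ) :
    letters T g acc = packKeys w acc ([1, 2, 3].flatMap L) := by
  simp [letters, h, packKeys_append]

/-- The keys of the errors of weight `1`. -/
noncomputable def singleKeys (w : ℕ) (f T : ℕ → ℕ) (acc : ℕ) : ℕ :=
  letters T (fun t acc => Nat.add (Nat.shiftLeft acc w) (f t)) acc

/-- The keys of the errors of weight `2`. -/
noncomputable def pairKeys (K N w n : ℕ) (f T : ℕ → ℕ) (acc : ℕ) : ℕ :=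
  letters T (fun t => letters T fun u =>
    rowKeys K N w f t (Nat.div n 2) (bitRot K N u)) acc

/-- The keys of the errors of weight `3`. -/
noncomputable def tripleKeys (K N w m c : ℕ) (f T : ℕ → ℕ) (acc : ℕ) : ℕ :=
  letters T (fun t => letters T fun u => letters T fun v =>
    blockKeys K N w f (fun x => bitRot K N (bitRot K N x)) 3 t m (bitRot K N u)
      (bitRot K N (bitRot K N v)) c) acc

/-- The keys for fixed letters of the errors of weight `4`. -/
noncomputable def cubeKeys (K N w : ℕ) (f : ℕ → ℕ) (t m : ℕ) : ℕ → ℕ → ℕ → ℕ → ℕ → ℕ :=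
  Nat.rec (fun _ _ _ _ acc => acc) (fun _ ih r s x cnt acc =>
    ih (bitRot K N r) (bitRot K N s) (bitRot K N x) (Nat.sub cnt 1)
      (Nat.add (Nat.shiftLeft acc (Nat.mul w (Nat.div (Nat.mul cnt (Nat.succ cnt)) 2)))
        (blockKeys K N w f (bitRot K N) 1 (Nat.xor t r) cnt s x cnt 0))) m

theorem sum_range_sub (c : ℕ) : ((List.range c).map fun j => c - j).sum = c * (c + 1) / 2 := by
  induction c with
  | zero => rfl
  | succ c ih =>
    simp only [List.range_succ_eq_map, List.map_cons, List.map_map, List.sum_cons,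
      Function.comp_def, Nat.succ_eq_add_one, Nat.add_sub_add_right, ih, Nat.sub_zero]
    have h : (c + 1) * (c + 1 + 1) = c * (c + 1) + (c + 1) * 2 := by ring
    rw [h, Nat.add_mul_div_right _ _ two_pos, add_comm]

/-- The keys of the errors of weight `4`. -/
noncomputable def quadKeys (K N w m : ℕ) (f T : ℕ → ℕ) (t acc : ℕ) : ℕ :=
  letters T (fun u => letters T fun v => letters T fun s =>
    cubeKeys K N w f t m (bitRot K N u) (bitRot K N (bitRot K N v))
      (bitRot K N (bitRot K N (bitRot K N s))) m) acc

theorem singleKeys_eq (K N w : ℕ) (f T : ℕ → ℕ) (acc : ℕ) :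
    singleKeys w f T acc = packKeys w acc (singleErrors.map fun l => f (syndrome K N T l)) := by
  rw [singleKeys, letters_eq (w := w) T _ (fun t => [f (T t)]) fun t acc => rfl]
  simp [singleErrors]

theorem pairKeys_eq (K N w n : ℕ) (f T : ℕ → ℕ) (acc : ℕ) :
    pairKeys K N w n f T acc =
      packKeys w acc ((pairErrors n).map fun l => f (syndrome K N T l)) := by
  rw [pairKeys, letters_eq (w := w) T _ _ fun t acc => letters_eq (w := w) T _ _
    (fun u acc => rowKeys_eq K N w f (T t) (n / 2) (bitRot K N (T u)) acc) acc]
  simp only [pairErrors, List.map_flatMap, List.map_map]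
  congr 1
  refine List.flatMap_congr fun t _ => List.flatMap_congr fun u _ =>
    List.map_congr_left fun i _ => ?_
  simp only [Function.comp, syndrome_cons, syndrome_nil, Nat.xor_zero, Function.iterate_zero, id,
    ← Function.iterate_succ_apply]

theorem iterate_two (g : ℕ → ℕ) (i x : ℕ) : (fun x => g (g x))^[i] x = g^[2 * i] x := by
  rw [Function.iterate_mul]
  rfl

theorem tripleKeys_eq (K N w m c : ℕ) (f T : ℕ → ℕ) (acc : ℕ) :
    tripleKeys K N w m c f T acc =
      packKeys w acc ((tripleErrors m c).map fun l => f (syndrome K N T l)) := by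
  rw [tripleKeys, letters_eq (w := w) T _ _ fun t acc => letters_eq (w := w) T _ _
    (fun u acc => letters_eq (w := w) T _ _ (fun v acc => blockKeys_eq K N w f
      (fun x => bitRot K N (bitRot K N x)) 3 (T t) m (bitRot K N (T u))
      (bitRot K N (bitRot K N (T v))) c acc) acc) acc]
  simp only [tripleErrors, List.map_flatMap, List.map_map]
  congr 1
  refine List.flatMap_congr fun t _ => List.flatMap_congr fun u _ => List.flatMap_congr fun v _ =>
    List.flatMap_congr fun i _ => List.map_congr_left fun j _ => ?_
  simp only [Function.comp, syndrome_cons, syndrome_nil, Nat.xor_zero, iterate_two,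
    Function.iterate_zero, id, ← Function.iterate_succ_apply, ← Function.iterate_add_apply]
  rw [Nat.xor_assoc]
  congr 4
  omega

theorem cubeKeys_eq (K N w : ℕ) (f : ℕ → ℕ) (t m r s x cnt acc : ℕ) :
    cubeKeys K N w f t m r s x cnt acc =
      packKeys w acc ((List.range m).flatMap fun i => (List.range (cnt - i)).flatMap fun j =>
        (List.range (cnt - i - j)).map fun k =>
          f (t ^^^ (bitRot K N)^[i] r ^^^ (bitRot K N)^[i + j] s ^^^
            (bitRot K N)^[i + j + k] x)) := by
  induction m generalizing r s x cnt acc with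
  | zero => rfl
  | succ m ih =>
    change cubeKeys K N w f t m (bitRot K N r) (bitRot K N s) (bitRot K N x) (cnt - 1)
      (acc <<< (w * (cnt * (cnt + 1) / 2)) +
        blockKeys K N w f (bitRot K N) 1 (t ^^^ r) cnt s x cnt 0) = _
    -- A block has cnt (cnt + 1) / 2 keys. It is packed on its own and then appended, so the long
    -- accumulator is shifted once per block.
    have hb : acc <<< (w * (cnt * (cnt + 1) / 2)) +
        blockKeys K N w f (bitRot K N) 1 (t ^^^ r) cnt s x cnt 0 =
        blockKeys K N w f (bitRot K N) 1 (t ^^^ r) cnt s x cnt acc := by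
      rw [blockKeys_eq, blockKeys_eq, packKeys_eq w acc, List.length_flatMap]
      simp only [List.length_map, List.length_range, one_mul, sum_range_sub]
    rw [hb, ih, blockKeys_eq, List.range_succ_eq_map, List.flatMap_cons, packKeys_append,
      List.flatMap_map]
    congr 1
    · congr 1
      refine List.flatMap_congr fun j _ => ?_
      simp only [one_mul, Nat.sub_zero, zero_add, Function.iterate_zero, id]
      refine List.map_congr_left fun k _ => ?_
      rw [← Function.iterate_add_apply, add_comm k j]
    · refine List.flatMap_congr fun i _ => ?_
      have h1 : cnt - 1 - i = cnt - (i + 1) := by omega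
      have h2 : ∀ j, i + 1 + j = i + j + 1 := fun j => by omega
      have h3 : ∀ j k, i + j + 1 + k = i + j + k + 1 := fun j k => by omega
      simp only [h1, Nat.succ_eq_add_one, h2, h3, Function.iterate_succ_apply]

theorem quadKeys_eq (K N w m : ℕ) (f T : ℕ → ℕ) (t acc : ℕ) :
    quadKeys K N w m f T (T t) acc =
      packKeys w acc ((quadErrors m t).map fun l => f (syndrome K N T l)) := by
  rw [quadKeys, letters_eq (w := w) T _ _ fun u acc => letters_eq (w := w) T _ _
    (fun v acc => letters_eq (w := w) T _ _ (fun s acc => cubeKeys_eq K N w f (T t) m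
      (bitRot K N (T u)) (bitRot K N (bitRot K N (T v)))
      (bitRot K N (bitRot K N (bitRot K N (T s)))) m acc) acc) acc]
  simp only [quadErrors, List.map_flatMap, List.map_map]
  congr 1
  refine List.flatMap_congr fun u _ => List.flatMap_congr fun v _ => List.flatMap_congr fun s _ =>
    List.flatMap_congr fun i _ => List.flatMap_congr fun j _ => List.map_congr_left fun k _ => ?_
  simp only [Function.comp, syndrome_cons, syndrome_nil, Nat.xor_zero,
    Function.iterate_zero, id, ← Function.iterate_succ_apply]
  simp only [Nat.xor_assoc]

/-! ## Errors of small weight have nonzero syndrome -/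

/-- The error `l` moved by `s` places in cyclic length `n`. -/
def place (n s : ℕ) (l : List (ℕ × ℕ)) : List (ℕ × ℕ) := l.map fun c => ((c.1 + s) % n, c.2)

/-- The assumptions under which `rotHash` separates the rotations of a syndrome. -/
structure IsRotHash (K n : ℕ) (Ds : List ℕ) (T : ℕ → ℕ) : Prop where
  K_pos : 0 < K
  n_pos : 0 < n
  lt : ∀ t, T t < 2 ^ (K * n)
  dvd : ∀ D ∈ Ds, D ∣ 2 ^ (K * n) - 1
  mem : ∀ p, p.Prime → p ∣ n → (2 ^ (K * n) - 1) / (2 ^ (K * (n / p)) - 1) ∈ Ds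

/-- Representatives for the errors of weight at most `3` up to rotation, without those supported
on a coset of the subgroup of order `3`. -/
def smallErrors (n : ℕ) : List (List (ℕ × ℕ)) :=
  [] :: (singleErrors ++ (pairErrors n ++ tripleErrors ((n - 1) / 3) (n - 3)))

/-- The letters `1`, `2`, `3` stand for the Pauli matrices `X`, `Z`, `XZ`. -/
def IsLetter (t : ℕ) : Prop := t ∈ [1, 2, 3]

theorem mem_pairErrors {n a t u : ℕ} (ha : 0 < a) (han : a ≤ n / 2) (ht : IsLetter t)
    (hu : IsLetter u) : [(0, t), (a, u)] ∈ pairErrors n := by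
  refine List.mem_flatMap.2 ⟨t, ht, List.mem_flatMap.2 ⟨u, hu, List.mem_map.2
    ⟨a - 1, List.mem_range.2 (by omega), ?_⟩⟩⟩
  rw [Nat.sub_add_cancel ha]

theorem mem_tripleErrors {m c a b t u v : ℕ} (ha : 0 < a) (hab : 2 * a ≤ b) (ham : a ≤ m)
    (hbc : a + b < c + 3) (ht : IsLetter t) (hu : IsLetter u)
    (hv : IsLetter v) : [(0, t), (a, u), (b, v)] ∈ tripleErrors m c := by
  refine List.mem_flatMap.2 ⟨t, ht, List.mem_flatMap.2 ⟨u, hu, List.mem_flatMap.2 ⟨v, hv,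
    List.mem_flatMap.2 ⟨a - 1, List.mem_range.2 (by omega), List.mem_map.2
    ⟨b - 2 * a, List.mem_range.2 (by omega), ?_⟩⟩⟩⟩⟩
  rw [Nat.sub_add_cancel ha, Nat.add_sub_cancel' hab]

theorem mem_quadErrors {m a b c t u v s : ℕ} (ha : 0 < a) (hab : a < b) (hbc : b < c)
    (hc : c ≤ m + 2) (hu : IsLetter u) (hv : IsLetter v) (hs : IsLetter s) :
    [(0, t), (a, u), (b, v), (c, s)] ∈ quadErrors m t := by
  refine List.mem_flatMap.2 ⟨u, hu, List.mem_flatMap.2 ⟨v, hv, List.mem_flatMap.2 ⟨s, hs,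
    List.mem_flatMap.2 ⟨a - 1, List.mem_range.2 (by omega), List.mem_flatMap.2
    ⟨b - a - 1, List.mem_range.2 (by omega), List.mem_map.2
    ⟨c - b - 1, List.mem_range.2 (by omega), ?_⟩⟩⟩⟩⟩⟩
  have h1 : a - 1 + 1 = a := by omega
  have h2 : a - 1 + (b - a - 1) + 2 = b := by omega
  have h3 : a - 1 + (b - a - 1) + (c - b - 1) + 3 = c := by omega
  rw [h1, h2, h3]

/-- The error `l` is a rotation of one of `smallErrors n`. -/
def IsSmallError (n : ℕ) (l : List (ℕ × ℕ)) : Prop := ∃ c ∈ smallErrors n, ∃ s, l.Perm (place n s c)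

theorem isSmallError_nil (n : ℕ) : IsSmallError n [] := ⟨[], by simp [smallErrors], 0, List.Perm.nil⟩

theorem isSmallError_single {n : ℕ} {x : ℕ × ℕ} (hx : x.1 < n) (ht : IsLetter x.2) :
    IsSmallError n [x] := by
  refine ⟨[(0, x.2)], ?_, x.1, ?_⟩
  · simp only [smallErrors, List.mem_cons, List.mem_append]
    exact Or.inr (Or.inl (List.mem_map.2 ⟨x.2, ht, rfl⟩))
  · simp [place, Nat.mod_eq_of_lt hx]

theorem isSmallError_pair {n : ℕ} {x y : ℕ × ℕ} (hxy : x.1 < y.1) (hy : y.1 < n)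
    (htx : IsLetter x.2) (hty : IsLetter y.2) : IsSmallError n [x, y] := by
  have hmem : ∀ {c}, c ∈ pairErrors n → c ∈ smallErrors n := fun h => by simp [smallErrors, h]
  by_cases h : y.1 - x.1 ≤ n / 2
  · refine ⟨_, hmem (mem_pairErrors (a := y.1 - x.1) (by omega) h htx hty), x.1, ?_⟩
    have h1 : (0 + x.1) % n = x.1 := by rw [zero_add, Nat.mod_eq_of_lt (by omega)]
    have h2 : (y.1 - x.1 + x.1) % n = y.1 := by
      rw [Nat.sub_add_cancel hxy.le, Nat.mod_eq_of_lt hy]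
    simp only [place, List.map_cons, List.map_nil, h1, h2]
    exact List.Perm.refl _
  · refine ⟨_, hmem (mem_pairErrors (a := n + x.1 - y.1) (by omega) (by omega) hty htx), y.1, ?_⟩
    have h1 : (0 + y.1) % n = y.1 := by rw [zero_add, Nat.mod_eq_of_lt (by omega)]
    have h2 : (n + x.1 - y.1 + y.1) % n = x.1 := by
      rw [Nat.sub_add_cancel (by omega), Nat.add_mod_left, Nat.mod_eq_of_lt (by omega)]
    simp only [place, List.map_cons, List.map_nil, h1, h2]
    exact List.Perm.swap _ _ _

/-- Start at the point whose gap to its successor is at most the next gap and strictly below the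
previous one. Such a point is missing only if all three gaps equal n/3. The strictness singles out
one starting point, as injectivity of the hash on representatives requires. -/
theorem isSmallError_triple {n : ℕ} {x y z : ℕ × ℕ} (hxy : x.1 < y.1) (hyz : y.1 < z.1)
    (hz : z.1 < n) (htx : IsLetter x.2) (hty : IsLetter y.2) (htz : IsLetter z.2)
    (h : ¬ (3 * (y.1 - x.1) = n ∧ 3 * (z.1 - y.1) = n)) : IsSmallError n [x, y, z] := by
  have hmem : ∀ {c}, c ∈ tripleErrors ((n - 1) / 3) (n - 3) → c ∈ smallErrors n := fun h => by
    simp [smallErrors, h]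
  have hx1 : (0 + x.1) % n = x.1 := by rw [zero_add, Nat.mod_eq_of_lt (by omega)]
  have hy1 : (0 + y.1) % n = y.1 := by rw [zero_add, Nat.mod_eq_of_lt (by omega)]
  have hz1 : (0 + z.1) % n = z.1 := by rw [zero_add, Nat.mod_eq_of_lt (by omega)]
  have hup : ∀ a b : ℕ, a ≤ b → b < n → (b - a + a) % n = b := fun a b hab hb => by
    rw [Nat.sub_add_cancel hab, Nat.mod_eq_of_lt hb]
  have hdown : ∀ a b : ℕ, a ≤ n → b < n → (n + b - a + a) % n = b := fun a b ha hb => by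
    rw [Nat.sub_add_cancel (by omega), Nat.add_mod_left, Nat.mod_eq_of_lt hb]
  have hcases : (y.1 - x.1 ≤ z.1 - y.1 ∧ y.1 - x.1 < n + x.1 - z.1) ∨
      (z.1 - y.1 ≤ n + x.1 - z.1 ∧ z.1 - y.1 < y.1 - x.1) ∨
      (n + x.1 - z.1 ≤ y.1 - x.1 ∧ n + x.1 - z.1 < z.1 - y.1) := by omega
  rcases hcases with h1 | h1 | h1
  · refine ⟨_, hmem (mem_tripleErrors (a := y.1 - x.1) (b := z.1 - x.1) (by omega) (by omega)
      (by omega) (by omega) htx hty htz), x.1, ?_⟩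
    simp only [place, List.map_cons, List.map_nil, hx1, hup x.1 y.1 (by omega) (by omega),
      hup x.1 z.1 (by omega) (by omega)]
    exact List.Perm.refl _
  · refine ⟨_, hmem (mem_tripleErrors (a := z.1 - y.1) (b := n + x.1 - y.1) (by omega) (by omega)
      (by omega) (by omega) hty htz htx), y.1, ?_⟩
    simp only [place, List.map_cons, List.map_nil, hy1, hup y.1 z.1 (by omega) (by omega),
      hdown y.1 x.1 (by omega) (by omega)]
    exact List.perm_append_comm (l₁ := [x]) (l₂ := [y, z])
  · refine ⟨_, hmem (mem_tripleErrors (a := n + x.1 - z.1) (b := n + y.1 - z.1) (by omega)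
      (by omega) (by omega) (by omega) htz htx hty), z.1, ?_⟩
    simp only [place, List.map_cons, List.map_nil, hz1, hdown z.1 x.1 (by omega) (by omega),
      hdown z.1 y.1 (by omega) (by omega)]
    exact List.perm_append_comm (l₁ := [x, y]) (l₂ := [z])

theorem syndrome_append (K N : ℕ) (T : ℕ → ℕ) (l l' : List (ℕ × ℕ)) :
    syndrome K N T (l ++ l') = syndrome K N T l ^^^ syndrome K N T l' := by
  induction l with
  | nil => simp
  | cons c l ih => simp [ih, Nat.xor_assoc]

theorem syndrome_perm {K N : ℕ} {T : ℕ → ℕ} {l l' : List (ℕ × ℕ)} (h : l.Perm l') :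
    syndrome K N T l = syndrome K N T l' := by
  induction h with
  | nil => rfl
  | cons c _ ih => simp [ih]
  | swap c d l => simp only [syndrome_cons, Nat.xor_left_comm]
  | trans _ _ ih1 ih2 => exact ih1.trans ih2

theorem syndrome_map_add (K N : ℕ) (T : ℕ → ℕ) (s : ℕ) (l : List (ℕ × ℕ)) :
    syndrome K N T (l.map fun c => (c.1 + s, c.2)) = (bitRot K N)^[s] (syndrome K N T l) := by
  induction l with
  | nil => simp
  | cons c l ih =>
    simp only [List.map_cons, syndrome_cons, ih, iterate_bitRot_xor, add_comm c.1 s,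
      Function.iterate_add_apply]

namespace IsRotHash

variable {K n : ℕ} {Ds : List ℕ} {T : ℕ → ℕ}

theorem le (h : IsRotHash K n Ds T) : K ≤ K * n := Nat.le_mul_of_pos_right K h.n_pos

theorem iterate_add_n (h : IsRotHash K n Ds T) {x : ℕ} (hx : x < 2 ^ (K * n)) (i : ℕ) :
    (bitRot K (K * n))^[i + n] x = (bitRot K (K * n))^[i] x := by
  rw [Function.iterate_add_apply, iterate_bitRot_period h.n_pos rfl hx]

theorem iterate_mod (h : IsRotHash K n Ds T) {x : ℕ} (hx : x < 2 ^ (K * n)) (i : ℕ) :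
    (bitRot K (K * n))^[i % n] x = (bitRot K (K * n))^[i] x := by
  have hper : Function.IsPeriodicPt (bitRot K (K * n)) n x := iterate_bitRot_period h.n_pos rfl hx
  exact hper.iterate_mod_apply i

theorem syndrome_lt (h : IsRotHash K n Ds T) (l : List (ℕ × ℕ)) :
    syndrome K (K * n) T l < 2 ^ (K * n) := by
  induction l with
  | nil => simp
  | cons c l ih => exact Nat.xor_lt_two_pow (iterate_bitRot_lt h.le (h.lt _) _) ih

theorem syndrome_place (h : IsRotHash K n Ds T) (s : ℕ) (l : List (ℕ × ℕ)) :
    syndrome K (K * n) T (place n s l) = (bitRot K (K * n))^[s] (syndrome K (K * n) T l) := by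
  rw [← syndrome_map_add]
  induction l with
  | nil => rfl
  | cons c l ih =>
    simp only [place, List.map_cons, syndrome_cons] at ih ⊢
    rw [ih, h.iterate_mod (h.lt _)]

theorem rotHash_syndrome_place (h : IsRotHash K n Ds T) (s : ℕ) (l : List (ℕ × ℕ)) :
    rotHash K Ds (syndrome K (K * n) T (place n s l)) =
      rotHash K Ds (syndrome K (K * n) T l) := by
  rw [h.syndrome_place, rotHash_iterate_bitRot h.n_pos h.K_pos rfl h.dvd (h.syndrome_lt l)]

/-- A string that is fixed by a proper rotation has vanishing hash. -/
theorem rotHash_eq_zero_of_iterate_eq (h : IsRotHash K n Ds T) {x : ℕ} (hx : x < 2 ^ (K * n))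
    {i j : ℕ} (hij : i < j) (hj : j < n)
    (he : (bitRot K (K * n))^[i] x = (bitRot K (K * n))^[j] x) : rotHash K Ds x = 0 := by
  have hK := h.K_pos
  have hn := h.n_pos
  set M := 2 ^ (K * n) - 1 with hM
  have hMpos : 0 < M := by
    have : 1 < 2 ^ (K * n) := Nat.one_lt_pow (by positivity) one_lt_two
    omega
  have h1 : 2 ^ (K * i) * x ≡ 2 ^ (K * j) * x [MOD M] :=
    (iterate_bitRot_modEq h.le hx i).symm.trans (he ▸ iterate_bitRot_modEq h.le hx j)
  obtain ⟨δ, rfl⟩ := Nat.exists_eq_add_of_lt hij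
  have hodd : Nat.Coprime M (2 ^ (K * i)) := by
    refine Nat.Coprime.pow_right _ ?_
    rw [Nat.coprime_two_right]
    exact Nat.Even.sub_odd Nat.one_le_two_pow (Nat.even_pow.2 ⟨even_two, by positivity⟩) odd_one
  have h2 : M ∣ (2 ^ (K * (δ + 1)) - 1) * x := by
    have e : 2 ^ (K * (i + δ + 1)) * x = 2 ^ (K * i) * (2 ^ (K * (δ + 1)) * x) := by
      rw [add_assoc, mul_add K i, pow_add]
      ring
    rw [e] at h1
    have h3 := Nat.ModEq.cancel_left_of_coprime hodd h1
    have h4 := (Nat.modEq_iff_dvd' (Nat.le_mul_of_pos_left x (by positivity))).1 h3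
    rwa [Nat.sub_mul, one_mul]
  -- The string is fixed by rotations by δ + 1 and by n blocks, hence by their gcd g < n.
  have h5 : M ∣ (2 ^ (K * Nat.gcd (δ + 1) n) - 1) * x := by
    have h6 : M ∣ Nat.gcd ((2 ^ (K * (δ + 1)) - 1) * x) (M * x) :=
      Nat.dvd_gcd h2 (Dvd.intro _ rfl)
    rwa [Nat.gcd_mul_right, hM, Nat.pow_sub_one_gcd_pow_sub_one, Nat.gcd_mul_left] at h6
  set g := Nat.gcd (δ + 1) n with hg
  have hgn : g ∣ n := Nat.gcd_dvd_right _ _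
  have hglt : g < n := (Nat.le_of_dvd (by omega) (Nat.gcd_dvd_left _ _)).trans_lt (by omega)
  obtain ⟨q, hq⟩ := hgn
  have hq1 : q ≠ 1 := by
    rintro rfl
    omega
  -- For a prime p dividing n/g the number g divides n/p, so x is fixed by rotation by n/p and is a
  -- multiple of the divisor that belongs to p.
  obtain ⟨p, hp, hpq⟩ := Nat.exists_prime_and_dvd hq1
  obtain ⟨r, rfl⟩ := hpq
  have hpn : p ∣ n := ⟨g * r, by rw [hq]; ring⟩
  have hdiv : n / p = g * r := by
    rw [hq, show g * (p * r) = g * r * p by ring, Nat.mul_div_cancel _ hp.pos]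
  refine rotHash_eq_zero (h.mem p hp hpn) ?_
  have hrpos : 0 < g * r := by
    rw [← hdiv]
    exact Nat.div_pos (Nat.le_of_dvd hn hpn) hp.pos
  have h7 : M ∣ (2 ^ (K * (n / p)) - 1) * x := by
    refine h5.trans (Nat.mul_dvd_mul_right ?_ x)
    rw [hdiv, ← mul_assoc, pow_mul 2 (K * g) r]
    exact Nat.sub_one_dvd_pow_sub_one _ _
  have h8 : 2 ^ (K * (n / p)) - 1 ∣ M := by
    have e : K * n = K * (n / p) * p := by rw [mul_assoc, Nat.div_mul_cancel hpn]
    rw [hM, e, pow_mul 2 (K * (n / p)) p]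
    exact Nat.sub_one_dvd_pow_sub_one _ _
  have h9 : 0 < 2 ^ (K * (n / p)) - 1 := by
    have : 1 < 2 ^ (K * (n / p)) := Nat.one_lt_pow (by rw [hdiv]; positivity) one_lt_two
    omega
  rw [Nat.div_dvd_iff_dvd_mul h8 h9, mul_comm]
  rwa [mul_comm] at h7

/-- Small errors with the same syndrome agree. -/
theorem perm_of_syndrome_eq (h : IsRotHash K n Ds T)
    (hnodup : ((smallErrors n).map fun l => rotHash K Ds (syndrome K (K * n) T l)).Nodup)
    {l l' : List (ℕ × ℕ)} (hl : IsSmallError n l) (hl' : IsSmallError n l')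
    (he : syndrome K (K * n) T l = syndrome K (K * n) T l') : l.Perm l' := by
  obtain ⟨c, hc, s, hs⟩ := hl
  obtain ⟨c', hc', s', hs'⟩ := hl'
  have hinj := List.inj_on_of_nodup_map hnodup
  rw [syndrome_perm hs, syndrome_perm hs'] at he
  -- Rotations do not change the hash, and the hash is injective on representatives.
  have hcc : c = c' := by
    refine hinj hc hc' ?_
    rw [← h.rotHash_syndrome_place s c, he, h.rotHash_syndrome_place]
  subst hcc
  rw [h.syndrome_place, h.syndrome_place, ← h.iterate_mod (h.syndrome_lt c) s,
    ← h.iterate_mod (h.syndrome_lt c) s'] at he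
  have hlt : ∀ s, s % n < n := fun s => Nat.mod_lt s h.n_pos
  -- Different rotations with the same syndrome make it periodic, so its hash is 0. That value
  -- belongs to the empty error, which is one of the representatives.
  have hzero : s % n ≠ s' % n → c = [] := by
    intro hne
    refine hinj hc (by simp [smallErrors]) ?_
    simp only [syndrome_nil, rotHash_zero]
    rcases Nat.lt_or_gt_of_ne hne with hlt' | hlt'
    · exact h.rotHash_eq_zero_of_iterate_eq (h.syndrome_lt c) hlt' (hlt _) he
    · exact h.rotHash_eq_zero_of_iterate_eq (h.syndrome_lt c) hlt' (hlt _) he.symm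
  have hplace : place n s c = place n s' c := by
    by_cases hs : s % n = s' % n
    · refine List.map_congr_left fun x _ => ?_
      rw [Nat.add_mod x.1, hs, ← Nat.add_mod]
    · rw [hzero hs]
      rfl
  exact (hs.trans (hplace ▸ List.Perm.refl _)).trans hs'.symm

/-- A zero sum means that both parts have the same syndrome, hence consist of the same entries.
Being disjoint, they are empty. -/
theorem syndrome_ne_zero_of_append (h : IsRotHash K n Ds T)
    (hnodup : ((smallErrors n).map fun l => rotHash K Ds (syndrome K (K * n) T l)).Nodup)
    {l l₁ l₂ : List (ℕ × ℕ)} (hl : l.Perm (l₁ ++ l₂)) (hd : l.Nodup) (hne : l ≠ [])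
    (h₁ : IsSmallError n l₁) (h₂ : IsSmallError n l₂) : syndrome K (K * n) T l ≠ 0 := by
  intro h0
  rw [syndrome_perm hl, syndrome_append, Nat.xor_eq_zero_iff] at h0
  have hp := h.perm_of_syndrome_eq hnodup h₁ h₂ h0
  have hdis := List.disjoint_of_nodup_append (hl.nodup_iff.1 hd)
  have hnil : l₁ = [] := List.eq_nil_iff_forall_not_mem.2 fun x hx => hdis hx (hp.subset hx)
  rw [hnil] at hp hl
  rw [hp.symm.eq_nil] at hl
  exact hne hl.eq_nil

/-- Errors of weight at most `6` have nonzero syndrome. -/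
theorem syndrome_ne_zero (h : IsRotHash K n Ds T)
    (hnodup : ((smallErrors n).map fun l => rotHash K Ds (syndrome K (K * n) T l)).Nodup)
    {l : List (ℕ × ℕ)} (hsort : l.IsChain fun x y => x.1 < y.1) (hlt : ∀ x ∈ l, x.1 < n)
    (hlet : ∀ x ∈ l, IsLetter x.2) (hne : l ≠ []) (hlen : l.length ≤ 6) :
    syndrome K (K * n) T l ≠ 0 := by
  have hd : l.Nodup := by
    have : IsTrans (ℕ × ℕ) fun x y => x.1 < y.1 := ⟨fun _ _ _ => lt_trans⟩
    exact (List.isChain_iff_pairwise.1 hsort).imp fun h he => (he ▸ h).ne rfl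
  have key := fun {l₁ l₂ : List (ℕ × ℕ)} (hl : l.Perm (l₁ ++ l₂)) =>
    h.syndrome_ne_zero_of_append hnodup hl hd hne
  match l, hne with
  | [x1], _ =>
    simp only [List.mem_cons, List.not_mem_nil, or_false, forall_eq] at hlt hlet
    exact key (l₁ := [x1]) (l₂ := []) (List.Perm.refl _) (isSmallError_single hlt hlet)
      (isSmallError_nil n)
  | [x1, x2], _ =>
    simp only [List.mem_cons, List.not_mem_nil, or_false, forall_eq_or_imp, forall_eq,
      List.isChain_cons_cons, List.isChain_singleton, and_true] at hlt hlet hsort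
    exact key (l₁ := [x1]) (l₂ := [x2]) (List.Perm.refl _) (isSmallError_single hlt.1 hlet.1)
      (isSmallError_single hlt.2 hlet.2)
  | [x1, x2, x3], _ =>
    simp only [List.mem_cons, List.not_mem_nil, or_false, forall_eq_or_imp, forall_eq,
      List.isChain_cons_cons, List.isChain_singleton, and_true] at hlt hlet hsort
    exact key (l₁ := [x1]) (l₂ := [x2, x3]) (List.Perm.refl _)
      (isSmallError_single hlt.1 hlet.1)
      (isSmallError_pair (by omega) (by omega) hlet.2.1 hlet.2.2)
  | [x1, x2, x3, x4], _ =>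
    simp only [List.mem_cons, List.not_mem_nil, or_false, forall_eq_or_imp, forall_eq,
      List.isChain_cons_cons, List.isChain_singleton, and_true] at hlt hlet hsort
    exact key (l₁ := [x1, x2]) (l₂ := [x3, x4]) (List.Perm.refl _)
      (isSmallError_pair (by omega) (by omega) hlet.1 hlet.2.1)
      (isSmallError_pair (by omega) (by omega) hlet.2.2.1 hlet.2.2.2)
  | [x1, x2, x3, x4, x5], _ =>
    simp only [List.mem_cons, List.not_mem_nil, or_false, forall_eq_or_imp, forall_eq,
      List.isChain_cons_cons, List.isChain_singleton, and_true] at hlt hlet hsort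
    obtain ⟨t1, t2, t3, t4, t5⟩ := hlet
    obtain ⟨-, -, -, -, hlt⟩ := hlt
    -- A coset of the subgroup of order 3 is avoided by using x4 instead of x3: the gap from x2 to
    -- x4 then exceeds n/3.
    by_cases hc : 3 * (x2.1 - x1.1) = n ∧ 3 * (x3.1 - x2.1) = n
    · exact key (l₁ := [x1, x2, x4]) (l₂ := [x3, x5])
        (((List.Perm.swap x4 x3 [x5]).cons x2).cons x1)
        (isSmallError_triple (by omega) (by omega) (by omega) t1 t2 t4 (by omega))
        (isSmallError_pair (by omega) (by omega) t3 t5)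
    · exact key (l₁ := [x1, x2, x3]) (l₂ := [x4, x5]) (List.Perm.refl _)
        (isSmallError_triple (by omega) (by omega) (by omega) t1 t2 t3 hc)
        (isSmallError_pair (by omega) (by omega) t4 t5)
  | [x1, x2, x3, x4, x5, x6], _ =>
    simp only [List.mem_cons, List.not_mem_nil, or_false, forall_eq_or_imp, forall_eq,
      List.isChain_cons_cons, List.isChain_singleton, and_true] at hlt hlet hsort
    obtain ⟨t1, t2, t3, t4, t5, t6⟩ := hlet
    obtain ⟨-, -, -, -, -, hlt⟩ := hlt
    -- Exchanging x3 and x4 repairs both halves. If x1, x2, x3 are equally spaced, then x3, x5, x6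
    -- lie in the last third; if x4, x5, x6 are, then x1, x2, x4 lie in the first third.
    by_cases hc : (3 * (x2.1 - x1.1) = n ∧ 3 * (x3.1 - x2.1) = n) ∨
        (3 * (x5.1 - x4.1) = n ∧ 3 * (x6.1 - x5.1) = n)
    · exact key (l₁ := [x1, x2, x4]) (l₂ := [x3, x5, x6])
        (((List.Perm.swap x4 x3 [x5, x6]).cons x2).cons x1)
        (isSmallError_triple (by omega) (by omega) (by omega) t1 t2 t4 (by omega))
        (isSmallError_triple (by omega) (by omega) (by omega) t3 t5 t6 (by omega))
    · exact key (l₁ := [x1, x2, x3]) (l₂ := [x4, x5, x6]) (List.Perm.refl _)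
        (isSmallError_triple (by omega) (by omega) (by omega) t1 t2 t3 (by tauto))
        (isSmallError_triple (by omega) (by omega) (by omega) t4 t5 t6 (by tauto))
  | _ :: _ :: _ :: _ :: _ :: _ :: _ :: _, _ => simp at hlen; omega

/-! ### Weight seven -/

/-- Rotate so that a smallest gap comes first. Only existence matters here, so ties and equal
spacing are admitted, which accounts for the larger ranges n/3 and n - 2. Positions may exceed n
because the word is later read from another starting point. -/
theorem exists_tripleErrors (h : IsRotHash K n Ds T) {x y z : ℕ × ℕ} (hxy : x.1 < y.1)
    (hyz : y.1 < z.1) (hz : z.1 < x.1 + n) (htx : IsLetter x.2) (hty : IsLetter y.2)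
    (htz : IsLetter z.2) : ∃ c ∈ tripleErrors (n / 3) (n - 2),
      rotHash K Ds (syndrome K (K * n) T [x, y, z]) = rotHash K Ds (syndrome K (K * n) T c) := by
  have hcyc : ∀ x y z : ℕ × ℕ, syndrome K (K * n) T [x, y, z] =
      syndrome K (K * n) T [y, z, (x.1 + n, x.2)] := fun x y z => by
    simp only [syndrome_cons, syndrome_nil, Nat.xor_zero, h.iterate_add_n (h.lt _)]
    ac_rfl
  have key : ∀ x y z : ℕ × ℕ, x.1 < y.1 → y.1 - x.1 ≤ z.1 - y.1 → z.1 - y.1 ≤ n →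
      y.1 - x.1 + z.1 ≤ x.1 + n → IsLetter x.2 → IsLetter y.2 → IsLetter z.2 →
      ∃ c ∈ tripleErrors (n / 3) (n - 2), rotHash K Ds (syndrome K (K * n) T [x, y, z]) =
        rotHash K Ds (syndrome K (K * n) T c) := by
    intro x y z h1 h2 h3 h4 htx hty htz
    refine ⟨_, mem_tripleErrors (a := y.1 - x.1) (b := z.1 - x.1) (by omega) (by omega) (by omega)
      (by omega) htx hty htz, ?_⟩
    rw [← rotHash_iterate_bitRot h.n_pos h.K_pos rfl h.dvd (h.syndrome_lt
      [(0, x.2), (y.1 - x.1, y.2), (z.1 - x.1, z.2)]) x.1, ← syndrome_map_add]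
    simp only [List.map_cons, List.map_nil, zero_add, Nat.sub_add_cancel h1.le,
      Nat.sub_add_cancel (show x.1 ≤ z.1 by omega)]
  have hcases : (y.1 - x.1 ≤ z.1 - y.1 ∧ y.1 - x.1 + z.1 ≤ x.1 + n) ∨
      (z.1 - y.1 ≤ n + x.1 - z.1 ∧ z.1 - y.1 ≤ y.1 - x.1) ∨
      (n + x.1 - z.1 ≤ y.1 - x.1 ∧ n + x.1 - z.1 ≤ z.1 - y.1) := by omega
  rcases hcases with h1 | h1 | h1
  · exact key x y z hxy (by omega) (by omega) (by omega) htx hty htz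
  · rw [hcyc]
    exact key _ _ _ (by omega) (by simp only; omega) (by simp only; omega) (by simp only; omega)
      hty htz htx
  · rw [hcyc, hcyc]
    exact key _ _ _ (by simp only; omega) (by simp only; omega) (by simp only; omega)
      (by simp only; omega) htz htx hty

theorem syndrome_seven_ne_zero_of_le (h : IsRotHash K n Ds T) {W : ℕ} (hW : 2 ≤ W)
    (hgap : ∀ t, IsLetter t → ∀ c ∈ tripleErrors (n / 3) (n - 2), ∀ q ∈ quadErrors (W - 2) t,
      rotHash K Ds (syndrome K (K * n) T c) ≠ rotHash K Ds (syndrome K (K * n) T q))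
    {x1 x2 x3 x4 x5 x6 x7 : ℕ × ℕ} (h1 : x1.1 < x2.1) (h2 : x2.1 < x3.1) (h3 : x3.1 < x4.1)
    (h4 : x4.1 < x5.1) (h5 : x5.1 < x6.1) (h6 : x6.1 < x7.1) (h7 : x7.1 < x1.1 + n)
    (hle : x4.1 ≤ x1.1 + W) (t1 : IsLetter x1.2) (t2 : IsLetter x2.2)
    (t3 : IsLetter x3.2) (t4 : IsLetter x4.2) (t5 : IsLetter x5.2)
    (t6 : IsLetter x6.2) (t7 : IsLetter x7.2) :
    syndrome K (K * n) T [x1, x2, x3, x4, x5, x6, x7] ≠ 0 := by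
  intro h0
  change syndrome K (K * n) T ([x1, x2, x3, x4] ++ [x5, x6, x7]) = 0 at h0
  rw [syndrome_append, Nat.xor_eq_zero_iff] at h0
  obtain ⟨c, hc, hce⟩ := h.exists_tripleErrors h5 h6 (by omega) t5 t6 t7
  refine hgap x1.2 t1 c hc _ (mem_quadErrors (a := x2.1 - x1.1) (b := x3.1 - x1.1)
    (c := x4.1 - x1.1) (by omega) (by omega) (by omega) (by omega) t2 t3 t4) ?_
  rw [← hce, ← h0, ← rotHash_iterate_bitRot h.n_pos h.K_pos rfl h.dvd (h.syndrome_lt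
    [(0, x1.2), (x2.1 - x1.1, x2.2), (x3.1 - x1.1, x3.2), (x4.1 - x1.1, x4.2)]) x1.1,
    ← syndrome_map_add]
  simp only [List.map_cons, List.map_nil, zero_add, Nat.sub_add_cancel h1.le,
    Nat.sub_add_cancel (show x1.1 ≤ x3.1 by omega), Nat.sub_add_cancel (show x1.1 ≤ x4.1 by omega)]

/-- Errors of weight `7` have nonzero syndrome. Some four cyclically consecutive positions lie in
a window of length `3 n / 7`. -/
theorem syndrome_seven_ne_zero (h : IsRotHash K n Ds T)
    (hgap : ∀ t, IsLetter t → ∀ c ∈ tripleErrors (n / 3) (n - 2),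
      ∀ q ∈ quadErrors (3 * n / 7 - 2) t,
      rotHash K Ds (syndrome K (K * n) T c) ≠ rotHash K Ds (syndrome K (K * n) T q))
    {l : List (ℕ × ℕ)} (hsort : l.IsChain fun x y => x.1 < y.1) (hlt : ∀ x ∈ l, x.1 < n)
    (hlet : ∀ x ∈ l, IsLetter x.2) (hlen : l.length = 7) :
    syndrome K (K * n) T l ≠ 0 := by
  match l, hlen with
  | [x1, x2, x3, x4, x5, x6, x7], _ =>
    simp only [List.mem_cons, List.not_mem_nil, or_false, forall_eq_or_imp, forall_eq,
      List.isChain_cons_cons, List.isChain_singleton, and_true] at hlt hlet hsort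
    obtain ⟨t1, t2, t3, t4, t5, t6, t7⟩ := hlet
    have key := @syndrome_seven_ne_zero_of_le K n Ds T h (3 * n / 7) (by omega) hgap
    have hcyc : ∀ x1 x2 x3 x4 x5 x6 x7 : ℕ × ℕ,
        syndrome K (K * n) T [x1, x2, x3, x4, x5, x6, x7] =
          syndrome K (K * n) T [x2, x3, x4, x5, x6, x7, (x1.1 + n, x1.2)] := by
      intro x1 x2 x3 x4 x5 x6 x7
      simp only [syndrome_cons, syndrome_nil, Nat.xor_zero, h.iterate_add_n (h.lt _)]
      ac_rfl
    obtain ⟨-, -, -, -, -, -, hlt⟩ := hlt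
    -- The seven cyclic spans of four consecutive positions add up to 3n, so one of them is at most
    -- 3n/7. Each failed case moves the first position to the end, raised by n; after six failures
    -- the seventh span must be short.
    by_cases c1 : x4.1 ≤ x1.1 + 3 * n / 7
    · exact key (by omega) (by omega) (by omega) (by omega) (by omega) (by omega) (by omega) c1
        t1 t2 t3 t4 t5 t6 t7
    rw [hcyc]
    by_cases c2 : x5.1 ≤ x2.1 + 3 * n / 7
    · exact key (by omega) (by omega) (by omega) (by omega) (by omega) (by simp only; omega)
        (by simp only; omega) c2 t2 t3 t4 t5 t6 t7 t1
    rw [hcyc]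
    by_cases c3 : x6.1 ≤ x3.1 + 3 * n / 7
    · exact key (by omega) (by omega) (by omega) (by omega) (by simp only; omega)
        (by simp only; omega) (by simp only; omega) c3 t3 t4 t5 t6 t7 t1 t2
    rw [hcyc]
    by_cases c4 : x7.1 ≤ x4.1 + 3 * n / 7
    · exact key (by omega) (by omega) (by omega) (by simp only; omega) (by simp only; omega)
        (by simp only; omega) (by simp only; omega) c4 t4 t5 t6 t7 t1 t2 t3
    rw [hcyc]
    by_cases c5 : x1.1 + n ≤ x5.1 + 3 * n / 7
    · exact key (by omega) (by omega) (by simp only; omega) (by simp only; omega)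
        (by simp only; omega) (by simp only; omega) (by simp only; omega) c5 t5 t6 t7 t1 t2 t3 t4
    rw [hcyc]
    by_cases c6 : x2.1 + n ≤ x6.1 + 3 * n / 7
    · exact key (by omega) (by simp only; omega) (by simp only; omega) (by simp only; omega)
        (by simp only; omega) (by simp only; omega) (by simp only; omega) c6
        t6 t7 t1 t2 t3 t4 t5
    rw [hcyc]
    exact key (by simp only; omega) (by simp only; omega) (by simp only; omega)
      (by simp only; omega) (by simp only; omega) (by simp only; omega) (by simp only; omega)
      (by simp only; omega) t7 t1 t2 t3 t4 t5 t6

end IsRotHash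

/-! ## Syndromes of symplectic vectors -/

/-- The letter of a symplectic vector at position `i`. -/
def letterAt {n : ℕ} (e : SympVec n) (i : Fin n) : ℕ := (e.1 i).val + 2 * (e.2 i).val

/-- The letters of a symplectic vector, with their positions. -/
def letterList {n : ℕ} (e : SympVec n) : List (ℕ × ℕ) :=
  (List.finRange n).map fun i : Fin n => ((i : ℕ), letterAt e i)

/-- The nonzero letters of a symplectic vector, with their positions. -/
def errorList {n : ℕ} (e : SympVec n) : List (ℕ × ℕ) :=
  ((List.finRange n).filter fun i => letterAt e i ≠ 0).map fun i : Fin n => ((i : ℕ), letterAt e i)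

theorem letterAt_lt {n : ℕ} (e : SympVec n) (i : Fin n) : letterAt e i < 4 := by
  have h1 := ZMod.val_lt (e.1 i)
  have h2 := ZMod.val_lt (e.2 i)
  unfold letterAt
  omega

theorem letterAt_ne_zero {n : ℕ} (e : SympVec n) (i : Fin n) :
    letterAt e i ≠ 0 ↔ (e.1 i, e.2 i) ≠ (0, 0) := by
  rw [ne_eq, ne_eq, Prod.mk.injEq, letterAt, Nat.add_eq_zero_iff, mul_eq_zero, ZMod.val_eq_zero,
    ZMod.val_eq_zero]
  simp only [OfNat.ofNat_ne_zero, false_or]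

theorem length_errorList {n : ℕ} (e : SympVec n) : (errorList e).length = sympWeight e := by
  rw [errorList, List.length_map, sympWeight,
    ← List.toFinset_card_of_nodup ((List.nodup_finRange n).filter _)]
  congr 1
  ext i
  simp only [List.mem_toFinset, List.mem_filter, List.mem_finRange, true_and, decide_eq_true_iff,
    letterAt_ne_zero, Finset.mem_filter, Finset.mem_univ]

theorem isChain_errorList {n : ℕ} (e : SympVec n) :
    (errorList e).IsChain fun x y => x.1 < y.1 := by
  refine List.Pairwise.isChain ?_
  rw [errorList, List.pairwise_map]
  exact ((List.pairwise_lt_finRange n).filter _).imp fun h => h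

theorem lt_of_mem_errorList {n : ℕ} {e : SympVec n} {x : ℕ × ℕ} (hx : x ∈ errorList e) :
    x.1 < n := by
  obtain ⟨i, -, rfl⟩ := List.mem_map.1 hx
  exact i.2

theorem isLetter_of_mem_errorList {n : ℕ} {e : SympVec n} {x : ℕ × ℕ} (hx : x ∈ errorList e) :
    IsLetter x.2 := by
  obtain ⟨i, hi, rfl⟩ := List.mem_map.1 hx
  have h0 : letterAt e i ≠ 0 := by simpa using (List.mem_filter.1 hi).2
  have h1 := letterAt_lt e i
  simp only [IsLetter, List.mem_cons, List.not_mem_nil, or_false]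
  omega

/-- `T` is additive on letters. -/
structure IsLetterMap (T : ℕ → ℕ) : Prop where
  zero : T 0 = 0
  three : T 3 = T 1 ^^^ T 2

theorem syndrome_errorList {K N n : ℕ} {T : ℕ → ℕ} (hT : T 0 = 0) (e : SympVec n) :
    syndrome K N T (errorList e) = syndrome K N T (letterList e) := by
  unfold errorList letterList
  induction List.finRange n with
  | nil => rfl
  | cons i l ih =>
    by_cases h : letterAt e i = 0
    · rw [List.filter_cons_of_neg (by simp [h]), ih, List.map_cons, syndrome_cons]
      simp [h, hT]
    · rw [List.filter_cons_of_pos (by simp [h]), List.map_cons, List.map_cons, syndrome_cons,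
        syndrome_cons, ih]

theorem bitVal_iterate_letterAt {K N n : ℕ} {T : ℕ → ℕ} (hT : IsLetterMap T) (e : SympVec n)
    (i : Fin n) (j k : ℕ) : bitVal ((bitRot K N)^[j] (T (letterAt e i))) k =
      e.1 i * bitVal ((bitRot K N)^[j] (T 1)) k + e.2 i * bitVal ((bitRot K N)^[j] (T 2)) k := by
  have h01 : ∀ c : ZMod 2, c = 0 ∨ c = 1 := by decide
  unfold letterAt
  rcases h01 (e.1 i) with h1 | h1 <;> rcases h01 (e.2 i) with h2 | h2 <;>
    simp [h1, h2, hT.zero, ZMod.val_one, hT.three, iterate_bitRot_xor, bitVal_xor]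

theorem bitVal_syndrome_letterList {K N n : ℕ} {T : ℕ → ℕ} (hT : IsLetterMap T) (e : SympVec n)
    (k : ℕ) : bitVal (syndrome K N T (letterList e)) k =
      ∑ i : Fin n, (e.1 i * bitVal ((bitRot K N)^[i] (T 1)) k +
        e.2 i * bitVal ((bitRot K N)^[i] (T 2)) k) := by
  rw [Fin.sum_univ_def, letterList]
  induction List.finRange n with
  | nil => simp
  | cons i l ih =>
    rw [List.map_cons, syndrome_cons, bitVal_xor, ih, List.map_cons, List.sum_cons]
    congr 1
    exact bitVal_iterate_letterAt hT e i _ k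

theorem syndrome_bitRot_comp (K N : ℕ) (T : ℕ → ℕ) (l : List (ℕ × ℕ)) :
    syndrome K N (fun t => bitRot K N (T t)) l = bitRot K N (syndrome K N T l) := by
  induction l with
  | nil => simp
  | cons c l ih =>
    rw [syndrome_cons, syndrome_cons, ih, bitRot_xor, ← Function.iterate_succ_apply,
      Function.iterate_succ_apply' (bitRot K N)]

theorem IsLetterMap.bitRot_comp {K N : ℕ} {T : ℕ → ℕ} (hT : IsLetterMap T) :
    IsLetterMap fun t => bitRot K N (T t) :=
  ⟨by simp [hT.zero], by simp [hT.three, bitRot_xor]⟩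

theorem syndrome_letterList_add {K N n : ℕ} {T : ℕ → ℕ} (hT : IsLetterMap T) (e f : SympVec n) :
    syndrome K N T (letterList (e + f)) =
      syndrome K N T (letterList e) ^^^ syndrome K N T (letterList f) := by
  refine bitVal_injective (funext fun k => ?_)
  rw [bitVal_xor, bitVal_syndrome_letterList hT, bitVal_syndrome_letterList hT,
    bitVal_syndrome_letterList hT, ← Finset.sum_add_distrib]
  refine Finset.sum_congr rfl fun i _ => ?_
  simp only [Prod.fst_add, Prod.snd_add, Pi.add_apply]
  ring

theorem syndrome_letterList_zero {K N n : ℕ} {T : ℕ → ℕ} (hT : IsLetterMap T) :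
    syndrome K N T (letterList (0 : SympVec n)) = 0 := by
  refine bitVal_injective (funext fun k => ?_)
  rw [bitVal_syndrome_letterList hT]
  simp

/-- Shifting a word rotates its syndrome by one block. The letter that wraps around is rotated n
times in all, which is the identity. -/
theorem syndrome_letterList_X_mul {K n : ℕ} {T : ℕ → ℕ} (hn : 0 < n)
    (hlt : ∀ t, T t < 2 ^ (K * n)) (hT : IsLetterMap T) (p q : (ZMod 2)[X]) :
    syndrome K (K * n) T (letterList (coeffVec n (X * p), coeffVec n (X * q))) =
      bitRot K (K * n) (syndrome K (K * n) T (letterList (coeffVec n p, coeffVec n q))) := by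
  obtain ⟨m, rfl⟩ : ∃ m, n = m + 1 := ⟨n - 1, by omega⟩
  have hper : ∀ t, bitRot K (K * (m + 1)) ((bitRot K (K * (m + 1)))^[m] (T t)) = T t := fun t => by
    rw [← Function.iterate_succ_apply' (bitRot K _), iterate_bitRot_period hn rfl (hlt t)]
  refine bitVal_injective (funext fun k => ?_)
  rw [← syndrome_bitRot_comp, bitVal_syndrome_letterList hT,
    bitVal_syndrome_letterList hT.bitRot_comp, Fin.sum_univ_succ, Fin.sum_univ_castSucc, add_comm]
  simp only [coeffVec_X_mul, Fin.cons_zero, Fin.cons_succ, Fin.val_zero, Function.iterate_zero,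
    id, Fin.val_succ, Fin.val_castSucc, Fin.val_last, ← Function.iterate_succ_apply,
    Function.iterate_succ_apply' (bitRot K (K * (m + 1))) m, hper]

theorem syndrome_letterList_mul {K n : ℕ} {T : ℕ → ℕ} (hn : 0 < n)
    (hlt : ∀ t, T t < 2 ^ (K * n)) (hT : IsLetterMap T) {p q : (ZMod 2)[X]}
    (h : syndrome K (K * n) T (letterList (coeffVec n p, coeffVec n q)) = 0) (a : (ZMod 2)[X]) :
    syndrome K (K * n) T (letterList (coeffVec n (a * p), coeffVec n (a * q))) = 0 := by
  induction a using Polynomial.induction_on' with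
  | add a b ha hb =>
    have e : ((coeffVec n ((a + b) * p), coeffVec n ((a + b) * q)) : SympVec n) =
        (coeffVec n (a * p), coeffVec n (a * q)) + (coeffVec n (b * p), coeffVec n (b * q)) := by
      simp only [← coeffLin_apply, add_mul, map_add, Prod.mk_add_mk]
    rw [e, syndrome_letterList_add hT, ha, hb, Nat.xor_self]
  | monomial i c =>
    have hc : c = 0 ∨ c = 1 := by
      revert c
      decide
    rcases hc with rfl | rfl
    · have e : ((coeffVec n (monomial i 0 * p), coeffVec n (monomial i 0 * q)) : SympVec n) = 0 := by
        simp only [← coeffLin_apply, map_zero, zero_mul, map_zero]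
        rfl
      rw [e, syndrome_letterList_zero hT]
    · induction i with
      | zero => simpa using h
      | succ i ih =>
        have e : (monomial (i + 1) 1 : (ZMod 2)[X]) = X * monomial i 1 := by
          rw [X_mul_monomial]
        rw [e, mul_assoc, mul_assoc, syndrome_letterList_X_mul hn hlt hT, ih, bitRot_zero]

/-- Additivity and equivariance under multiplication by x reduce the claim to the two generators.
Only this direction is used: words outside the code may also have syndrome zero. -/
theorem syndrome_letterList_of_mem {K n : ℕ} {T : ℕ → ℕ} (hn : 0 < n)
    (hlt : ∀ t, T t < 2 ^ (K * n)) (hT : IsLetterMap T) {g₁ g₂ v : (ZMod 2)[X]}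
    (h₁ : syndrome K (K * n) T (letterList (coeffVec n (v * g₁), coeffVec n g₁)) = 0)
    (h₂ : syndrome K (K * n) T (letterList (coeffVec n g₂, coeffVec n (v * g₂))) = 0)
    {e : SympVec n} (he : e ∈ quasiCyclicCode n g₁ g₂ v) :
    syndrome K (K * n) T (letterList e) = 0 := by
  obtain ⟨a, b, rfl⟩ := mem_quasiCyclicCode.1 he
  have e : ((coeffVec n (a * (v * g₁) + b * g₂), coeffVec n (a * g₁ + b * (v * g₂))) : SympVec n) =
      (coeffVec n (a * (v * g₁)), coeffVec n (a * g₁)) +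
        (coeffVec n (b * g₂), coeffVec n (b * (v * g₂))) := by
    simp only [← coeffLin_apply, map_add, Prod.mk_add_mk]
  rw [e, syndrome_letterList_add hT, syndrome_letterList_mul hn hlt hT h₁,
    syndrome_letterList_mul hn hlt hT h₂, Nat.xor_self]

/-! ### Computing syndromes on bit strings -/

/-- The sum of the rotations of `t` by the places of the bits of `A`. -/
noncomputable def rotSum (K N m : ℕ) : ℕ → ℕ → ℕ :=
  Nat.rec (fun _ _ => 0) (fun _ ih A t =>
    Nat.xor (Nat.mul (Nat.mod A 2) t) (ih (Nat.div A 2) (bitRot K N t))) m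

theorem bitVal_rotSum (K N m A t k : ℕ) : bitVal (rotSum K N m A t) k =
    ∑ i : Fin m, bitVal A i * bitVal ((bitRot K N)^[i] t) k := by
  induction m generalizing A t with
  | zero =>
    change bitVal 0 k = _
    simp
  | succ m ih =>
    change bitVal (((A % 2) * t) ^^^ rotSum K N m (A / 2) (bitRot K N t)) k = _
    rw [bitVal_xor, ih, Fin.sum_univ_succ]
    congr 1
    · rw [Fin.val_zero, Function.iterate_zero, id, bitVal.eq_1 A, Nat.testBit_zero]
      rcases Nat.mod_two_eq_zero_or_one A with h | h <;> simp [h]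
    · refine Finset.sum_congr rfl fun i _ => ?_
      rw [Fin.val_succ, Function.iterate_succ_apply, bitVal.eq_1 A, Nat.testBit_succ]
      rfl

theorem syndrome_letterList_bitPoly {K N n A B : ℕ} {T : ℕ → ℕ} (hn : 0 < n)
    (hT : IsLetterMap T) (hA : A < 2 ^ n) (hB : B < 2 ^ n) :
    syndrome K N T (letterList (coeffVec n (bitPoly A), coeffVec n (bitPoly B))) =
      rotSum K N n A (T 1) ^^^ rotSum K N n B (T 2) := by
  refine bitVal_injective (funext fun k => ?_)
  rw [bitVal_syndrome_letterList hT, bitVal_xor, bitVal_rotSum, bitVal_rotSum,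
    Finset.sum_add_distrib]
  simp only [coeffVec_bitPoly hn hA, coeffVec_bitPoly hn hB]

/-- The additive map on letters with `1 ↦ x` and `2 ↦ z`. -/
noncomputable def letterMap (x z t : ℕ) : ℕ :=
  Nat.xor (Nat.mul (Nat.mod t 2) x) (Nat.mul (Nat.mod (Nat.div t 2) 2) z)

theorem letterMap_eq (x z t : ℕ) : letterMap x z t = ((t % 2) * x) ^^^ ((t / 2 % 2) * z) := rfl

theorem isLetterMap_letterMap (x z : ℕ) : IsLetterMap (letterMap x z) := by
  constructor <;> simp [letterMap_eq]

theorem letterMap_lt {x z N : ℕ} (hx : x < 2 ^ N) (hz : z < 2 ^ N) (t : ℕ) :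
    letterMap x z t < 2 ^ N := by
  have h : ∀ a y, y < 2 ^ N → a % 2 * y < 2 ^ N := fun a y hy => by
    rcases Nat.mod_two_eq_zero_or_one a with h | h <;> simp [h, hy]
  exact Nat.xor_lt_two_pow (h _ _ hx) (h _ _ hz)

/-- The numbers `(2 ^ (K n) - 1) / (2 ^ (K n / p) - 1)`; their multiples are the strings that are
fixed by rotation by `n / p` blocks. -/
def rotDivisors (K n : ℕ) (ps : List ℕ) : List ℕ :=
  ps.map fun p => Nat.div (Nat.sub (Nat.pow 2 (Nat.mul K n)) 1)
    (Nat.sub (Nat.pow 2 (Nat.mul K (Nat.div n p))) 1)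

theorem isRotHash_letterMap {K n x z : ℕ} {ps : List ℕ} (hK : 0 < K) (hn : 0 < n)
    (hdvd : ∀ p ∈ ps, p ∣ n) (hps : ∀ p, p.Prime → p ∣ n → p ∈ ps) (hx : x < 2 ^ (K * n))
    (hz : z < 2 ^ (K * n)) : IsRotHash K n (rotDivisors K n ps) (letterMap x z) := by
  refine ⟨hK, hn, letterMap_lt hx hz, fun D hD => ?_, fun p hp hpn =>
    List.mem_map.2 ⟨p, hps p hp hpn, rfl⟩⟩
  obtain ⟨p, hp, rfl⟩ := List.mem_map.1 hD
  refine Nat.div_dvd_of_dvd ?_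
  change 2 ^ (K * (n / p)) - 1 ∣ 2 ^ (K * n) - 1
  have e : K * n = K * (n / p) * p := by rw [mul_assoc, Nat.div_mul_cancel (hdvd p hp)]
  rw [e, pow_mul 2 (K * (n / p)) p]
  exact Nat.sub_one_dvd_pow_sub_one _ _

/-! ### Lower bounds for the minimum distance -/

theorem length_pairErrors (n : ℕ) : (pairErrors n).length = 9 * (n / 2) := by
  simp only [pairErrors, List.length_flatMap, List.length_map, List.length_range, List.map_cons,
    List.map_nil, List.sum_cons, List.sum_nil]
  ring

theorem length_tripleErrors (m c : ℕ) : (tripleErrors m c).length =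
    27 * ((List.range m).map fun i => c - 3 * i).sum := by
  simp only [tripleErrors, List.length_flatMap, List.length_map, List.length_range, List.map_cons,
    List.map_nil, List.sum_cons, List.sum_nil]
  ring

theorem length_quadErrors (m t : ℕ) : (quadErrors m t).length =
    27 * ((List.range m).map fun i =>
      ((List.range (m - i)).map fun j => m - i - j).sum).sum := by
  simp only [quadErrors, List.length_flatMap, List.length_map, List.length_range, List.map_cons,
    List.map_nil, List.sum_cons, List.sum_nil]
  ring

theorem length_smallErrors (n : ℕ) : (smallErrors n).length =
    9 * (n / 2) + 27 * ((List.range ((n - 1) / 3)).map fun i => n - 3 - 3 * i).sum + 4 := by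
  simp only [smallErrors, List.length_cons, List.length_append, length_pairErrors,
    length_tripleErrors]
  simp only [singleErrors, List.length_map, List.length_cons, List.length_nil]
  ring

/-- The keys of all small errors. -/
noncomputable def smallKeys (K N w n : ℕ) (f T : ℕ → ℕ) : ℕ :=
  tripleKeys K N w (Nat.div (Nat.sub n 1) 3) (Nat.sub n 3) f T
    (pairKeys K N w n f T (singleKeys w f T 0))

/-- The empty error has key f 0 = 0, which the initial accumulator 0 already contains as an
invisible leading field. -/
theorem smallKeys_eq (K N w n : ℕ) {f : ℕ → ℕ} (hf : f 0 = 0) (T : ℕ → ℕ) :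
    smallKeys K N w n f T =
      packKeys w 0 ((smallErrors n).map fun l => f (syndrome K N T l)) := by
  rw [smallKeys, singleKeys_eq K N, pairKeys_eq, tripleKeys_eq, ← packKeys_append,
    ← packKeys_append, smallErrors, List.map_cons, List.map_append, List.map_append,
    syndrome_nil, hf, ← List.append_assoc]
  change _ = packKeys w (0 <<< w + 0) _
  simp only [Nat.zero_shiftLeft, add_zero]
  rfl

/-- The hashes of the syndromes of small errors are distinct. -/
noncomputable def smallCheck (K n m M : ℕ) (ps : List ℕ) (x z : ℕ) : Bool :=
  strictCheck (Nat.succ K) m M (fieldSort (Nat.succ K) m (smallKeys K (Nat.mul K n) (Nat.succ K) n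
    (rotHash K (rotDivisors K n ps)) (letterMap x z)))

/-- Hashes have K bits; the width K + 1 leaves the free top bit that the order test relies on. -/
theorem nodup_of_smallCheck {K n m M x z : ℕ} {ps : List ℕ} (hK : 0 < K)
    (hM : (smallErrors n).length = M) (hm : M ≤ 2 ^ m) (h : smallCheck K n m M ps x z = true) :
    ((smallErrors n).map fun l => rotHash K (rotDivisors K n ps)
      (syndrome K (K * n) (letterMap x z) l)).Nodup := by
  refine nodup_of_strictCheck (w := K + 1) (m := m) (by omega) (fun y hy => ?_) ?_ ?_
  · obtain ⟨l, -, rfl⟩ := List.mem_map.1 hy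
    exact (rotHash_lt hK _ _).trans (Nat.pow_lt_pow_right one_lt_two (by omega))
  · rw [List.length_map, hM]
    exact hm
  · rw [List.length_map, hM, ← smallKeys_eq K (K * n) (K + 1) n (rotHash_zero _)]
    exact h

/-- The hashes of the syndromes of the errors of weight `3` differ from those of the errors of
weight `4` that begin with the letter `t` and fit into a window. -/
noncomputable def windowCheck (K n W m t : ℕ) (ps : List ℕ) (x z : ℕ) : Bool :=
  gapCheck (Nat.add K 3) m (fieldSort (Nat.add K 3) m
    (quadKeys K (Nat.mul K n) (Nat.add K 3) (Nat.sub W 2)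
      (fun y => Nat.add (Nat.mul 3 (rotHash K (rotDivisors K n ps) y)) 3) (letterMap x z)
      (letterMap x z t)
      (tripleKeys K (Nat.mul K n) (Nat.add K 3) (Nat.div n 3) (Nat.sub n 2)
        (fun y => Nat.add (Nat.mul 3 (rotHash K (rotDivisors K n ps) y)) 2) (letterMap x z) 0)))

/-- Triples get the key 3R + 2 and fours the key 3R + 3, so two sorted keys are consecutive exactly
when a triple and a four have the same hash; coincidences within one kind are allowed. The padding 0
is never followed by 1, since all keys are at least 2. Keys fit into K + 2 bits, and the last bit of
the field stays free. -/
theorem ne_of_windowCheck {K n W m t x z : ℕ} {ps : List ℕ} (hK : 0 < K)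
    (hM : (tripleErrors (n / 3) (n - 2)).length + (quadErrors (W - 2) t).length ≤ 2 ^ m)
    (h : windowCheck K n W m t ps x z = true) {c q : List (ℕ × ℕ)}
    (hc : c ∈ tripleErrors (n / 3) (n - 2)) (hq : q ∈ quadErrors (W - 2) t) :
    rotHash K (rotDivisors K n ps) (syndrome K (K * n) (letterMap x z) c) ≠
      rotHash K (rotDivisors K n ps) (syndrome K (K * n) (letterMap x z) q) := by
  intro he
  set R := fun l => rotHash K (rotDivisors K n ps) (syndrome K (K * n) (letterMap x z) l) with hR
  have hlt : ∀ l, 3 * R l + 3 < 2 ^ (K + 3) := fun l => by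
    have h1 : R l < 2 ^ K := rotHash_lt hK _ _
    rw [pow_add]
    have h2 : 0 < 2 ^ K := by positivity
    omega
  refine add_one_notMem_of_gapCheck (w := K + 3) (m := m) (a := 3 * R c + 2)
    (l := (tripleErrors (n / 3) (n - 2)).map (fun l => 3 * R l + 2) ++
      (quadErrors (W - 2) t).map fun l => 3 * R l + 3) (by omega) ?_ ?_ ?_ ?_ ?_
  · intro y hy
    rcases List.mem_append.1 hy with hy | hy <;> obtain ⟨l, -, rfl⟩ := List.mem_map.1 hy
    · exact (Nat.lt_succ_self _).trans (hlt l)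
    · exact hlt l
  · rw [List.length_append, List.length_map, List.length_map]
    exact hM
  · rw [packKeys_append]
    refine Eq.trans ?_ h
    unfold windowCheck
    have h1 := tripleKeys_eq K (K * n) (K + 3) (n / 3) (n - 2)
      (fun y => Nat.add (Nat.mul 3 (rotHash K (rotDivisors K n ps) y)) 2) (letterMap x z) 0
    have h2 := quadKeys_eq K (K * n) (K + 3) (W - 2)
      (fun y => Nat.add (Nat.mul 3 (rotHash K (rotDivisors K n ps) y)) 3) (letterMap x z) t
    exact congrArg (fun y => gapCheck (K + 3) m (fieldSort (K + 3) m y))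
      ((h2 _).trans (congrArg (fun a => packKeys (K + 3) a _) h1)).symm
  · exact List.mem_append_left _ (List.mem_map_of_mem hc)
  · rw [show R c = R q from he]
    exact List.mem_append_right _ (List.mem_map_of_mem (f := fun l => 3 * R l + 3) hq)

/-- Strings `x`, `z` such that the syndrome with `x` for the letter `1` and `z` for the letter `2`
vanishes on a quasi-cyclic code. The numbers `u` and `u'` stand for `v g₁` and `v g₂`. -/
structure IsCheckPair (K n g₁ g₂ v u u' x z : ℕ) : Prop where
  mul : cycFold n 2 (clMul n g₁ v) = u ∧ cycFold n 2 (clMul n g₂ v) = u'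
  size : v < 2 ^ n ∧ g₁ < 2 ^ n ∧ g₂ < 2 ^ n ∧ u < 2 ^ n ∧ u' < 2 ^ n
  lt : x < 2 ^ (K * n) ∧ z < 2 ^ (K * n)
  sum₁ : rotSum K (K * n) n u x = rotSum K (K * n) n g₁ z
  sum₂ : rotSum K (K * n) n g₂ x = rotSum K (K * n) n u' z

/-- The two conditions on rotation sums say that the generators (v g₁, g₁) and (g₂, v g₂) have
syndrome zero. -/
theorem IsCheckPair.syndrome_eq_zero {K n g₁ g₂ v u u' x z : ℕ}
    (h : IsCheckPair K n g₁ g₂ v u u' x z) (hn : 0 < n) {e : SympVec n}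
    (he : e ∈ quasiCyclicCode n (bitPoly g₁) (bitPoly g₂) (bitPoly v)) :
    syndrome K (K * n) (letterMap x z) (letterList e) = 0 := by
  obtain ⟨hv, hg₁, hg₂, hu, hu'⟩ := h.size
  have hT := isLetterMap_letterMap x z
  have h1 : letterMap x z 1 = x := by simp [letterMap_eq]
  have h2 : letterMap x z 2 = z := by simp [letterMap_eq]
  have hmul : ∀ {g w : ℕ}, cycFold n 2 (clMul n g v) = w →
      coeffVec n (bitPoly v * bitPoly g) = coeffVec n (bitPoly w) := by
    intro g w hw
    rw [mul_comm, ← bitPoly_clMul n g v hv, ← hw]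
    exact coeffVec_congr hn (dvd_bitPoly_sub_cycFold _ _ _)
  refine syndrome_letterList_of_mem hn (letterMap_lt h.lt.1 h.lt.2) hT ?_ ?_ he
  · rw [hmul h.mul.1, syndrome_letterList_bitPoly hn hT hu hg₁, h1, h2, h.sum₁, Nat.xor_self]
  · rw [hmul h.mul.2, syndrome_letterList_bitPoly hn hT hg₂ hu', h1, h2, h.sum₂, Nat.xor_self]

theorem IsCheckPair.seven_le_sympWeight {K n g₁ g₂ v u u' x z m M : ℕ} {ps : List ℕ}
    (h : IsCheckPair K n g₁ g₂ v u u' x z) (hK : 0 < K) (hn : 0 < n)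
    (hdvd : ∀ p ∈ ps, p ∣ n) (hps : ∀ p, p.Prime → p ∣ n → p ∈ ps)
    (hM : (smallErrors n).length = M) (hm : M ≤ 2 ^ m) (hc : smallCheck K n m M ps x z = true)
    {e : SympVec n} (he : e ∈ quasiCyclicCode n (bitPoly g₁) (bitPoly g₂) (bitPoly v))
    (h0 : e ≠ 0) : 7 ≤ sympWeight e := by
  by_contra hlt
  refine (isRotHash_letterMap hK hn hdvd hps h.lt.1 h.lt.2).syndrome_ne_zero
    (nodup_of_smallCheck hK hM hm hc) (isChain_errorList e) (fun x => lt_of_mem_errorList)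
    (fun x => isLetter_of_mem_errorList) (fun hnil => ?_) (by rw [length_errorList]; omega)
    ((syndrome_errorList (isLetterMap_letterMap x z).zero e).trans (h.syndrome_eq_zero hn he))
  have hw : sympWeight e = 0 := by rw [← length_errorList, hnil, List.length_nil]
  refine h0 ?_
  rw [sympWeight, Finset.card_eq_zero, Finset.filter_eq_empty_iff] at hw
  refine Prod.ext (funext fun i => ?_) (funext fun i => ?_)
  · exact (Prod.mk.inj (not_not.1 (hw (Finset.mem_univ i)))).1
  · exact (Prod.mk.inj (not_not.1 (hw (Finset.mem_univ i)))).2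

theorem IsCheckPair.sympWeight_ne_seven {K n g₁ g₂ v u u' x z m : ℕ} {ps : List ℕ}
    (h : IsCheckPair K n g₁ g₂ v u u' x z) (hK : 0 < K) (hn : 0 < n)
    (hdvd : ∀ p ∈ ps, p ∣ n) (hps : ∀ p, p.Prime → p ∣ n → p ∈ ps)
    (hm : ∀ t, (tripleErrors (n / 3) (n - 2)).length +
      (quadErrors (3 * n / 7 - 2) t).length ≤ 2 ^ m)
    (hc₁ : windowCheck K n (3 * n / 7) m 1 ps x z = true)
    (hc₂ : windowCheck K n (3 * n / 7) m 2 ps x z = true)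
    (hc₃ : windowCheck K n (3 * n / 7) m 3 ps x z = true)
    {e : SympVec n} (he : e ∈ quasiCyclicCode n (bitPoly g₁) (bitPoly g₂) (bitPoly v)) :
    sympWeight e ≠ 7 := by
  intro hw
  have hall : ∀ t, IsLetter t → windowCheck K n (3 * n / 7) m t ps x z = true := by
    intro t ht
    simp only [IsLetter, List.mem_cons, List.not_mem_nil, or_false] at ht
    rcases ht with rfl | rfl | rfl
    exacts [hc₁, hc₂, hc₃]
  exact (isRotHash_letterMap hK hn hdvd hps h.lt.1 h.lt.2).syndrome_seven_ne_zero
    (fun t ht c hc q hq => ne_of_windowCheck hK (hm t) (hall t ht) hc hq)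
    (isChain_errorList e) (fun x => lt_of_mem_errorList)
    (fun x => isLetter_of_mem_errorList) (by rw [length_errorList, hw])
    ((syndrome_errorList (isLetterMap_letterMap x z).zero e).trans (h.syndrome_eq_zero hn he))

/-! ## Quantum codes from quasi-cyclic codes -/

/-- A pure code from the symplectic dual-containing code `C`. -/
theorem exists_isStabilizerCode {n k d : ℕ} {C : Submodule (ZMod 2) (SympVec n)}
    (hC : sympDual C ≤ C) (hk : Module.finrank (ZMod 2) (sympDual C) + k = n)
    (hmin : ∀ e ∈ C, e ≠ 0 → d ≤ sympWeight e)
    (hex : ∃ e ∈ C, e ∉ sympDual C ∧ sympWeight e = d) :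
    ∃ χ Q, IsStabilizerCode n k d (sympDual C) χ Q ∧ IsPureQECC d Q := by
  have hle : sympDual C ≤ sympDual (sympDual C) := by rwa [sympDual_sympDual]
  -- Any joint eigenspace serves: dimension, distance and purity do not depend on the eigenvalues.
  obtain ⟨χ, Q, hQ, -⟩ := exists_isJointEigenspace hle (V := ⊤) top_ne_bot
    fun _ _ _ _ => Submodule.mem_top
  refine ⟨χ, Q, ⟨hle, hQ, ?_, ?_⟩, ?_⟩
  · have h := hQ.finrank_mul_card
    rw [card_submodule] at h
    refine Nat.eq_of_mul_eq_mul_right (show 0 < 2 ^ Module.finrank (ZMod 2) (sympDual C) by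
      positivity) ?_
    rw [h, ← pow_add, add_comm k, hk]
  · rw [sympDual_sympDual]
    refine ⟨hex, ?_⟩
    rintro w ⟨e, he, heS, rfl⟩
    exact hmin e he fun h0 => heS (h0 ▸ zero_mem _)
  · intro e h0 hd φ hφ ψ hψ
    refine hQ.inner_pauli_eq_zero (fun he => ?_) hφ hψ
    rw [sympDual_sympDual] at he
    refine hd.not_ge (hmin e he fun he0 => ?_)
    rw [he0] at h0
    simp [sympWeight] at h0

/-- The symplectic vector with the bits of `A` and `B`. -/
noncomputable def bitVec (n A B : ℕ) : SympVec n := (coeffVec n (bitPoly A), coeffVec n (bitPoly B))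

theorem bitVec_mem {n g₁ g₂ v u u' a b A B : ℕ} (hn : 0 < n)
    (hu : cycFold n 2 (clMul n g₁ v) = u ∧ cycFold n 2 (clMul n g₂ v) = u')
    (hv : v < 2 ^ n) (ha : a < 2 ^ n) (hb : b < 2 ^ n)
    (hA : cycFold n 2 (Nat.xor (clMul n u a) (clMul n g₂ b)) = A)
    (hB : cycFold n 2 (Nat.xor (clMul n g₁ a) (clMul n u' b)) = B) :
    bitVec n A B ∈ quasiCyclicCode n (bitPoly g₁) (bitPoly g₂) (bitPoly v) := by
  have h1 : ∀ {x : ℕ}, coeffVec n (bitPoly (cycFold n 2 x)) = coeffVec n (bitPoly x) :=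
    fun {x} => (coeffVec_congr hn (dvd_bitPoly_sub_cycFold n 2 x)).symm
  have hmul : ∀ {g w c : ℕ}, cycFold n 2 (clMul n g v) = w →
      coeffLin n (bitPoly c * (bitPoly v * bitPoly g)) = coeffLin n (bitPoly w * bitPoly c) := by
    intro g w c hw
    refine coeffVec_congr hn ?_
    have := (dvd_bitPoly_sub_cycFold n 2 (clMul n g v)).mul_left (bitPoly c)
    rw [hw, bitPoly_clMul n g v hv] at this
    convert this using 1
    ring
  refine mem_quasiCyclicCode.2 ⟨bitPoly a, bitPoly b, Prod.ext ?_ ?_⟩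
  · change coeffVec n (bitPoly A) = coeffLin n _
    rw [map_add, hmul hu.1, mul_comm (bitPoly b), ← map_add, ← hA, h1]
    change coeffVec n (bitPoly (clMul n u a ^^^ clMul n g₂ b)) = _
    rw [bitPoly_xor, bitPoly_clMul n u a ha, bitPoly_clMul n g₂ b hb, coeffLin_apply]
  · change coeffVec n (bitPoly B) = coeffLin n _
    rw [map_add, hmul hu.2, mul_comm (bitPoly a), ← map_add, ← hB, h1]
    change coeffVec n (bitPoly (clMul n g₁ a ^^^ clMul n u' b)) = _
    rw [bitPoly_xor, bitPoly_clMul n g₁ a ha, bitPoly_clMul n u' b hb, coeffLin_apply]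

theorem bitVal_eq_zero {A i : ℕ} : bitVal A i = 0 ↔ A.testBit i = false := by
  unfold bitVal
  split_ifs with h <;> simp [h]

theorem sympWeight_bitVec {n A B : ℕ} (hn : 0 < n) (hA : A < 2 ^ n) (hB : B < 2 ^ n) :
    sympWeight (bitVec n A B) =
      (Finset.univ.filter fun i : Fin n => (A ||| B).testBit i = true).card := by
  rw [sympWeight]
  congr 1
  ext i
  simp only [Finset.mem_filter, Finset.mem_univ, true_and, bitVec, coeffVec_bitPoly hn hA,
    coeffVec_bitPoly hn hB, ne_eq, Prod.mk.injEq, bitVal_eq_zero, Nat.testBit_or]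
  cases A.testBit i <;> cases B.testBit i <;> simp

theorem sympInner_bitVec {n A B A' B' : ℕ} (hn : 0 < n) (hA : A < 2 ^ n) (hB : B < 2 ^ n)
    (hA' : A' < 2 ^ n) (hB' : B' < 2 ^ n) : sympInner (bitVec n A B) (bitVec n A' B') =
      ∑ i : Fin n, bitVal ((A &&& B') ^^^ (B &&& A')) i := by
  refine Finset.sum_congr rfl fun i _ => ?_
  simp only [bitVec, coeffVec_bitPoly hn hA, coeffVec_bitPoly hn hB, coeffVec_bitPoly hn hA',
    coeffVec_bitPoly hn hB', bitVal, Nat.testBit_xor, Nat.testBit_and]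
  cases A.testBit i <;> cases B.testBit i <;> cases A'.testBit i <;> cases B'.testBit i <;> decide

/-- A string of `n` blocks of `K` bits that represents a pair of polynomials. -/
noncomputable def checkString (K n a b : ℕ) : ℕ :=
  -- Spreading the bits of a and b by K makes multiplication by x a rotation by K places. The powers
  -- 3^250 < 2^400 and 5^250 < 2^600 are fixed irregular multipliers that mix the two parity checks
  -- given by a and b over the K bits of a block, so that the hash separates syndromes.
  cycFold (Nat.mul K n) 2 (Nat.xor (clMul 400 (spreadBits K n a) (Nat.pow 3 250))
    (clMul 600 (spreadBits K n b) (Nat.pow 5 250)))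

/-- `e = (A, B)` and `f = (A', B')` are codewords of the quasi-cyclic code, `e` has weight `d`,
and `e`, `f` are not orthogonal. -/
structure IsWitness (n d g₁ g₂ v u u' a b A B a' b' A' B' : ℕ) : Prop where
  lt : a < 2 ^ n ∧ b < 2 ^ n ∧ a' < 2 ^ n ∧ b' < 2 ^ n ∧ A < 2 ^ n ∧ B < 2 ^ n ∧ A' < 2 ^ n ∧
    B' < 2 ^ n
  fst : cycFold n 2 (Nat.xor (clMul n u a) (clMul n g₂ b)) = A ∧
    cycFold n 2 (Nat.xor (clMul n g₁ a) (clMul n u' b)) = B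
  snd : cycFold n 2 (Nat.xor (clMul n u a') (clMul n g₂ b')) = A' ∧
    cycFold n 2 (Nat.xor (clMul n g₁ a') (clMul n u' b')) = B'
  weight : (Finset.univ.filter fun i : Fin n => (A ||| B).testBit i = true).card = d
  inner : ∑ i : Fin n, bitVal ((A' &&& B) ^^^ (B' &&& A)) i = 1

theorem IsWitness.exists_mem {K n d g₁ g₂ v u u' x z a b A B a' b' A' B' : ℕ}
    (h : IsWitness n d g₁ g₂ v u u' a b A B a' b' A' B')
    (hc : IsCheckPair K n g₁ g₂ v u u' x z) (hn : 0 < n) :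
    ∃ e ∈ quasiCyclicCode n (bitPoly g₁) (bitPoly g₂) (bitPoly v),
      e ∉ sympDual (quasiCyclicCode n (bitPoly g₁) (bitPoly g₂) (bitPoly v)) ∧
        sympWeight e = d := by
  obtain ⟨ha, hb, ha', hb', hA, hB, hA', hB'⟩ := h.lt
  refine ⟨bitVec n A B, bitVec_mem hn hc.mul hc.size.1 ha hb h.fst.1 h.fst.2, fun hd => ?_,
    (sympWeight_bitVec hn hA hB).trans h.weight⟩
  have h1 := mem_sympDual.1 hd (bitVec n A' B')
    (bitVec_mem hn hc.mul hc.size.1 ha' hb' h.snd.1 h.snd.2)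
  rw [sympInner_bitVec hn hA' hB' hA hB, h.inner] at h1
  exact one_ne_zero h1

/-- One of the eight quasi-cyclic codes gives a pure quantum code with parameters
`[[n, k, d]]`. -/
def IsRealized (n k d : ℕ) : Prop :=
  ∃ p ∈ eightCodes, p.n = n ∧ p.k = k ∧ p.d = d ∧
    ∃ χ Q, IsStabilizerCode p.n p.k p.d (sympDual (quasiCyclicCode p.n p.g₁ p.g₂ p.v)) χ Q ∧
      IsPureQECC p.d Q

theorem isRealized_of_mem {p : QCData} (hp : p ∈ eightCodes) {n k d g₁ g₂ v : ℕ} (hn : p.n = n)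
    (hk : p.k = k) (hd : p.d = d) {L₁ L₂ L : List (ZMod 2 × ℕ)} (hg₁ : p.g₁ = ofRuns L₁)
    (hg₂ : p.g₂ = ofRuns L₂) (hv : p.v = ofRuns L) (hL₁ : runBits L₁ = g₁) (hL₂ : runBits L₂ = g₂)
    (hL : runBits L = v) {d₁ d₂ h₁ h₂ c₁ c₂ w : ℕ}
    (hdual : DualCertificate n d₁ d₂ g₁ g₂ v h₁ h₂ c₁ c₂ w) (hsum : d₁ + d₂ + k = n)
    {K u u' x z : ℕ} (hpair : IsCheckPair K n g₁ g₂ v u u' x z) {a b A B a' b' A' B' : ℕ}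
    (hwit : IsWitness n d g₁ g₂ v u u' a b A B a' b' A' B')
    (hmin : ∀ e ∈ quasiCyclicCode n (bitPoly g₁) (bitPoly g₂) (bitPoly v), e ≠ 0 →
      d ≤ sympWeight e) : IsRealized n k d := by
  refine ⟨p, hp, hn, hk, hd, ?_⟩
  rw [hg₁, hg₂, hv, ofRuns_eq_bitPoly, ofRuns_eq_bitPoly, ofRuns_eq_bitPoly, hL₁, hL₂, hL]
  subst hn hk hd
  obtain ⟨hle, hfr⟩ := hdual.sympDual_le
  exact exists_isStabilizerCode hle (by rw [hfr, hsum]) hmin (hwit.exists_mem hpair hdual.pos)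

theorem IsRealized.propagate {n k d : ℕ} (h : IsRealized n k d) (i j : ℕ) (hi : i < k) :
    ∃ p ∈ eightCodes, ∃ Q₀ : Submodule ℂ (Qubits p.n), ∃ Q : Submodule ℂ (Qubits (n + j)),
      IsSymplecticConstruction (quasiCyclicCode p.n p.g₁ p.g₂ p.v) Q₀ ∧
      IsQECC p.n p.k p.d Q₀ ∧ IsPureQECC p.d Q₀ ∧ Propagates Q₀ (n + j) Q ∧
      (∃ C : Submodule (ZMod 2) (SympVec (n + j)), IsSymplecticConstruction C Q) ∧
      IsQECC (n + j) (k - i) d Q := by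
  obtain ⟨p, hp, rfl, rfl, rfl, χ, Q₀, hQ₀, hpure⟩ := h
  obtain ⟨S, χ', Q, hQ, hprop⟩ := exists_propagates hQ₀ i j hi
  have hcon := hQ₀.isSymplecticConstruction
  rw [sympDual_sympDual] at hcon
  exact ⟨p, hp, Q₀, Q, hcon, hQ₀.isQECC, hpure, hprop, ⟨_, hQ.isSymplecticConstruction⟩, hQ.isQECC⟩

/-! ### Length 45 -/

/-- After the degrees 13 and 16 come g₁, g₂ and v as bit strings, the generators h₁, h₂ of the dual,
the quotients h₁/g₁ and h₂/g₂, and an inverse of 1 + v² modulo x^45 - 1. -/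
theorem dualCertificate_45 : DualCertificate 45 13 16 12315 90447
    29686813950006
    867810205 7633891839
    71187 102609
    24237459321883 := by
  constructor <;> decide +kernel

theorem isCheckPair_45 : IsCheckPair 32 45 12315 90447
    29686813950006
    5497558512640 27487794728792
    (checkString 32 45 779577203
      1256278459522)
    (checkString 32 45 31919452155219
      8575222215) := by
  constructor <;> decide +kernel

/-- The multipliers a, b produce a word of weight 8; the word not orthogonal to it is x times the
first generator. -/
theorem isWitness_45 : IsWitness 45 8 12315 90447
    29686813950006
    5497558512640 27487794728792
    1685854500 476549856
    10739515459 1073741893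
    2 0
    10995117025280 24630 := by
  constructor <;> decide +kernel

theorem smallCheck_45 : smallCheck 32 45 14 8707 [3, 5]
    (checkString 32 45 779577203
      1256278459522)
    (checkString 32 45 31919452155219
      8575222215) = true := by
  decide +kernel

/-- The window is ⌊3 · 45 / 7⌋ = 19. The three possible first letters of a four are treated
separately, so that all keys of one run fit into 2^16 fields. -/
theorem windowCheck_45_1 : windowCheck 32 45 19 16 1 [3, 5]
    (checkString 32 45 779577203
      1256278459522)
    (checkString 32 45 31919452155219
      8575222215) = true := by
  decide +kernel

theorem windowCheck_45_2 : windowCheck 32 45 19 16 2 [3, 5]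
    (checkString 32 45 779577203
      1256278459522)
    (checkString 32 45 31919452155219
      8575222215) = true := by
  decide +kernel

theorem windowCheck_45_3 : windowCheck 32 45 19 16 3 [3, 5]
    (checkString 32 45 779577203
      1256278459522)
    (checkString 32 45 31919452155219
      8575222215) = true := by
  decide +kernel

theorem mem_of_prime_dvd_45 (p : ℕ) (hp : p.Prime) (h : p ∣ 45) : p ∈ [3, 5] := by
  have h1 : p ∈ Nat.primeFactorsList 45 := (Nat.mem_primeFactorsList (by norm_num)).2 ⟨hp, h⟩
  simpa using h1

theorem isRealized_45 : IsRealized 45 16 8 := by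
  refine isRealized_of_mem (p := eightCodes[0]'(by simp [eightCodes])) (List.getElem_mem _) rfl rfl rfl
    rfl rfl rfl (by decide +kernel) (by decide +kernel) (by decide +kernel)
    dualCertificate_45 rfl isCheckPair_45 isWitness_45 fun e he h0 => ?_
  have h7 := isCheckPair_45.seven_le_sympWeight (m := 14) (M := 8707) (ps := [3, 5]) (by norm_num)
    (by norm_num) (by decide) mem_of_prime_dvd_45
    ((length_smallErrors _).trans (by decide +kernel)) (by norm_num) smallCheck_45 he h0
  have h8 := isCheckPair_45.sympWeight_ne_seven (m := 16) (ps := [3, 5]) (by norm_num)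
    (by norm_num) (by decide) mem_of_prime_dvd_45
    (fun t => by
      rw [length_tripleErrors, length_quadErrors]
      decide +kernel)
    windowCheck_45_1 windowCheck_45_2 windowCheck_45_3 he
  omega

/-! ### Length 51 -/

theorem dualCertificate_51 : DualCertificate 51 1 24 3 24294179
    234959027100336
    262575117 2251799813685247
    90338299 117338677
    1548807338217499 := by
  constructor <;> decide +kernel

/-- The second check is the parity of the Z-half, with the all-one string 2^51 - 1. It vanishes on
the code because g₁ = 1 + x and v have even weight. -/
theorem isCheckPair_51 : IsCheckPair 32 51 3 24294179
    234959027100336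
    420919611322320 1974472001598763
    (checkString 32 51 184718943
      0)
    (checkString 32 51 180508889785762
      2251799813685247) := by
  constructor <;> decide +kernel

theorem isWitness_51 : IsWitness 51 7 3 24294179
    234959027100336
    420919611322320 1974472001598763
    463374446526557 93783450
    17592186044491 1126999418470400
    4 0
    1683678445289280 12 := by
  constructor <;> decide +kernel

theorem smallCheck_51 : smallCheck 32 51 14 11245 [3, 17]
    (checkString 32 51 184718943
      0)
    (checkString 32 51 180508889785762
      2251799813685247) = true := by
  decide +kernel

theorem mem_of_prime_dvd_51 (p : ℕ) (hp : p.Prime) (h : p ∣ 51) : p ∈ [3, 17] := by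
  have h1 : p ∈ Nat.primeFactorsList 51 := (Nat.mem_primeFactorsList (by norm_num)).2 ⟨hp, h⟩
  simpa using h1

/-- For d = 7 the exclusion of weights up to 6 is enough, and no window check is required. -/
theorem isRealized_51 : IsRealized 51 26 7 := by
  refine isRealized_of_mem (p := eightCodes[1]'(by simp [eightCodes])) (List.getElem_mem _) rfl rfl rfl
    rfl rfl rfl (by decide +kernel) (by decide +kernel) (by decide +kernel)
    dualCertificate_51 rfl isCheckPair_51 isWitness_51 fun e he h0 => ?_
  exact isCheckPair_51.seven_le_sympWeight (m := 14) (M := 11245) (ps := [3, 17]) (by norm_num)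
    (by norm_num) (by decide) mem_of_prime_dvd_51
    ((length_smallErrors _).trans (by decide +kernel)) (by norm_num) smallCheck_51 he h0

/-! ### Length 47 -/

theorem dualCertificate_47 : DualCertificate 47 23 1 16215601 3
    69144678549372
    140737488355327 18461267
    9205487 16215601
    91738423293643 := by
  constructor <;> decide +kernel

theorem isCheckPair_47 : IsCheckPair 32 47 16215601 3
    69144678549372
    139601478984301 73826192935300
    (checkString 32 47 140737488355327
      1205826408219)
    (checkString 32 47 0
      26516273) := by
  constructor <;> decide +kernel

theorem isWitness_47 : IsWitness 47 7 16215601 3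
    69144678549372
    139601478984301 73826192935300
    1419017 48627242001163
    75530247 68786585600
    1 0
    139601478984301 16215601 := by
  constructor <;> decide +kernel

/-- Since 47 is prime, the only periodic strings to exclude are those with all blocks equal. -/
theorem smallCheck_47 : smallCheck 32 47 14 9526 [47]
    (checkString 32 47 140737488355327
      1205826408219)
    (checkString 32 47 0
      26516273) = true := by
  decide +kernel

theorem mem_of_prime_dvd_47 (p : ℕ) (hp : p.Prime) (h : p ∣ 47) : p ∈ [47] := by
  have h1 : p ∈ Nat.primeFactorsList 47 := (Nat.mem_primeFactorsList (by norm_num)).2 ⟨hp, h⟩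
  simpa using h1

theorem isRealized_47 : IsRealized 47 23 7 := by
  refine isRealized_of_mem (p := eightCodes[2]'(by simp [eightCodes])) (List.getElem_mem _) rfl rfl rfl
    rfl rfl rfl (by decide +kernel) (by decide +kernel) (by decide +kernel)
    dualCertificate_47 rfl isCheckPair_47 isWitness_47 fun e he h0 => ?_
  exact isCheckPair_47.seven_le_sympWeight (m := 14) (M := 9526) (ps := [47]) (by norm_num)
    (by norm_num) (by decide) mem_of_prime_dvd_47
    ((length_smallErrors _).trans (by decide +kernel)) (by norm_num) smallCheck_47 he h0

/-! ### Length 55 -/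

theorem dualCertificate_55 : DualCertificate 55 20 10 1894765 2047
    24668642880792042
    52802340526083 51462183867
    46960135 58836173
    12439380621888565 := by
  constructor <;> decide +kernel

theorem isCheckPair_55 : IsCheckPair 32 55 1894765 2047
    24668642880792042
    12829118724931393 23252471919226767
    (checkString 32 55 52802340526083
      5718873975513061)
    (checkString 32 55 34849544747214780
      59552067069) := by
  constructor <;> decide +kernel

theorem isWitness_55 : IsWitness 55 8 1894765 2047
    24668642880792042
    12829118724931393 23252471919226767
    14647733896 30297985514836
    393314 4398046773317
    4 0
    15287677880761605 7579060 := by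
  constructor <;> decide +kernel

theorem smallCheck_55 : smallCheck 32 55 14 13126 [5, 11]
    (checkString 32 55 52802340526083
      5718873975513061)
    (checkString 32 55 34849544747214780
      59552067069) = true := by
  decide +kernel

theorem windowCheck_55_1 : windowCheck 32 55 23 16 1 [5, 11]
    (checkString 32 55 52802340526083
      5718873975513061)
    (checkString 32 55 34849544747214780
      59552067069) = true := by
  decide +kernel

theorem windowCheck_55_2 : windowCheck 32 55 23 16 2 [5, 11]
    (checkString 32 55 52802340526083
      5718873975513061)
    (checkString 32 55 34849544747214780
      59552067069) = true := by
  decide +kernel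

theorem windowCheck_55_3 : windowCheck 32 55 23 16 3 [5, 11]
    (checkString 32 55 52802340526083
      5718873975513061)
    (checkString 32 55 34849544747214780
      59552067069) = true := by
  decide +kernel

theorem mem_of_prime_dvd_55 (p : ℕ) (hp : p.Prime) (h : p ∣ 55) : p ∈ [5, 11] := by
  have h1 : p ∈ Nat.primeFactorsList 55 := (Nat.mem_primeFactorsList (by norm_num)).2 ⟨hp, h⟩
  simpa using h1

theorem isRealized_55 : IsRealized 55 25 8 := by
  refine isRealized_of_mem (p := eightCodes[3]'(by simp [eightCodes])) (List.getElem_mem _) rfl rfl rfl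
    rfl rfl rfl (by decide +kernel) (by decide +kernel) (by decide +kernel)
    dualCertificate_55 rfl isCheckPair_55 isWitness_55 fun e he h0 => ?_
  have h7 := isCheckPair_55.seven_le_sympWeight (m := 14) (M := 13126) (ps := [5, 11]) (by norm_num)
    (by norm_num) (by decide) mem_of_prime_dvd_55
    ((length_smallErrors _).trans (by decide +kernel)) (by norm_num) smallCheck_55 he h0
  have h8 := isCheckPair_55.sympWeight_ne_seven (m := 16) (ps := [5, 11]) (by norm_num)
    (by norm_num) (by decide) mem_of_prime_dvd_55
    (fun t => by
      rw [length_tripleErrors, length_quadErrors]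
      decide +kernel)
    windowCheck_55_1 windowCheck_55_2 windowCheck_55_3 he
  omega

/-! ### Length 73 -/

theorem dualCertificate_73 : DualCertificate 73 18 10 488055 1963
    6124319032471571136714
    17088278666289722131 60324898718124651
    35911280809229 48562410825025
    7859684806691242844503 := by
  constructor <;> decide +kernel

theorem isCheckPair_73 : IsCheckPair 32 73 488055 1963
    6124319032471571136714
    3025266028088405497166 959230691832896818815
    (checkString 32 73 14469406939832100023
      5688069376418373732235)
    (checkString 32 73 9260086963923649770880
      60324898718124651) := by
  constructor <;> decide +kernel

theorem isWitness_73 : IsWitness 73 7 488055 1963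
    6124319032471571136714
    3025266028088405497166 959230691832896818815
    30194693636144768 1571897452641598673
    274877906955 2308097282928541704
    1 0
    3025266028088405497166 488055 := by
  constructor <;> decide +kernel

theorem smallCheck_73 : smallCheck 32 73 15 23332 [73]
    (checkString 32 73 14469406939832100023
      5688069376418373732235)
    (checkString 32 73 9260086963923649770880
      60324898718124651) = true := by
  decide +kernel

theorem mem_of_prime_dvd_73 (p : ℕ) (hp : p.Prime) (h : p ∣ 73) : p ∈ [73] := by
  have h1 : p ∈ Nat.primeFactorsList 73 := (Nat.mem_primeFactorsList (by norm_num)).2 ⟨hp, h⟩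
  simpa using h1

theorem isRealized_73 : IsRealized 73 45 7 := by
  refine isRealized_of_mem (p := eightCodes[4]'(by simp [eightCodes])) (List.getElem_mem _) rfl rfl rfl
    rfl rfl rfl (by decide +kernel) (by decide +kernel) (by decide +kernel)
    dualCertificate_73 rfl isCheckPair_73 isWitness_73 fun e he h0 => ?_
  exact isCheckPair_73.seven_le_sympWeight (m := 15) (M := 23332) (ps := [73]) (by norm_num)
    (by norm_num) (by decide) mem_of_prime_dvd_73
    ((length_smallErrors _).trans (by decide +kernel)) (by norm_num) smallCheck_73 he h0

/-! ### Length 91 -/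

theorem dualCertificate_91 : DualCertificate 91 12 19 4473 726915
    1934281311383406679529881638
    9388019958627836418077 738075935227986378134225
    2196819096460898437 1450620065385457615
    1276907130664026558015848515 := by
  constructor <;> decide +kernel

theorem isCheckPair_91 : IsCheckPair 32 91 4473 726915
    1934281311383406679529881638
    77371252455336267181343839 851083777008698939016189943
    (checkString 32 91 6792316320773734035071
      99366643304553455115456693)
    (checkString 32 91 1779736148049412475174843697
      657764334276621842567737) := by
  constructor <;> decide +kernel

theorem isWitness_91 : IsWitness 91 7 4473 726915
    1934281311383406679529881638
    77371252455336267181343839 851083777008698939016189943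
    490103245663752420356573 350025110546541055826
    67117065 73786976299200282626
    1 0
    77371252455336267181343839 4473 := by
  constructor <;> decide +kernel

theorem smallCheck_91 : smallCheck 32 91 16 36454 [7, 13]
    (checkString 32 91 6792316320773734035071
      99366643304553455115456693)
    (checkString 32 91 1779736148049412475174843697
      657764334276621842567737) = true := by
  decide +kernel

theorem mem_of_prime_dvd_91 (p : ℕ) (hp : p.Prime) (h : p ∣ 91) : p ∈ [7, 13] := by
  have h1 : p ∈ Nat.primeFactorsList 91 := (Nat.mem_primeFactorsList (by norm_num)).2 ⟨hp, h⟩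
  simpa using h1

theorem isRealized_91 : IsRealized 91 60 7 := by
  refine isRealized_of_mem (p := eightCodes[5]'(by simp [eightCodes])) (List.getElem_mem _) rfl rfl rfl
    rfl rfl rfl (by decide +kernel) (by decide +kernel) (by decide +kernel)
    dualCertificate_91 rfl isCheckPair_91 isWitness_91 fun e he h0 => ?_
  exact isCheckPair_91.seven_le_sympWeight (m := 16) (M := 36454) (ps := [7, 13]) (by norm_num)
    (by norm_num) (by decide) mem_of_prime_dvd_91
    ((length_smallErrors _).trans (by decide +kernel)) (by norm_num) smallCheck_91 he h0

/-! ### Length 93 -/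

theorem dualCertificate_93 : DualCertificate 93 25 5 47537207 55
    1592603117794258474883787048
    513906104783151629653532519 490559234364849320509
    17345562603569341809 10279238419880865039
    7839143957262824298417064615 := by
  constructor <;> decide +kernel

theorem isCheckPair_93 : IsCheckPair 32 93 47537207 55
    1592603117794258474883787048
    4663363336522869413728556143 4028971607272437829574518879
    (checkString 32 93 558468439418340885180961067
      437989126927766092232515007)
    (checkString 32 93 2233873757673363540723844268
      434210551719381761323) := by
  constructor <;> decide +kernel

theorem isWitness_93 : IsWitness 93 7 47537207 55
    1592603117794258474883787048
    4663363336522869413728556143 4028971607272437829574518879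
    270843537926542114604 85682818753259015719472774
    144115188084768803 25690112
    4 0
    8749933031808435455721230781 190148828 := by
  constructor <;> decide +kernel

theorem smallCheck_93 : smallCheck 32 93 16 38083 [3, 31]
    (checkString 32 93 558468439418340885180961067
      437989126927766092232515007)
    (checkString 32 93 2233873757673363540723844268
      434210551719381761323) = true := by
  decide +kernel

theorem mem_of_prime_dvd_93 (p : ℕ) (hp : p.Prime) (h : p ∣ 93) : p ∈ [3, 31] := by
  have h1 : p ∈ Nat.primeFactorsList 93 := (Nat.mem_primeFactorsList (by norm_num)).2 ⟨hp, h⟩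
  simpa using h1

theorem isRealized_93 : IsRealized 93 63 7 := by
  refine isRealized_of_mem (p := eightCodes[6]'(by simp [eightCodes])) (List.getElem_mem _) rfl rfl rfl
    rfl rfl rfl (by decide +kernel) (by decide +kernel) (by decide +kernel)
    dualCertificate_93 rfl isCheckPair_93 isWitness_93 fun e he h0 => ?_
  exact isCheckPair_93.seven_le_sympWeight (m := 16) (M := 38083) (ps := [3, 31]) (by norm_num)
    (by norm_num) (by decide) mem_of_prime_dvd_93
    ((length_smallErrors _).trans (by decide +kernel)) (by norm_num) smallCheck_93 he h0

/-! ### Length 105 -/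

theorem dualCertificate_105 : DualCertificate 105 12 19 4667 1046283
    12755734164796558352560576004628
    140861990488042089185948931 17845113676702934605898262985
    36403496474058829792425 22007446987457955870063
    40213689133882697982575357077375 := by
  constructor <;> decide +kernel

theorem isCheckPair_105 : IsCheckPair 32 105 4667 1046283
    12755734164796558352560576004628
    17350967590623889932986127554808 38901027794503789758430602706901
    (checkString 32 105 116464000888310329429889175
      6030305496288838460812728477297)
    (checkString 32 105 39913419106625345643363447051592
      11418504308471613661342934375) := by
  constructor <;> decide +kernel

theorem isWitness_105 : IsWitness 105 7 4667 1046283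
    12755734164796558352560576004628
    17350967590623889932986127554808 38901027794503789758430602706901
    5135983660100767555350162752 55201591515475264546500465
    1125899906842631 20292313123965953466180804018180
    2 0
    34701935181247779865972255109616 9334 := by
  constructor <;> decide +kernel

theorem smallCheck_105 : smallCheck 32 105 16 48667 [3, 5, 7]
    (checkString 32 105 116464000888310329429889175
      6030305496288838460812728477297)
    (checkString 32 105 39913419106625345643363447051592
      11418504308471613661342934375) = true := by
  decide +kernel

theorem mem_of_prime_dvd_105 (p : ℕ) (hp : p.Prime) (h : p ∣ 105) : p ∈ [3, 5, 7] := by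
  have h1 : p ∈ Nat.primeFactorsList 105 := (Nat.mem_primeFactorsList (by norm_num)).2 ⟨hp, h⟩
  simpa using h1

set_option maxRecDepth 2000 in
theorem isRealized_105 : IsRealized 105 74 7 := by
  refine isRealized_of_mem (p := eightCodes[7]'(by simp [eightCodes])) (List.getElem_mem _) rfl rfl rfl
    rfl rfl rfl (by decide +kernel) (by decide +kernel) (by decide +kernel)
    dualCertificate_105 rfl isCheckPair_105 isWitness_105 fun e he h0 => ?_
  exact isCheckPair_105.seven_le_sympWeight (m := 16) (M := 48667) (ps := [3, 5, 7]) (by norm_num)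
    (by norm_num) (by decide) mem_of_prime_dvd_105
    ((length_smallErrors _).trans (by decide +kernel)) (by norm_num) smallCheck_105 he h0

/-! ### The 36 derived codes -/

theorem mainTheorem6 :
    newCodes.length = 36 ∧
    (newCodes.map fun r => (r.n, r.k, r.d)).Nodup ∧
    (∀ r ∈ newCodes, ∀ p ∈ eightCodes, (r.n, r.k, r.d) ≠ (p.n, p.k, p.d)) ∧
    ∀ r ∈ newCodes,
      (∃ p ∈ eightCodes, ∃ Q₀ : Submodule ℂ (Qubits p.n), ∃ Q : Submodule ℂ (Qubits r.n),
        IsSymplecticConstruction (quasiCyclicCode p.n p.g₁ p.g₂ p.v) Q₀ ∧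
        IsQECC p.n p.k p.d Q₀ ∧ IsPureQECC p.d Q₀ ∧
        Propagates Q₀ r.n Q ∧
        (∃ C : Submodule (ZMod 2) (SympVec r.n), IsSymplecticConstruction C Q) ∧
        IsQECC r.n r.k r.d Q) ∧
      r.known < r.d := by
  refine ⟨rfl, by decide, ?_, ?_⟩
  · intro r hr p hp
    have h1 : (r.n, r.k, r.d) ∈ newCodes.map fun r => (r.n, r.k, r.d) := List.mem_map_of_mem hr
    have h2 : (p.n, p.k, p.d) ∈ eightCodes.map fun p => (p.n, p.k, p.d) := List.mem_map_of_mem hp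
    have h3 : eightCodes.map (fun p => (p.n, p.k, p.d)) = [(45, 16, 8), (51, 26, 7), (47, 23, 7),
      (55, 25, 8), (73, 45, 7), (91, 60, 7), (93, 63, 7), (105, 74, 7)] := rfl
    rw [h3] at h2
    have h4 : ∀ x ∈ newCodes.map fun r => (r.n, r.k, r.d), x ∉ [(45, 16, 8), (51, 26, 7),
        (47, 23, 7), (55, 25, 8), (73, 45, 7), (91, 60, 7), (93, 63, 7), (105, 74, 7)] := by
      decide
    exact fun h => h4 _ h1 (h ▸ h2)
  · simp only [newCodes, List.forall_mem_cons]
    -- In each line the first number counts the passages to a subcode and the second the adjoined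
    -- qubits.
    refine ⟨⟨isRealized_45.propagate 0 1 (by norm_num), by norm_num⟩,
      ⟨isRealized_45.propagate 0 2 (by norm_num), by norm_num⟩,
      ⟨isRealized_47.propagate 0 1 (by norm_num), by norm_num⟩,
      ⟨isRealized_47.propagate 0 2 (by norm_num), by norm_num⟩,
      ⟨isRealized_47.propagate 0 3 (by norm_num), by norm_num⟩,
      ⟨isRealized_51.propagate 3 0 (by norm_num), by norm_num⟩,
      ⟨isRealized_51.propagate 1 0 (by norm_num), by norm_num⟩,
      ⟨isRealized_51.propagate 2 0 (by norm_num), by norm_num⟩,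
      ⟨isRealized_55.propagate 0 1 (by norm_num), by norm_num⟩,
      ⟨isRealized_55.propagate 0 2 (by norm_num), by norm_num⟩,
      ⟨isRealized_73.propagate 1 0 (by norm_num), by norm_num⟩,
      ⟨isRealized_73.propagate 2 0 (by norm_num), by norm_num⟩,
      ⟨isRealized_73.propagate 0 1 (by norm_num), by norm_num⟩,
      ⟨isRealized_73.propagate 1 1 (by norm_num), by norm_num⟩,
      ⟨isRealized_73.propagate 2 1 (by norm_num), by norm_num⟩,
      ⟨isRealized_73.propagate 0 2 (by norm_num), by norm_num⟩,
      ⟨isRealized_73.propagate 1 2 (by norm_num), by norm_num⟩,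
      ⟨isRealized_73.propagate 2 2 (by norm_num), by norm_num⟩,
      ⟨isRealized_73.propagate 0 3 (by norm_num), by norm_num⟩,
      ⟨isRealized_73.propagate 1 3 (by norm_num), by norm_num⟩,
      ⟨isRealized_73.propagate 2 3 (by norm_num), by norm_num⟩,
      ⟨isRealized_73.propagate 0 4 (by norm_num), by norm_num⟩,
      ⟨isRealized_73.propagate 1 4 (by norm_num), by norm_num⟩,
      ⟨isRealized_73.propagate 0 5 (by norm_num), by norm_num⟩,
      ⟨isRealized_91.propagate 1 0 (by norm_num), by norm_num⟩,
      ⟨isRealized_91.propagate 2 0 (by norm_num), by norm_num⟩,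
      ⟨isRealized_91.propagate 0 1 (by norm_num), by norm_num⟩,
      ⟨isRealized_91.propagate 1 1 (by norm_num), by norm_num⟩,
      ⟨isRealized_93.propagate 1 0 (by norm_num), by norm_num⟩,
      ⟨isRealized_93.propagate 0 1 (by norm_num), by norm_num⟩,
      ⟨isRealized_93.propagate 0 2 (by norm_num), by norm_num⟩,
      ⟨isRealized_105.propagate 1 0 (by norm_num), by norm_num⟩,
      ⟨isRealized_105.propagate 0 1 (by norm_num), by norm_num⟩,
      ⟨isRealized_105.propagate 1 1 (by norm_num), by norm_num⟩,
      ⟨isRealized_105.propagate 0 2 (by norm_num), by norm_num⟩,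
      ⟨isRealized_105.propagate 1 2 (by norm_num), by norm_num⟩,
      List.forall_mem_nil _⟩
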